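/- Let $n,k\ge 0$ be integers, and let $S:[0,1]\times\mathbb R\to \mathrm{Mat}(n,\mathbb R)$, $S_\lambda=S(\lambda,\cdot)$, be continuous (in particular, any smooth family is allowed). Assume: (A1) the limits $S_\lambda^{\pm}=\lim_{t\to\pm\infty}S_\lambda(t)$ exist uniformly in $\lambda\in[0,1]$, and for every $\lambda$ the matrices $S^+_\lambda,S^-_\lambda$ are hyperbolic (no eigenvalue on the imaginary axis); (A2) for $\lambda=0$ and $\lambda=1$ the only solution of $u'(t)=S_\lambda(t)u(t)$, $t\in\mathbb R$, with $u(t)\to0$ as $t\to\pm\infty$, is $u\equiv 0$; (A3) for every $\lambda\in[0,1]$, $\dim V^+(S^-_\lambda)=k$ and $\dim V^-(S^+_\lambda)=n-k$, where $V^+(M)$ and $V^-(M)$ are the real spectral subspaces of $M$ for the eigenvalues with positive, respectively negative, real part. For $\tau\in\mathbb R$ let $E^s_\lambda(\tau)$ (resp. $E^u_\lambda(\tau)$) be the space of the values $u(\tau)$ of the solutions $u$ of $u'=S_\lambda u$ on $\mathbb R$ with $u(t)\to0$ as $t\to+\infty$ (resp. $t\to-\infty$). Let $$A_\lambda=\frac{d}{dt}-S_\lambda: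 W^{1,2}(\mathbb R,\mathbb R^n)\to L^2(\mathbb R,\mathbb R^n),$$ and for $\tau>0$ let $A_{\lambda,\tau}$ be the operator $\frac{d}{dt}-S_\lambda$ with values in $L^2([-\tau,\tau],\mathbb R^n)$ and with domain $$E_\lambda(\tau)=\{x\in W^{1,2}([-\tau,\tau],\mathbb R^n): x(-\tau)\in E^u_\lambda(-\tau),\ x(\tau)\in E^s_\lambda(\tau)\}.$$ Parity is defined as follows. Let $X,Y$ be real Hilbert spaces, $D_s\subset X$, $s\in[0,1]$, the ranges of a norm continuous path of bounded projections, and $T_s\in\mathcal L(X,Y)$ a norm continuous path such that every $T_s|_{D_s}:D_s\to Y$ is Fredholm of index $0$ and $T_0|_{D_0}$, $T_1|_{D_1}$ are invertible; call this an admissible path. Choose a finite-dimensional $V\subset Y$ with $T_s(D_s)+V=Y$ for all $s$, and let $E_T\to\mathbb S^1$ be the vector bundle obtained by gluing the bundle over $[0,1]$ with fibres $\{x\in D_s: T_sx\in V\}$ to the trivial bundle with fibre $V$ over a second copy of $[0,1]$, at the endpoints $s=0,1$, by the isomorphisms $T_0$ and $T_1$. The parity of $T$ is $w_1(E_T)\in\mathbb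 Z_2$, that is, $0$ if $E_T$ is orientable and $1$ if not; it does not depend on $V$. Then $\lambda\mapsto A_\lambda$ (with $D_\lambda=W^{1,2}(\mathbb R,\mathbb R^n)$) is an admissible path, and there is $\tau_0>0$ such that for every $\tau\ge\tau_0$ the path $\lambda\mapsto A_{\lambda,\tau}$ (with $D_\lambda=E_\lambda(\tau)\subset W^{1,2}([-\tau,\tau],\mathbb R^n)$) is admissible and $$\operatorname{parity}(A_{\lambda,\tau};\lambda\in[0,1])=\operatorname{parity}(A_\lambda;\lambda\in[0,1]).$$ -/

import Mathlib

open Set Filter Topology MeasureTheory unitInterval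
open scoped ENNReal ContDiff

noncomputable section

/-! ## Sobolev spaces on subsets of the line -/

/-- The Lebesgue space `L²(J, ℝⁿ)`. -/
abbrev L2On (n : ℕ) (J : Set ℝ) : Type :=
  Lp (EuclideanSpace ℝ (Fin n)) 2 (volume.restrict J)

/-- `w` is the weak derivative of `u` on the interior of `J`. -/
def IsWeakDeriv {n : ℕ} (J : Set ℝ) (u w : ℝ → EuclideanSpace ℝ (Fin n)) : Prop :=
  ∀ φ : ℝ → ℝ, ContDiff ℝ ∞ φ → HasCompactSupport φ → tsupport φ ⊆ interior J →
    ∫ t in J, deriv φ t • u t = - ∫ t in J, φ t • w t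

/-- Integration against a continuous function of compact support, as a bounded operator. -/
theorem exists_pairing {n : ℕ} (J : Set ℝ) {φ : ℝ → ℝ} (hc : Continuous φ)
    (hs : HasCompactSupport φ) :
    ∃ L : L2On n J →L[ℝ] EuclideanSpace ℝ (Fin n), ∀ u, L u = ∫ t in J, φ t • u t := by
  have hφ : MemLp φ 2 (volume.restrict J) := (hc.memLp_of_hasCompactSupport hs).restrict J
  refine ⟨(ContinuousLinearMap.lsmul ℝ ℝ).lpPairing (volume.restrict J) 2 2 hφ.toLp, fun u => ?_⟩
  rw [ContinuousLinearMap.lpPairing_eq_integral]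
  refine integral_congr_ae ?_
  filter_upwards [hφ.coeFn_toLp] with t ht
  simp [ht]

/-- For each test function the defining identity of the weak derivative is the vanishing of a
bounded operator. -/
theorem exists_weakDeriv_functional {n : ℕ} (J : Set ℝ) {φ : ℝ → ℝ} (hc : ContDiff ℝ ∞ φ)
    (hs : HasCompactSupport φ) :
    ∃ L : WithLp 2 (L2On n J × L2On n J) →L[ℝ] EuclideanSpace ℝ (Fin n),
      ∀ p, L p = 0 ↔ ∫ t in J, deriv φ t • p.fst t = - ∫ t in J, φ t • p.snd t := by
  obtain ⟨L₁, h₁⟩ := exists_pairing (n := n) J (hc.continuous_deriv (by simp)) hs.deriv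
  obtain ⟨L₂, h₂⟩ := exists_pairing (n := n) J hc.continuous hs
  refine ⟨L₁ ∘L WithLp.fstL 2 ℝ _ _ + L₂ ∘L WithLp.sndL 2 ℝ _ _, fun p => ?_⟩
  rw [← h₁, ← h₂]
  exact add_eq_zero_iff_eq_neg

/-- The Sobolev space `W^{1,2}(J, ℝⁿ)`: the pairs `(u, u')` in `L² × L²` such that `u'` is the weak
derivative of `u`, with the norm `(‖u‖² + ‖u'‖²)^{1/2}`. -/
def W12 (n : ℕ) (J : Set ℝ) : Submodule ℝ (WithLp 2 (L2On n J × L2On n J)) where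
  carrier := {p | IsWeakDeriv J p.fst p.snd}
  zero_mem' := by
    intro φ hc hs _
    obtain ⟨L, hL⟩ := exists_weakDeriv_functional (n := n) J hc hs
    exact (hL 0).1 (map_zero L)
  add_mem' := by
    intro p q hp hq φ hc hs hi
    obtain ⟨L, hL⟩ := exists_weakDeriv_functional (n := n) J hc hs
    refine (hL (p + q)).1 ?_
    rw [map_add, (hL p).2 (hp φ hc hs hi), (hL q).2 (hq φ hc hs hi), add_zero]
  smul_mem' := by
    intro c p hp φ hc hs hi
    obtain ⟨L, hL⟩ := exists_weakDeriv_functional (n := n) J hc hs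
    refine (hL (c • p)).1 ?_
    rw [map_smul, (hL p).2 (hp φ hc hs hi), smul_zero]

theorem isClosed_W12 (n : ℕ) (J : Set ℝ) :
    IsClosed (W12 n J : Set (WithLp 2 (L2On n J × L2On n J))) := by
  rw [← isSeqClosed_iff_isClosed]
  intro x p hx hp φ hc hs hi
  obtain ⟨L, hL⟩ := exists_weakDeriv_functional (n := n) J hc hs
  refine (hL p).1 ?_
  have h0 : ∀ j, L (x j) = 0 := fun j => (hL (x j)).2 (hx j φ hc hs hi)
  have h1 := (L.continuous.tendsto p).comp hp
  simp only [Function.comp_def, h0] at h1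
  exact (tendsto_nhds_unique h1 tendsto_const_nhds)

instance instCompleteSpaceW12 (n : ℕ) (J : Set ℝ) : CompleteSpace (W12 n J) :=
  (isClosed_W12 n J).completeSpace_coe

/-! ## Asymptotically hyperbolic families of linear systems -/

/-- A real matrix is hyperbolic if it has no eigenvalue on the imaginary axis. -/
def IsHyperbolic {n : ℕ} (M : Matrix (Fin n) (Fin n) ℝ) : Prop :=
  ∀ z ∈ spectrum ℂ (M.map (algebraMap ℝ ℂ)), z.re ≠ 0

/-- The inclusion of `ℝⁿ` into its complexification `ℂⁿ`. -/
def complexify (n : ℕ) : EuclideanSpace ℝ (Fin n) →ₗ[ℝ] (Fin n → ℂ) where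
  toFun v i := (v i : ℂ)
  map_add' v w := by ext i; simp
  map_smul' c v := by ext i; simp

/-- The real spectral subspace of `M` for the part of the spectrum in `s`: the real vectors in the
sum of the complex generalized eigenspaces for the eigenvalues in `s` (for `s` invariant under
conjugation). -/
def spectralSubspace {n : ℕ} (M : Matrix (Fin n) (Fin n) ℝ) (s : Set ℂ) :
    Submodule ℝ (EuclideanSpace ℝ (Fin n)) :=
  ((⨆ z ∈ s, Module.End.maxGenEigenspace (Matrix.toLin' (M.map (algebraMap ℝ ℂ))) z).restrictScalars
    ℝ).comap (complexify n)

/-- The negative spectral space `V⁻(M)`. -/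
def negSpace {n : ℕ} (M : Matrix (Fin n) (Fin n) ℝ) : Submodule ℝ (EuclideanSpace ℝ (Fin n)) :=
  spectralSubspace M {z | z.re < 0}

/-- The positive spectral space `V⁺(M)`. -/
def posSpace {n : ℕ} (M : Matrix (Fin n) (Fin n) ℝ) : Submodule ℝ (EuclideanSpace ℝ (Fin n)) :=
  spectralSubspace M {z | 0 < z.re}

/-- A continuous family of matrix functions `S_l(t)`, `l ∈ [0,1]`, `t ∈ ℝ`, with limits
`Sp l` at `+∞` and `Sm l` at `-∞` which are uniform in `l` and hyperbolic. -/
structure AsympHyperbolic {n : ℕ} (S : I → ℝ → Matrix (Fin n) (Fin n) ℝ)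
    (Sp Sm : I → Matrix (Fin n) (Fin n) ℝ) : Prop where
  continuous : Continuous fun q : I × ℝ => S q.1 q.2
  tendsto_atTop : TendstoUniformly (fun t l => S l t) Sp atTop
  tendsto_atBot : TendstoUniformly (fun t l => S l t) Sm atBot
  hyperbolic_atTop : ∀ l, IsHyperbolic (Sp l)
  hyperbolic_atBot : ∀ l, IsHyperbolic (Sm l)

/-- `u` is a solution on the whole line of `u' = M(t) u`. -/
def IsSolution {n : ℕ} (M : ℝ → Matrix (Fin n) (Fin n) ℝ) (u : ℝ → EuclideanSpace ℝ (Fin n)) :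
    Prop :=
  ∀ t, HasDerivAt u (Matrix.toEuclideanCLM (𝕜 := ℝ) (M t) (u t)) t

/-- The only solution of `u' = M(t) u` which tends to zero at `±∞` is `u = 0`. -/
def OnlyTrivialSolution {n : ℕ} (M : ℝ → Matrix (Fin n) (Fin n) ℝ) : Prop :=
  ∀ u : ℝ → EuclideanSpace ℝ (Fin n), IsSolution M u →
    Tendsto u atTop (𝓝 0) → Tendsto u atBot (𝓝 0) → u = 0

/-- The initial values at time `τ` of the solutions that tend to zero along the filter `l`. -/
def decayingSpace {n : ℕ} (M : ℝ → Matrix (Fin n) (Fin n) ℝ) (l : Filter ℝ) (τ : ℝ) :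
    Submodule ℝ (EuclideanSpace ℝ (Fin n)) where
  carrier := {v | ∃ u, IsSolution M u ∧ u τ = v ∧ Tendsto u l (𝓝 0)}
  zero_mem' := ⟨0, fun t => by simp,
    rfl, tendsto_const_nhds⟩
  add_mem' := by
    rintro _ _ ⟨u, hu, rfl, hu0⟩ ⟨w, hw, rfl, hw0⟩
    refine ⟨u + w, fun t => ?_, rfl, by
      have h := hu0.add hw0
      rwa [add_zero] at h⟩
    simpa using (hu t).add (hw t)
  smul_mem' := by
    rintro c _ ⟨u, hu, rfl, hu0⟩
    refine ⟨c • u, fun t => ?_, rfl, by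
      have h := hu0.const_smul c
      rwa [smul_zero] at h⟩
    simpa using (hu t).const_smul c

/-- The stable subspace `E^s(τ)`. -/
def stableSpace {n : ℕ} (M : ℝ → Matrix (Fin n) (Fin n) ℝ) (τ : ℝ) :
    Submodule ℝ (EuclideanSpace ℝ (Fin n)) :=
  decayingSpace M atTop τ

/-- The unstable subspace `E^u(τ)`. -/
def unstableSpace {n : ℕ} (M : ℝ → Matrix (Fin n) (Fin n) ℝ) (τ : ℝ) :
    Submodule ℝ (EuclideanSpace ℝ (Fin n)) :=
  decayingSpace M atBot τ

/-! ## The differential operators -/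

/-- Each `S_l` is a bounded measurable function. -/
theorem AsympHyperbolic.memLp {n : ℕ} {S : I → ℝ → Matrix (Fin n) (Fin n) ℝ}
    {Sp Sm : I → Matrix (Fin n) (Fin n) ℝ} (hS : AsympHyperbolic S Sp Sm) (l : I) (J : Set ℝ) :
    MemLp (fun t => Matrix.toEuclideanCLM (𝕜 := ℝ) (S l t)) ∞ (volume.restrict J) := by
  have hF : Continuous (fun M : Matrix (Fin n) (Fin n) ℝ => Matrix.toEuclideanCLM (𝕜 := ℝ) M) :=
    (Matrix.toEuclideanCLM (n := Fin n) (𝕜 := ℝ)).toAlgEquiv.toLinearMap.continuous_of_finiteDimensional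
  have hc : Continuous fun t => Matrix.toEuclideanCLM (𝕜 := ℝ) (S l t) :=
    hF.comp (hS.continuous.comp (by fun_prop : Continuous fun t : ℝ => (l, t)))
  have h1 := (hF.tendsto _).comp (hS.tendsto_atTop.tendsto_at l)
  have h2 := (hF.tendsto _).comp (hS.tendsto_atBot.tendsto_at l)
  obtain ⟨C₁, hC₁⟩ := h1.norm.isBoundedUnder_le
  obtain ⟨C₂, hC₂⟩ := h2.norm.isBoundedUnder_le
  rw [eventually_map] at hC₁ hC₂
  obtain ⟨a, ha⟩ := eventually_atTop.1 hC₁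
  obtain ⟨b, hb⟩ := eventually_atBot.1 hC₂
  obtain ⟨C₃, hC₃⟩ := (isCompact_Icc (a := b) (b := a)).exists_bound_of_continuousOn hc.continuousOn
  refine memLp_top_of_bound hc.aestronglyMeasurable (max (max C₁ C₂) C₃) (.of_forall fun t => ?_)
  rcases le_total a t with h | h
  · exact (ha t h).trans ((le_max_left _ _).trans (le_max_left _ _))
  rcases le_total t b with h' | h'
  · exact (hb t h').trans ((le_max_right _ _).trans (le_max_left _ _))
  · exact (hC₃ t ⟨h', h⟩).trans (le_max_right _ _)

/-- Multiplication of an `L²` function by an essentially bounded operator-valued function. -/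
def mulOp {n : ℕ} {J : Set ℝ}
    {M : ℝ → EuclideanSpace ℝ (Fin n) →L[ℝ] EuclideanSpace ℝ (Fin n)}
    (hM : MemLp M ∞ (volume.restrict J)) : L2On n J →L[ℝ] L2On n J :=
  (ContinuousLinearMap.id ℝ (EuclideanSpace ℝ (Fin n) →L[ℝ] EuclideanSpace ℝ (Fin n))).holderL
    (volume.restrict J) ∞ 2 2 hM.toLp

/-- The operator `u ↦ u' - S_l u` from `W^{1,2}(J, ℝⁿ)` to `L²(J, ℝⁿ)`. -/
def diffOp {n : ℕ} {S : I → ℝ → Matrix (Fin n) (Fin n) ℝ}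
    {Sp Sm : I → Matrix (Fin n) (Fin n) ℝ} (hS : AsympHyperbolic S Sp Sm) (J : Set ℝ) (l : I) :
    W12 n J →L[ℝ] L2On n J :=
  (WithLp.sndL 2 ℝ _ _ - mulOp (hS.memLp l J) ∘L WithLp.fstL 2 ℝ _ _) ∘L (W12 n J).subtypeL

/-- The space of `x ∈ W^{1,2}([-τ, τ], ℝⁿ)` with `x(-τ) ∈ E^u(-τ)` and `x(τ) ∈ E^s(τ)`, the boundary
values being those of the continuous representative of `x`. -/
def boundaryDomain {n : ℕ} (M : ℝ → Matrix (Fin n) (Fin n) ℝ) (τ : ℝ) :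
    Submodule ℝ (W12 n (Icc (-τ) τ)) where
  carrier := {x | ∃ f : ℝ → EuclideanSpace ℝ (Fin n), ContinuousOn f (Icc (-τ) τ) ∧
    x.1.fst =ᵐ[volume.restrict (Icc (-τ) τ)] f ∧
    f (-τ) ∈ unstableSpace M (-τ) ∧ f τ ∈ stableSpace M τ}
  zero_mem' := ⟨0, continuousOn_const, Lp.coeFn_zero _ _ _, zero_mem _, zero_mem _⟩
  add_mem' := by
    rintro x y ⟨f, hf, hxf, hfu, hfs⟩ ⟨g, hg, hyg, hgu, hgs⟩
    exact ⟨f + g, hf.add hg, (Lp.coeFn_add _ _).trans (hxf.add hyg), add_mem hfu hgu,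
      add_mem hfs hgs⟩
  smul_mem' := by
    rintro c x ⟨f, hf, hxf, hfu, hfs⟩
    exact ⟨c • f, hf.const_smul c, (Lp.coeFn_smul _ _).trans (hxf.const_smul c),
      Submodule.smul_mem _ c hfu, Submodule.smul_mem _ c hfs⟩

/-! ## Parity of paths of Fredholm operators of index zero -/

section Parity

variable {X Y : Type*} [NormedAddCommGroup X] [InnerProductSpace ℝ X] [CompleteSpace X]
  [NormedAddCommGroup Y] [InnerProductSpace ℝ Y] [CompleteSpace Y]

/-- A continuous path of Fredholm operators of index zero with invertible endpoints. The domain of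
the operator at time `s` is a closed subspace `D s` of a fixed Hilbert space `X`, and the spaces
`D s` vary continuously: they are the ranges of a norm continuous path of bounded projections. -/
structure IsFredholmPath (D : I → Submodule ℝ X) (T : I → X →L[ℝ] Y) : Prop where
  continuous : Continuous T
  continuous_domain : ∃ P : I → X →L[ℝ] X, Continuous P ∧
    ∀ s, (∀ x, P s x ∈ D s) ∧ ∀ x ∈ D s, P s x = x
  fredholm : ∀ s, ((T s) ∘L (D s).subtypeL).IsFredholm
  index_zero : ∀ s, Module.finrank ℝ ((T s) ∘L (D s).subtypeL).ker =
    Module.finrank ℝ (Y ⧸ ((T s) ∘L (D s).subtypeL).range)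
  invertible_zero : Function.Bijective ((T 0) ∘L (D 0).subtypeL)
  invertible_one : Function.Bijective ((T 1) ∘L (D 1).subtypeL)

/-- The finite-dimensional subspace `V` satisfies `Ran T(s) + V = Y` for all `s`. -/
def IsTransverse (D : I → Submodule ℝ X) (T : I → X →L[ℝ] Y) (V : Submodule ℝ Y) : Prop :=
  FiniteDimensional ℝ V ∧ ∀ s, (D s).map (T s : X →ₗ[ℝ] Y) ⊔ V = ⊤

/-- The fibre `T(s)⁻¹(V)`. -/
def indexFibre (D : I → Submodule ℝ X) (T : I → X →L[ℝ] Y) (V : Submodule ℝ Y) (s : I) :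
    Submodule ℝ X :=
  D s ⊓ V.comap (T s : X →ₗ[ℝ] Y)

/-- A continuous orientation of a rank `m` bundle over `[0,1]` whose fibres are subspaces `F s` of a
fixed space: locally it is the orientation of a continuous frame. -/
def IsContinuousOrientation {Z : Type*} [NormedAddCommGroup Z] [InnerProductSpace ℝ Z] {m : ℕ}
    (F : I → Submodule ℝ Z) (o : ∀ s, Orientation ℝ (F s) (Fin m)) : Prop :=
  ∀ s₀, ∃ U ∈ 𝓝 s₀, ∃ e : Fin m → I → Z, (∀ i, ContinuousOn (e i) U) ∧
    ∀ s ∈ U, ∃ b : Module.Basis (Fin m) ℝ (F s), (∀ i, (b i : Z) = e i s) ∧ b.orientation = o s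

/-- Orientability of the bundle `E_T` over the circle obtained by gluing the bundle with fibres
`T(s)⁻¹(V)` over one copy of `[0,1]` to the bundle with fibre `V` over a second copy, at the two
endpoints, by the isomorphisms `T(0)` and `T(1)`. -/
def ClutchingOrientable (D : I → Submodule ℝ X) (T : I → X →L[ℝ] Y) (V : Submodule ℝ Y) : Prop :=
  ∃ (oE : ∀ s, Orientation ℝ (indexFibre D T V s) (Fin (Module.finrank ℝ V)))
    (oV : I → Orientation ℝ V (Fin (Module.finrank ℝ V))),
    IsContinuousOrientation (indexFibre D T V) oE ∧
    IsContinuousOrientation (fun _ => V) oV ∧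
    ∀ s, s = 0 ∨ s = 1 → ∃ g : indexFibre D T V s ≃ₗ[ℝ] V,
      (∀ x, (g x : Y) = T s x) ∧ Orientation.map _ g (oE s) = oV s

open Classical in
/-- The parity of a path of Fredholm operators of index zero: the first Stiefel-Whitney class of the
bundle `E_T` over the circle, which is `0` if that bundle is orientable and `1` if not. This does not
depend on the choice of the transverse subspace `V`. -/
def parity (D : I → Submodule ℝ X) (T : I → X →L[ℝ] Y) : ZMod 2 :=
  if ∃ V, IsTransverse D T V ∧ ClutchingOrientable D T V then 0 else 1

end Parity

end

/-! Let `ι` be extension by zero from `L²([-τ,τ])` to `L²(ℝ)`. If `A_λ x` is supported in `[-τ,τ]`,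
then outside the interval `x` is a square-integrable solution of the homogeneous equation. For large
`τ` this says exactly that the boundary values of `x` lie in `E^u_λ(-τ)` and `E^s_λ(τ)`, and `x` is
determined by its restriction. Hence restriction maps `A_λ⁻¹(ι V)` isomorphically onto
`A_{λ,τ}⁻¹(V)` and intertwines the operators. Moreover `ran A_λ + ran ι` is all of `L²(ℝ)`, so `ι V`
is transverse to `A_λ` as soon as `V` is transverse to `A_{λ,τ}`. The two clutching bundles are then
isomorphic. `IsReduction` isolates this situation, `AsympHyperbolic.isReduction` establishes it, and
`IsReduction.parity_eq` draws the conclusion.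

The same correspondence identifies kernels and cokernels, so the Fredholm property on the line is
inherited from the interval. There it is linear algebra: the equation is always solvable, its
solutions form an `n`-dimensional space, and the boundary values are confined to a subspace of `ℝ²ⁿ`
of dimension `k + (n - k) = n` (`LinearMap.index_restrict_comap`).

The parity itself becomes computable because bundles over `[0,1]` have global frames: orientability
is the positivity of a product of two determinants (`clutchingOrientable_iff`), and this sign does
not change when `V` is enlarged (`IsFredholmPath.clutchingOrientable_iff_of_le`).

The analysis rests on Lyapunov forms, that is, symmetric `H` with `⟨Hv, av⟩ ≥ c‖v‖²`. Since `⟨Hu,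
u'⟩` integrates to zero on the line, such a form makes `u' - au` invertible (`bijective_coeffOp`).
This replaces the usual theory of exponential dichotomies: inverting the operator gives global
solutions, complementary stable and unstable spaces, and their continuous dependence on `λ`
(`exists_splitting`). Hyperbolic matrices have Lyapunov forms that survive small perturbations, so
compactness of `[0,1]` yields one `τ₀` beyond which they are valid for all `λ`. -/

noncomputable section

/-! ### Orientations of bundles over an interval, and orientability as a sign of determinants. -/

open scoped RealInnerProductSpace in
/-- The cross Gram determinant of a basis with another family. -/
theorem det_inner_basis {Z : Type*} [NormedAddCommGroup Z] [InnerProductSpace ℝ Z] {ι : Type*}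
    [Fintype ι] [DecidableEq ι] {F : Submodule ℝ Z} (b : Module.Basis ι ℝ F) (v : ι → F) :
    ∃ c > 0, (Matrix.of fun i j => ⟪(b i : Z), (v j : Z)⟫).det = c * b.det v := by
  -- The cross Gram matrix is the Gram matrix of `b` times the coordinate matrix of `v`. It has the
  -- same sign of determinant as the latter, but is visibly continuous in the ambient vectors even
  -- when the subspace moves.
  refine ⟨(Matrix.gram ℝ fun i => (b i : Z)).det, ?_, ?_⟩
  · have hli : LinearIndependent ℝ fun i => (b i : Z) :=
      b.linearIndependent.map' F.subtype (Submodule.ker_subtype F)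
    exact (Matrix.posDef_gram_of_linearIndependent hli).det_pos
  · rw [Module.Basis.det_apply, ← Matrix.det_mul]
    congr 1
    ext i j
    have h : (v j : Z) = ∑ k, b.toMatrix v k j • (b k : Z) := by
      conv_lhs => rw [← b.sum_toMatrix_smul_self v j]
      simp only [Submodule.coe_sum, Submodule.coe_smul]
    simp only [Matrix.of_apply, Matrix.mul_apply, Matrix.gram_apply]
    rw [h, inner_sum]
    refine Finset.sum_congr rfl fun k _ => ?_
    rw [inner_smul_right, mul_comm]

/-- A continuous orientation of a bundle with a global frame is that of the frame or its
opposite. -/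
theorem IsContinuousOrientation.eq_or_eq_neg {Z : Type*} [NormedAddCommGroup Z]
    [InnerProductSpace ℝ Z] {m : ℕ} {F : I → Submodule ℝ Z}
    {o : ∀ s, Orientation ℝ (F s) (Fin m)} (ho : IsContinuousOrientation F o)
    (b : ∀ s, Module.Basis (Fin m) ℝ (F s)) (hb : ∀ i, Continuous fun s => (b s i : Z)) :
    (∀ s, o s = (b s).orientation) ∨ ∀ s, o s = -(b s).orientation := by
  -- Agreement with the global frame is the sign of a continuous nonvanishing function near each
  -- point, hence locally constant; connectedness of `[0,1]` finishes.
  have key : ∀ s₀, ∀ᶠ s in 𝓝 s₀, (o s = (b s).orientation ↔ o s₀ = (b s₀).orientation) := by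
    intro s₀
    obtain ⟨U, hU, e, he, hbe⟩ := ho s₀
    set G : I → ℝ := fun s => (Matrix.of fun i j => inner ℝ (b s i : Z) (e j s)).det with hG
    have hGs : ∀ s ∈ U, G s ≠ 0 ∧ (o s = (b s).orientation ↔ 0 < G s) := by
      intro s hs
      obtain ⟨b', hb', hor⟩ := hbe s hs
      obtain ⟨c, hc, hdet⟩ := det_inner_basis (b s) b'
      have h1 : G s = c * (b s).det b' := by
        rw [hG, ← hdet]
        simp only [hb']
      rw [h1, ← hor, eq_comm, Module.Basis.orientation_eq_iff_det_pos]
      refine ⟨mul_ne_zero hc.ne' ((b s).isUnit_det b').ne_zero, ?_⟩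
      rw [mul_pos_iff_of_pos_left hc]
    have hcont : ContinuousAt G s₀ := by
      have : ContinuousOn G U := by
        refine (continuous_id.matrix_det (R := ℝ)).comp_continuousOn ?_
        refine continuousOn_pi.2 fun i => continuousOn_pi.2 fun j => ?_
        exact (hb i).continuousOn.inner (he j)
      exact this.continuousAt hU
    have hs₀ := hGs s₀ (mem_of_mem_nhds hU)
    rcases lt_or_gt_of_ne hs₀.1 with h | h
    · filter_upwards [hU, hcont.eventually (gt_mem_nhds h)] with s hs hlt
      rw [(hGs s hs).2, hs₀.2]
      constructor <;> intro h' <;> linarith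
    · filter_upwards [hU, hcont.eventually (lt_mem_nhds h)] with s hs hlt
      rw [(hGs s hs).2, hs₀.2]
      exact ⟨fun _ => h, fun _ => hlt⟩
  have hclopen : IsClopen {s | o s = (b s).orientation} := by
    constructor
    · rw [← isOpen_compl_iff, isOpen_iff_mem_nhds]
      intro s hs
      filter_upwards [key s] with s' hs' h
      exact hs (hs'.1 h)
    · rw [isOpen_iff_mem_nhds]
      intro s hs
      filter_upwards [key s] with s' hs'
      exact hs'.2 hs
  rcases isClopen_iff.1 hclopen with h | h
  · right
    intro s
    rcases (b s).orientation_eq_or_eq_neg (o s) with h' | h'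
    · exact absurd h' (Set.eq_empty_iff_forall_notMem.1 h s)
    · exact h'
  · left
    intro s
    have : s ∈ {s | o s = (b s).orientation} := h ▸ mem_univ s
    exact this

theorem isContinuousOrientation_of_frame {Z : Type*} [NormedAddCommGroup Z]
    [InnerProductSpace ℝ Z] {m : ℕ} {F : I → Submodule ℝ Z}
    (b : ∀ s, Module.Basis (Fin m) ℝ (F s)) (hb : ∀ i, Continuous fun s => (b s i : Z)) :
    IsContinuousOrientation F fun s => (b s).orientation :=
  fun _ => ⟨univ, univ_mem, fun i s => (b s i : Z), fun i => (hb i).continuousOn,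
    fun s _ => ⟨b s, fun _ => rfl, rfl⟩⟩

section Parity

variable {X Y : Type*} [NormedAddCommGroup X] [InnerProductSpace ℝ X]
  [NormedAddCommGroup Y] [InnerProductSpace ℝ Y]

/-- The operator `T s` as a map from the fibre `T(s)⁻¹(V)` to `V`. -/
def indexMap (D : I → Submodule ℝ X) (T : I → X →L[ℝ] Y) (V : Submodule ℝ Y) (s : I) :
    indexFibre D T V s →ₗ[ℝ] V :=
  ((T s : X →ₗ[ℝ] Y) ∘ₗ (indexFibre D T V s).subtype).codRestrict V fun x => x.2.2

@[simp]
theorem coe_indexMap (D : I → Submodule ℝ X) (T : I → X →L[ℝ] Y) (V : Submodule ℝ Y) (s : I)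
    (x : indexFibre D T V s) : (indexMap D T V s x : Y) = T s x := rfl

/-- Over each of the two arcs there are only two continuous orientations, plus or minus that of a
global frame. A pair of them is compatible with both gluings exactly when the two gluing matrices
have determinants of the same sign. -/
theorem clutchingOrientable_iff_fin {D : I → Submodule ℝ X} {T : I → X →L[ℝ] Y}
    {V : Submodule ℝ Y}
    (hinj : ∀ s, s = 0 ∨ s = 1 → Function.Injective (indexMap D T V s))
    (b : ∀ s, Module.Basis (Fin (Module.finrank ℝ V)) ℝ (indexFibre D T V s))
    (hb : ∀ i, Continuous fun s => (b s i : X))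
    (bV : Module.Basis (Fin (Module.finrank ℝ V)) ℝ V) :
    ClutchingOrientable D T V ↔
      0 < bV.det (indexMap D T V 0 ∘ b 0) * bV.det (indexMap D T V 1 ∘ b 1) := by
  constructor
  · rintro ⟨oE, oV, hE, hV, hg⟩
    have h1 := hE.eq_or_eq_neg b hb
    have h2 := hV.eq_or_eq_neg (fun _ => bV) (fun _ => continuous_const)
    have h3 : ∀ s, s = 0 ∨ s = 1 → bV.det (indexMap D T V s ∘ b s) ≠ 0 ∧
        (0 < bV.det (indexMap D T V s ∘ b s) ↔
        (oE s = (b s).orientation ↔ oV s = bV.orientation)) := by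
      intro s hs
      obtain ⟨g, hgT, hor⟩ := hg s hs
      have h4 : indexMap D T V s ∘ b s = (b s).map g := by
        ext i
        simp [hgT]
      rw [h4]
      refine ⟨(bV.isUnit_det _).ne_zero, ?_⟩
      rw [← Module.Basis.orientation_eq_iff_det_pos, ← hor, Module.Basis.orientation_map]
      rcases (b s).orientation_eq_or_eq_neg (oE s) with h | h
      · rw [h]
        simp [eq_comm]
      · have hne : (b s).orientation ≠ -(b s).orientation := Module.Ray.ne_neg_self _
        rw [h, Orientation.map_neg, ← Module.Basis.orientation_map]
        have := ((b s).map g).orientation_eq_or_eq_neg bV.orientation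
        have hne' : ((b s).map g).orientation ≠ -((b s).map g).orientation :=
          Module.Ray.ne_neg_self _
        rcases this with h5 | h5
        · simp [h5, hne.symm, hne'.symm]
        · simp [h5, hne.symm, hne'.symm]
    obtain ⟨hn0, h0⟩ := h3 0 (Or.inl rfl)
    obtain ⟨hn1, h1'⟩ := h3 1 (Or.inr rfl)
    have hsame : 0 < bV.det (indexMap D T V 0 ∘ b 0) ↔ 0 < bV.det (indexMap D T V 1 ∘ b 1) := by
      rw [h0, h1']
      have hne : ∀ s, (b s).orientation ≠ -(b s).orientation := fun s => Module.Ray.ne_neg_self _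
      have hneV : bV.orientation ≠ -bV.orientation := Module.Ray.ne_neg_self _
      rcases h1 with h1 | h1 <;> rcases h2 with h2 | h2 <;>
        simp [h1, h2, (hne _).symm, hneV.symm]
    rcases lt_or_gt_of_ne hn0 with h | h
    · refine mul_pos_of_neg_of_neg h (lt_of_le_of_ne (not_lt.1 fun h' => ?_) hn1)
      exact absurd (hsame.2 h') h.not_gt
    · exact mul_pos h (hsame.1 h)
  · intro hpos
    have hbij : ∀ s, s = 0 ∨ s = 1 → Function.Bijective (indexMap D T V s) := fun s hs => by
      have : FiniteDimensional ℝ V := bV.finiteDimensional_of_finite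
      have : FiniteDimensional ℝ (indexFibre D T V s) := (b s).finiteDimensional_of_finite
      refine ⟨hinj s hs, (LinearMap.injective_iff_surjective_of_finrank_eq_finrank ?_).1
        (hinj s hs)⟩
      rw [Module.finrank_eq_card_basis (b s), Fintype.card_fin]
    let g := fun s hs => LinearEquiv.ofBijective (indexMap D T V s) (hbij s hs)
    have hgb : ∀ s hs, ⇑((b s).map (g s hs)) = indexMap D T V s ∘ b s := fun s hs => by
      ext i; simp [g]
    -- The constant orientation of `V` is transported from the fibre at `0`, so compatibility at `0`
    -- is automatic and the sign condition is what gives it at `1`.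
    let b' := (b 0).map (g 0 (Or.inl rfl))
    refine ⟨fun s => (b s).orientation, fun _ => b'.orientation,
      isContinuousOrientation_of_frame b hb,
      isContinuousOrientation_of_frame (fun _ => b') fun _ => continuous_const, ?_⟩
    intro s hs
    refine ⟨g s hs, fun x => rfl, ?_⟩
    rw [← Module.Basis.orientation_map]
    rcases hs with rfl | rfl
    · rfl
    · rw [eq_comm, Module.Basis.orientation_eq_iff_det_pos]
      rw [← hgb 0 (Or.inl rfl), ← hgb 1 (Or.inr rfl)] at hpos
      have h6 : bV.det ((b 1).map (g 1 (Or.inr rfl))) =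
          bV.det b' * b'.det ((b 1).map (g 1 (Or.inr rfl))) := by
        simp only [Module.Basis.det_apply]
        rw [← Matrix.det_mul, Module.Basis.toMatrix_mul_toMatrix]
      rw [h6, ← mul_assoc] at hpos
      exact pos_of_mul_pos_right hpos (mul_self_nonneg _)

theorem clutchingOrientable_iff {ι : Type*} [Fintype ι] [DecidableEq ι] {D : I → Submodule ℝ X}
    {T : I → X →L[ℝ] Y} {V : Submodule ℝ Y}
    (hinj : ∀ s, s = 0 ∨ s = 1 → Function.Injective (indexMap D T V s))
    (b : ∀ s, Module.Basis ι ℝ (indexFibre D T V s))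
    (hb : ∀ i, Continuous fun s => (b s i : X)) (bV : Module.Basis ι ℝ V) :
    ClutchingOrientable D T V ↔
      0 < bV.det (indexMap D T V 0 ∘ b 0) * bV.det (indexMap D T V 1 ∘ b 1) := by
  let f : ι ≃ Fin (Module.finrank ℝ V) :=
    Fintype.equivFinOfCardEq (Module.finrank_eq_card_basis bV).symm
  rw [clutchingOrientable_iff_fin hinj (fun s => (b s).reindex f) (fun i => by simpa using hb _)
    (bV.reindex f)]
  have h : ∀ s, (bV.reindex f).det (indexMap D T V s ∘ (b s).reindex f) =
      bV.det (indexMap D T V s ∘ b s) := by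
    intro s
    rw [Module.Basis.det_reindex]
    congr 1
    ext i
    simp
  rw [h, h]

end Parity

end


/-! ### Global frames of index bundles and existence of transverse subspaces. -/

noncomputable section

/-- Local frames of a family of subspaces over `[0,1]` can be patched to a global frame. -/
theorem exists_global_frame {Z : Type*} [NormedAddCommGroup Z] [InnerProductSpace ℝ Z] {ι : Type*}
    [Fintype ι] [DecidableEq ι] {F : I → Submodule ℝ Z}
    (h : ∀ s₀, ∃ U ∈ 𝓝 s₀, ∃ e : ι → I → Z, (∀ i, ContinuousOn (e i) U) ∧
      ∀ s ∈ U, ∃ b : Module.Basis ι ℝ (F s), ∀ i, (b i : Z) = e i s) :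
    ∃ b : ∀ s, Module.Basis ι ℝ (F s), ∀ i, Continuous fun s => (b s i : Z) := by
  choose U hU e he using h
  -- A subdivision fine enough for each piece to lie in one trivialising set; the frame is extended
  -- piece by piece.
  obtain ⟨t, ht0, htm, ⟨N, hN⟩, htc⟩ := exists_monotone_Icc_subset_open_cover_unitInterval
    (c := fun s => interior (U s)) (fun s => isOpen_interior)
    (fun s _ => mem_iUnion.2 ⟨s, mem_interior_iff_mem_nhds.2 (hU s)⟩)
  have key : ∀ k, ∃ e : ι → I → Z, (∀ i, ContinuousOn (e i) (Icc 0 (t k))) ∧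
      ∀ s ∈ Icc 0 (t k), ∃ b : Module.Basis ι ℝ (F s), ∀ i, (b i : Z) = e i s := by
    intro k
    induction k with
    | zero =>
      rw [ht0, Icc_self]
      refine ⟨e 0, fun i => continuousOn_singleton _ _, fun s hs => (he 0).2 s ?_⟩
      rw [mem_singleton_iff] at hs
      rw [hs]
      exact mem_of_mem_nhds (hU 0)
    | succ k ih =>
      obtain ⟨f, hf, hfb⟩ := ih
      obtain ⟨s₁, hs₁⟩ := htc k
      have h0k : (0 : I) ≤ t k := unitInterval.nonneg'
      have hk : t k ≤ t (k + 1) := htm (Nat.le_succ k)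
      obtain ⟨B, hB⟩ := hfb (t k) ⟨h0k, le_rfl⟩
      have hsub : Icc (t k) (t (k + 1)) ⊆ U s₁ := hs₁.trans interior_subset
      obtain ⟨B', hB'⟩ := (he s₁).2 (t k) (hsub ⟨le_rfl, hk⟩)
      set C := B'.toMatrix B with hC
      -- Beyond `t k` the next local frame is multiplied by the constant change of basis at `t k`,
      -- so that the two pieces match there.
      let f' : ι → I → Z := fun i s => if s ≤ t k then f i s else ∑ j, C j i • e s₁ j s
      have hf1 : ∀ i, ∀ s ∈ Icc 0 (t k), f' i s = f i s := fun i s hs => if_pos hs.2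
      have hf2 : ∀ i, ∀ s ∈ Icc (t k) (t (k + 1)), f' i s = ∑ j, C j i • e s₁ j s := by
        intro i s hs
        rcases hs.1.eq_or_lt with h | h
        · subst h
          rw [hf1 i _ ⟨h0k, le_rfl⟩, ← hB, ← B'.sum_toMatrix_smul_self B i]
          simp only [Submodule.coe_sum, Submodule.coe_smul, hB', hC]
        · exact if_neg h.not_ge
      refine ⟨f', fun i => ?_, fun s hs => ?_⟩
      · rw [← Icc_union_Icc_eq_Icc h0k hk]
        refine ContinuousOn.union_of_isClosed ((hf i).congr (hf1 i)) (ContinuousOn.congr ?_ (hf2 i))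
          isClosed_Icc isClosed_Icc
        exact continuousOn_finsetSum _ fun j _ => (((he s₁).1 j).mono hsub).const_smul _
      · rcases le_total s (t k) with h | h
        · obtain ⟨b, hb⟩ := hfb s ⟨hs.1, h⟩
          exact ⟨b, fun i => by rw [hb, hf1 i s ⟨hs.1, h⟩]⟩
        · obtain ⟨b, hb⟩ := (he s₁).2 s (hsub ⟨h, hs.2⟩)
          refine ⟨B.map (B'.equiv b (Equiv.refl ι)), fun i => ?_⟩
          rw [hf2 i s ⟨h, hs.2⟩, Module.Basis.map_apply, ← B'.sum_toMatrix_smul_self B i, map_sum]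
          simp only [map_smul, Module.Basis.equiv_apply, Equiv.refl_apply, Submodule.coe_sum,
            Submodule.coe_smul, hb, hC]
  obtain ⟨f, hf, hfb⟩ := key N
  have huniv : Icc 0 (t N) = univ := by
    rw [hN N le_rfl]
    exact eq_univ_of_forall fun s => ⟨unitInterval.nonneg', unitInterval.le_one'⟩
  rw [huniv] at hf hfb
  choose b hb using fun s => hfb s (mem_univ s)
  exact ⟨b, fun i => by simpa only [hb] using continuousOn_univ.1 (hf i)⟩

/-- In a Hilbert space the kernel has a closed complement, on which `f` is bijective and therefore
boundedly invertible by the open mapping theorem. -/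
theorem exists_rightInverse_of_surjective {X W : Type*} [NormedAddCommGroup X]
    [InnerProductSpace ℝ X] [CompleteSpace X] [NormedAddCommGroup W] [NormedSpace ℝ W]
    [CompleteSpace W] (f : X →L[ℝ] W) (hf : Function.Surjective f) :
    ∃ R : W →L[ℝ] X, f ∘L R = ContinuousLinearMap.id ℝ W := by
  have : CompleteSpace f.ker := f.isClosed_ker.completeSpace_coe
  let g := f ∘L (f.ker)ᗮ.subtypeL
  have hinj : g.ker = ⊥ := by
    rw [LinearMap.ker_eq_bot']
    intro x hx
    have h1 : (x : X) ∈ f.ker := hx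
    have h2 := (f.ker).inf_orthogonal_eq_bot
    have h3 : (x : X) ∈ f.ker ⊓ (f.ker)ᗮ := ⟨h1, x.2⟩
    rw [h2, Submodule.mem_bot] at h3
    exact Subtype.ext h3
  have hsurj : g.range = ⊤ := by
    rw [LinearMap.range_eq_top]
    intro w
    obtain ⟨x, rfl⟩ := hf w
    obtain ⟨y, hy, z, hz, rfl⟩ := (f.ker).exists_add_mem_mem_orthogonal x
    refine ⟨⟨z, hz⟩, ?_⟩
    have : f y = 0 := hy
    simp [g, this]
  let e := ContinuousLinearEquiv.ofBijective g hinj hsurj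
  refine ⟨(f.ker)ᗮ.subtypeL ∘L e.symm, ?_⟩
  ext w
  exact ContinuousLinearEquiv.ofBijective_apply_symm_apply g hinj hsurj w

section Parity

variable {X Y : Type*} [NormedAddCommGroup X] [InnerProductSpace ℝ X]
  [NormedAddCommGroup Y] [InnerProductSpace ℝ Y]
  {D : I → Submodule ℝ X} {T : I → X →L[ℝ] Y}

/-- Fredholm operators have finite-dimensional preimages of finite-dimensional spaces; for index
zero and a transverse subspace the dimensions agree. -/
theorem finrank_indexFibre {V : Submodule ℝ Y} {s : I}
    (hfin : FiniteDimensional ℝ ((T s) ∘L (D s).subtypeL).ker)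
    (hidx : Module.finrank ℝ ((T s) ∘L (D s).subtypeL).ker =
      Module.finrank ℝ (Y ⧸ ((T s) ∘L (D s).subtypeL).range))
    (hV : IsTransverse D T V) :
    FiniteDimensional ℝ (indexFibre D T V s) ∧
      Module.finrank ℝ (indexFibre D T V s) = Module.finrank ℝ V := by
  have := hV.1
  set f := (T s) ∘L (D s).subtypeL with hf
  set g := indexMap D T V s with hg
  let eker : f.ker ≃ₗ[ℝ] g.ker :=
    { toFun := fun x => ⟨⟨(x : D s), x.1.2, by
          have : T s (x : D s) = 0 := x.2
          simp [this]⟩, by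
          have : T s (x : D s) = 0 := x.2
          exact Subtype.ext this⟩
      map_add' := fun x y => rfl
      map_smul' := fun c x => rfl
      invFun := fun x => ⟨⟨(x : indexFibre D T V s), x.1.2.1⟩, congrArg Subtype.val x.2⟩
      left_inv := fun x => rfl
      right_inv := fun x => rfl }
  have hkfin : FiniteDimensional ℝ g.ker := eker.finiteDimensional
  have hrfin : FiniteDimensional ℝ (indexFibre D T V s ⧸ g.ker) :=
    g.quotKerEquivRange.symm.finiteDimensional
  have hfd : FiniteDimensional ℝ (indexFibre D T V s) := Module.Finite.of_submodule_quotient g.ker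
  refine ⟨hfd, ?_⟩
  -- By transversality `q` is onto, and its kernel is the range of `g`. Thus `V` exceeds `g.range`
  -- by the cokernel of `f`, which for index zero has the dimension of `f.ker ≃ g.ker`.
  let q : V →ₗ[ℝ] Y ⧸ f.range := f.range.mkQ ∘ₗ V.subtype
  have hqs : Function.Surjective q := by
    intro y
    obtain ⟨y, rfl⟩ := f.range.mkQ_surjective y
    have hy : y ∈ (D s).map (T s : X →ₗ[ℝ] Y) ⊔ V := hV.2 s ▸ Submodule.mem_top
    obtain ⟨z, ⟨x, hx, rfl⟩, v, hv, rfl⟩ := Submodule.mem_sup.1 hy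
    refine ⟨⟨v, hv⟩, ?_⟩
    have : f.range.mkQ (T s x) = 0 := by
      rw [Submodule.mkQ_apply, Submodule.Quotient.mk_eq_zero]
      exact ⟨⟨x, hx⟩, rfl⟩
    simp only [q, LinearMap.comp_apply, map_add, Submodule.subtype_apply]
    rw [show f.range.mkQ ((T s : X →ₗ[ℝ] Y) x) = 0 from this, zero_add]
  have hqk : q.ker = g.range := by
    ext v
    simp only [q, LinearMap.mem_ker, LinearMap.comp_apply, Submodule.mkQ_apply,
      Submodule.Quotient.mk_eq_zero, Submodule.subtype_apply, LinearMap.mem_range]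
    constructor
    · rintro ⟨x, hx⟩
      have hx' : T s x = v := hx
      exact ⟨⟨x, x.2, by simp [hx']⟩, Subtype.ext hx'⟩
    · rintro ⟨x, rfl⟩
      exact ⟨⟨x, x.2.1⟩, rfl⟩
  have h1 := g.finrank_range_add_finrank_ker
  have h2 := q.finrank_range_add_finrank_ker
  rw [LinearMap.range_eq_top.2 hqs, finrank_top, hqk, ← hidx, eker.finrank_eq] at h2
  omega

variable [CompleteSpace X] [CompleteSpace Y]

/-- Near `s₀`, the operator `T(s)` has a continuous right inverse modulo `V`. -/
theorem exists_rightInverse_mod (hT : Continuous T) {P : I → X →L[ℝ] X} (hP : Continuous P)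
    (hPD : ∀ s, (∀ x, P s x ∈ D s) ∧ ∀ x ∈ D s, P s x = x) {V : Submodule ℝ Y}
    [FiniteDimensional ℝ V] {s₀ : I} (hV : (D s₀).map (T s₀ : X →ₗ[ℝ] Y) ⊔ V = ⊤) :
    ∃ U, IsOpen U ∧ s₀ ∈ U ∧ ∃ R : I → Vᗮ →L[ℝ] X, ContinuousOn R U ∧
      ∀ s ∈ U, ∀ y, Vᗮ.orthogonalProjectionOnto (T s (P s (R s y))) = y := by
  -- Precomposing with the projections `P s` makes the domain independent of `s`, so that continuity
  -- of inversion applies in a fixed operator space.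
  let F : I → X →L[ℝ] Vᗮ := fun s => Vᗮ.orthogonalProjectionOnto ∘L T s ∘L P s
  have hF : Continuous F := continuous_const.clm_comp (hT.clm_comp hP)
  have hsurj : Function.Surjective (F s₀) := by
    intro y
    have hy : (y : Y) ∈ (D s₀).map (T s₀ : X →ₗ[ℝ] Y) ⊔ V := hV ▸ Submodule.mem_top
    obtain ⟨z, ⟨x, hx, rfl⟩, v, hv, hxy⟩ := Submodule.mem_sup.1 hy
    refine ⟨x, ?_⟩
    have h1 : Vᗮ.orthogonalProjectionOnto v = 0 := by
      rw [Submodule.orthogonalProjectionOnto_eq_zero_iff, Submodule.orthogonal_orthogonal]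
      exact hv
    have h2 : Vᗮ.orthogonalProjectionOnto (y : Y) = y :=
      Submodule.orthogonalProjectionOnto_mem_subspace_eq_self y
    rw [← hxy, map_add, h1, add_zero] at h2
    simpa [F, (hPD s₀).2 x hx] using h2
  obtain ⟨R, hR⟩ := exists_rightInverse_of_surjective (F s₀) hsurj
  have hFR : Continuous fun s => F s ∘L R := hF.clm_comp continuous_const
  -- `F s ∘L R` is the identity at `s₀`, hence invertible nearby, and composing `R` with its inverse
  -- corrects `R` to a right inverse of `F s`.
  refine ⟨{s | IsUnit (F s ∘L R)}, Units.isOpen.preimage hFR, ?_,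
    fun s => R ∘L Ring.inverse (F s ∘L R), ?_, ?_⟩
  · simp only [mem_ofPred_eq, hR]
    exact isUnit_one
  · intro s hs
    obtain ⟨u, hu⟩ := hs
    have h1 : ContinuousAt Ring.inverse (F s ∘L R) := hu ▸ NormedRing.inverse_continuousAt u
    have h2 : ContinuousAt (fun s => Ring.inverse (F s ∘L R)) s :=
      ContinuousAt.comp (f := fun s => F s ∘L R) h1 hFR.continuousAt
    exact (continuousAt_const.clm_comp h2).continuousWithinAt
  · intro s hs y
    exact congrArg (fun A : Vᗮ →L[ℝ] Vᗮ => A y) (Ring.mul_inverse_cancel _ hs)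

/-- A basis of the fibre at `s₀` is moved into the nearby fibres by removing, through the continuous
right inverse, the part of its image transverse to `V`. Index zero makes all fibres of the same
dimension, so linear independence, an open condition, is enough for a local frame. -/
theorem IsFredholmPath.exists_frame (h : IsFredholmPath D T) {V : Submodule ℝ Y}
    (hV : IsTransverse D T V) {ι : Type*} [Fintype ι] [DecidableEq ι]
    (hι : Fintype.card ι = Module.finrank ℝ V) :
    ∃ b : ∀ s, Module.Basis ι ℝ (indexFibre D T V s), ∀ i, Continuous fun s => (b s i : X) := by
  obtain ⟨P, hP, hPD⟩ := h.continuous_domain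
  have := hV.1
  have hdim := fun s => finrank_indexFibre (h.fredholm s).finite_ker (h.index_zero s) hV
  refine exists_global_frame fun s₀ => ?_
  obtain ⟨U, hUo, hs₀, R, hR, hRs⟩ := exists_rightInverse_mod h.continuous hP hPD (hV.2 s₀)
  have := (hdim s₀).1
  let b₀ : Module.Basis ι ℝ (indexFibre D T V s₀) :=
    (Module.finBasisOfFinrankEq ℝ _ ((hdim s₀).2.trans hι.symm)).reindex (Fintype.equivFin ι).symm
  let e : ι → I → X := fun i s => P s ((b₀ i : X) -
    R s (Vᗮ.orthogonalProjectionOnto (T s (P s (b₀ i)))))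
  have hTc := h.continuous
  have he : ∀ i, ContinuousOn (e i) U := by
    intro i
    refine hP.continuousOn.clm_apply (continuousOn_const.sub (hR.clm_apply ?_))
    exact (continuous_const.clm_apply (hTc.clm_apply (hP.clm_apply continuous_const))).continuousOn
  have hmem : ∀ i, ∀ s ∈ U, e i s ∈ indexFibre D T V s := by
    intro i s hs
    refine ⟨(hPD s).1 _, ?_⟩
    change T s (e i s) ∈ V
    rw [← Submodule.orthogonal_orthogonal V, ← Submodule.orthogonalProjectionOnto_eq_zero_iff]
    simp only [e, map_sub]
    rw [hRs s hs, sub_self]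
  have he₀ : ∀ i, e i s₀ = b₀ i := by
    intro i
    have h1 : P s₀ (b₀ i) = b₀ i := (hPD s₀).2 _ (b₀ i).2.1
    have h2 : Vᗮ.orthogonalProjectionOnto (T s₀ (b₀ i)) = 0 := by
      rw [Submodule.orthogonalProjectionOnto_eq_zero_iff, Submodule.orthogonal_orthogonal]
      exact (b₀ i).2.2
    simp only [e, h1, h2, map_zero, sub_zero]
  have hli : ∀ᶠ s in 𝓝 s₀, LinearIndependent ℝ fun i => e i s := by
    have hcont : ContinuousAt (fun s i => e i s) s₀ :=
      continuousAt_pi.2 fun i => (he i).continuousAt (hUo.mem_nhds hs₀)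
    refine hcont.eventually (isOpen_setOfPred_linearIndependent.mem_nhds ?_)
    simp only [he₀]
    exact b₀.linearIndependent.map' _ (Submodule.ker_subtype _)
  refine ⟨U ∩ {s | LinearIndependent ℝ fun i => e i s}, inter_mem (hUo.mem_nhds hs₀) hli, e,
    fun i => (he i).mono inter_subset_left, fun s hs => ?_⟩
  have := (hdim s).1
  have hli' : LinearIndependent ℝ fun i => (⟨e i s, hmem i s hs.1⟩ : indexFibre D T V s) :=
    LinearIndependent.of_comp (indexFibre D T V s).subtype hs.2
  refine ⟨Module.Basis.mk hli' (hli'.span_eq_top_of_card_eq_finrank' (hι.trans (hdim s).2.symm)).ge,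
    fun i => ?_⟩
  simp

/-- A complement of the range at `s₀` stays transverse near `s₀`; by compactness finitely many such
complements suffice, and their sum is transverse everywhere. -/
theorem IsFredholmPath.exists_isTransverse (h : IsFredholmPath D T) :
    ∃ V, IsTransverse D T V := by
  obtain ⟨P, hP, hPD⟩ := h.continuous_domain
  have hloc : ∀ s₀, ∃ V : Submodule ℝ Y, FiniteDimensional ℝ V ∧
      ∀ᶠ s in 𝓝 s₀, (D s).map (T s : X →ₗ[ℝ] Y) ⊔ V = ⊤ := by
    intro s₀
    obtain ⟨V, hV⟩ := Submodule.exists_isCompl ((T s₀) ∘L (D s₀).subtypeL).range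
    have hfin := (h.fredholm s₀).finite_coker
    have hVfin : FiniteDimensional ℝ V := (Submodule.quotientEquivOfIsCompl _ _ hV).finiteDimensional
    refine ⟨V, hVfin, ?_⟩
    have hrange : ((T s₀) ∘L (D s₀).subtypeL).range = (D s₀).map (T s₀ : X →ₗ[ℝ] Y) := by
      ext y
      constructor
      · rintro ⟨x, rfl⟩
        exact ⟨x, x.2, rfl⟩
      · rintro ⟨x, hx, rfl⟩
        exact ⟨⟨x, hx⟩, rfl⟩
    obtain ⟨U, hUo, hs₀, R, -, hRs⟩ := exists_rightInverse_mod (V := V) h.continuous hP hPD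
      (hrange ▸ hV.sup_eq_top)
    filter_upwards [hUo.mem_nhds hs₀] with s hs
    rw [eq_top_iff]
    intro y _
    set x := P s (R s (Vᗮ.orthogonalProjectionOnto y))
    refine Submodule.mem_sup.2 ⟨T s x, ⟨x, (hPD s).1 _, rfl⟩, y - T s x, ?_, by abel⟩
    rw [← Submodule.orthogonal_orthogonal V, ← Submodule.orthogonalProjectionOnto_eq_zero_iff,
      map_sub, hRs s hs, sub_self]
  choose V hVfin hV using hloc
  obtain ⟨t, -, ht⟩ := isCompact_univ.elim_nhds_subcover _ fun s _ => hV s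
  refine ⟨t.sup V, Submodule.finiteDimensional_finset_sup t V, fun s => ?_⟩
  obtain ⟨s₀, hs₀, hs⟩ := mem_iUnion₂.1 (ht (mem_univ s))
  rw [eq_top_iff, ← show _ = _ from hs]
  exact sup_le_sup_left (Finset.le_sup hs₀) _

end Parity

end


/-! ### Independence of the parity from the transverse subspace. -/

noncomputable section

theorem Submodule.exists_basis_extending {Y : Type*} [AddCommGroup Y] [Module ℝ Y]
    {V₁ V₂ : Submodule ℝ Y} [FiniteDimensional ℝ V₂] (hle : V₁ ≤ V₂) {ι : Type*}
    (b₁ : Module.Basis ι ℝ V₁) :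
    ∃ (r : ℕ) (b : Module.Basis (ι ⊕ Fin r) ℝ V₂), ∀ i, (b (Sum.inl i) : Y) = b₁ i := by
  obtain ⟨W, hW⟩ := (V₁.comap V₂.subtype).exists_isCompl
  let b₁' := b₁.map (Submodule.comapSubtypeEquivOfLe hle).symm
  refine ⟨_, (b₁'.prod (Module.finBasis ℝ W)).map (Submodule.prodEquivOfIsCompl _ _ hW),
    fun i => ?_⟩
  simp [b₁']

theorem matrix_mul_toMatrix {E κ ι' ι : Type*} [AddCommGroup E] [Module ℝ E] [Fintype ι]
    (L : E →ₗ[ℝ] κ → ℝ) (e : Module.Basis ι ℝ E) (c : ι' → E) :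
    (Matrix.of fun a j => L (e j) a) * e.toMatrix c = Matrix.of fun a i => L (c i) a := by
  ext a i
  simp only [Matrix.mul_apply, Matrix.of_apply]
  conv_rhs => rw [← e.sum_toMatrix_smul_self c i, map_sum, Finset.sum_apply]
  simp only [map_smul, Pi.smul_apply, smul_eq_mul, mul_comm]

section Parity

variable {X Y : Type*} [NormedAddCommGroup X] [InnerProductSpace ℝ X]
  [NormedAddCommGroup Y] [InnerProductSpace ℝ Y]
  {D : I → Submodule ℝ X} {T : I → X →L[ℝ] Y}

theorem IsTransverse.mono {V₁ V₂ : Submodule ℝ Y} (h : IsTransverse D T V₁) (hle : V₁ ≤ V₂)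
    [FiniteDimensional ℝ V₂] : IsTransverse D T V₂ :=
  ⟨inferInstance, fun s => eq_top_iff.2 ((h.2 s).ge.trans (sup_le_sup_left hle _))⟩

theorem indexFibre_mono {V₁ V₂ : Submodule ℝ Y} (hle : V₁ ≤ V₂) (s : I) :
    indexFibre D T V₁ s ≤ indexFibre D T V₂ s :=
  fun _ hx => ⟨hx.1, hle hx.2⟩

theorem IsFredholmPath.injective_indexMap (h : IsFredholmPath D T) (V : Submodule ℝ Y) (s : I)
    (hs : s = 0 ∨ s = 1) : Function.Injective (indexMap D T V s) := by
  have hbij : Function.Bijective ((T s) ∘L (D s).subtypeL) := by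
    rcases hs with rfl | rfl
    · exact h.invertible_zero
    · exact h.invertible_one
  intro x y hxy
  have h1 : T s x = T s y := congrArg Subtype.val hxy
  have h2 := @hbij.1 ⟨x, x.2.1⟩ ⟨y, y.2.1⟩ h1
  exact Subtype.ext (Subtype.mk.inj h2)

variable [CompleteSpace X] [CompleteSpace Y]

/-- The larger index bundle is the smaller one plus a copy of `V₂/V₁`. The functionals `L s`, inner
products with the frame `e₁` together with the `V₂/V₁`-coordinates of `T s x`, are coordinates on
the larger fibre for every `s`. So `N s`, the determinant of `e₂` in these coordinates, never
vanishes and keeps its sign along `[0,1]`. This ties the relative orientations of `e₁` and `e₂` at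
the two ends. -/
theorem IsFredholmPath.clutchingOrientable_iff_of_le (h : IsFredholmPath D T)
    {V₁ V₂ : Submodule ℝ Y} (hV₁ : IsTransverse D T V₁) (hV₂ : IsTransverse D T V₂)
    (hle : V₁ ≤ V₂) : ClutchingOrientable D T V₁ ↔ ClutchingOrientable D T V₂ := by
  classical
  have := hV₁.1
  have := hV₂.1
  let b₁ := Module.finBasis ℝ V₁
  obtain ⟨r, b₂, hb⟩ := Submodule.exists_basis_extending hle b₁
  obtain ⟨e₁, he₁⟩ := h.exists_frame hV₁ (Module.finrank_eq_card_basis b₁).symm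
  obtain ⟨e₂, he₂⟩ := h.exists_frame hV₂ (Module.finrank_eq_card_basis b₂).symm
  have hrepr : ∀ v : V₁, b₂.equivFun (Submodule.inclusion hle v) =
      Sum.elim (b₁.equivFun v) 0 := by
    intro v
    have h1 : Submodule.inclusion hle v = ∑ i, b₁.equivFun v i • b₂ (Sum.inl i) := by
      apply Subtype.ext
      conv_lhs => rw [← b₁.sum_equivFun v]
      simp only [Submodule.coe_inclusion, Submodule.coe_sum, Submodule.coe_smul, hb]
    rw [h1, map_sum]
    ext a
    simp only [map_smul, Finset.sum_apply, Pi.smul_apply, smul_eq_mul, Module.Basis.equivFun_self]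
    cases a <;> simp
  have hmem : ∀ v : V₂, (∀ k, b₂.equivFun v (Sum.inr k) = 0) → (v : Y) ∈ V₁ := by
    intro v hv
    rw [← b₂.sum_equivFun v, Fintype.sum_sum_type]
    simp only [hv, zero_smul, Finset.sum_const_zero, add_zero, Submodule.coe_sum,
      Submodule.coe_smul, hb]
    exact Submodule.sum_mem _ fun i _ => Submodule.smul_mem _ _ (b₁ i).2
  let L : ∀ s, indexFibre D T V₂ s →ₗ[ℝ] Fin (Module.finrank ℝ V₁) ⊕ Fin r → ℝ := fun s =>
    LinearMap.pi (Sum.elim (fun i => innerₗ X (e₁ s i : X) ∘ₗ (indexFibre D T V₂ s).subtype)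
      fun k => LinearMap.proj (Sum.inr k) ∘ₗ b₂.equivFun.toLinearMap ∘ₗ indexMap D T V₂ s)
  have hLl : ∀ s x i, L s x (Sum.inl i) = inner ℝ (e₁ s i : X) (x : X) := fun s x i => rfl
  have hLr : ∀ s x k, L s x (Sum.inr k) = b₂.equivFun (indexMap D T V₂ s x) (Sum.inr k) :=
    fun s x k => rfl
  have hLinj : ∀ s x, L s x = 0 → x = 0 := by
    intro s x hx
    have h1 : (indexMap D T V₂ s x : Y) ∈ V₁ := hmem _ fun k => by rw [← hLr, hx]; rfl
    let x' : indexFibre D T V₁ s := ⟨x, x.2.1, h1⟩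
    have h2 : inner ℝ (x : X) (x : X) = 0 := by
      have h3 : (x : X) = ∑ i, (e₁ s).equivFun x' i • (e₁ s i : X) := by
        have h4 := congrArg Subtype.val ((e₁ s).sum_equivFun x')
        rw [Submodule.coe_sum] at h4
        exact h4.symm
      conv_lhs => rw [h3]
      rw [sum_inner]
      refine Finset.sum_eq_zero fun i _ => ?_
      rw [inner_smul_left, ← h3, ← hLl, hx]
      simp
    exact Subtype.ext (inner_self_eq_zero.1 h2)
  let N : I → ℝ := fun s => (Matrix.of fun a j => L s (e₂ s j) a).det
  have hN0 : ∀ s, N s ≠ 0 := by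
    intro s hs
    obtain ⟨v, hv, hv0⟩ := Matrix.exists_mulVec_eq_zero_iff.2 hs
    apply hv
    have h1 : L s (∑ j, v j • e₂ s j) = 0 := by
      rw [← hv0, map_sum]
      ext a
      simp [Matrix.mulVec, dotProduct, mul_comm]
    have h2 := hLinj s _ h1
    ext j
    exact Fintype.linearIndependent_iff.1 (e₂ s).linearIndependent v h2 j
  have hTe : ∀ j, Continuous fun s => indexMap D T V₂ s (e₂ s j) := fun j =>
    Continuous.subtype_mk (h.continuous.clm_apply (he₂ j)) _
  have hNc : Continuous N := by
    refine Continuous.matrix_det (continuous_pi fun a => continuous_pi fun j => ?_)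
    rcases a with i | k
    · exact (he₁ i).inner (he₂ j)
    · exact (continuous_apply (Sum.inr k)).comp
        (b₂.equivFun.toLinearMap.continuous_of_finiteDimensional.comp (hTe j))
  have hNpos : 0 < N 0 * N 1 := by
    by_contra hneg
    have hmem0 : (0 : ℝ) ∈ Set.uIcc (N 0) (N 1) := by
      rw [Set.mem_uIcc]
      rcases mul_nonpos_iff.1 (not_lt.1 hneg) with h1 | h1
      · exact Or.inr ⟨h1.2, h1.1⟩
      · exact Or.inl h1
    obtain ⟨s, -, hs⟩ := intermediate_value_uIcc (a := (0 : I)) (b := 1) hNc.continuousOn hmem0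
    exact hN0 s hs
  -- `ρ` is the determinant in `e₂` of the basis formed by `e₁` and preimages of the added vectors
  -- of `b₂`. In it both `L s` and `T s` are block triangular. The first identity gives `ρ` the sign
  -- of `N s`, the second compares the gluing determinants.
  have key : ∀ s, s = 0 ∨ s = 1 → ∃ c > 0, ∃ ρ : ℝ, ρ ≠ 0 ∧
      N s * ρ = c ∧ b₂.det (indexMap D T V₂ s ∘ e₂ s) * ρ =
        b₁.det (indexMap D T V₁ s ∘ e₁ s) := by
    intro s hs
    have hsurj : Function.Surjective (indexMap D T V₂ s) := by
      have := Module.Basis.finiteDimensional_of_finite (e₂ s)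
      refine (LinearMap.injective_iff_surjective_of_finrank_eq_finrank ?_).1
        (h.injective_indexMap V₂ s hs)
      rw [Module.finrank_eq_card_basis (e₂ s), Module.finrank_eq_card_basis b₂]
    choose x hx using fun k => hsurj (b₂ (Sum.inr k))
    let c : Fin (Module.finrank ℝ V₁) ⊕ Fin r → indexFibre D T V₂ s :=
      Sum.elim (fun i => Submodule.inclusion (indexFibre_mono hle s) (e₁ s i)) x
    have hTl : ∀ i, b₂.equivFun (indexMap D T V₂ s (c (Sum.inl i))) =
        Sum.elim (b₁.equivFun (indexMap D T V₁ s (e₁ s i))) 0 := fun i =>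
      hrepr (indexMap D T V₁ s (e₁ s i))
    have hTr : ∀ k, b₂.equivFun (indexMap D T V₂ s (c (Sum.inr k))) =
        Pi.single (Sum.inr k) 1 := fun k => by
      rw [show indexMap D T V₂ s (c (Sum.inr k)) = b₂ (Sum.inr k) from hx k]
      ext a
      rw [Module.Basis.equivFun_self, Pi.single_apply]
      simp only [eq_comm]
    obtain ⟨g, hg, hgdet⟩ := det_inner_basis (e₁ s) (e₁ s)
    have h1 : N s * ((e₂ s).toMatrix c).det = g := by
      rw [← Matrix.det_mul, matrix_mul_toMatrix]
      rw [Module.Basis.det_self, mul_one] at hgdet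
      have : (Matrix.of fun a i => L s (c i) a) = Matrix.fromBlocks
          (Matrix.of fun i j => inner ℝ (e₁ s i : X) (e₁ s j : X))
          (Matrix.of fun i k => inner ℝ (e₁ s i : X) (x k : X)) 0 1 := by
        ext a b
        rcases a with i | k <;> rcases b with j | l
        · rfl
        · rfl
        · rw [Matrix.of_apply, hLr, hTl]
          rfl
        · rw [Matrix.of_apply, hLr, hTr]
          simp [Matrix.one_apply, Pi.single_apply]
      rw [this, Matrix.det_fromBlocks_zero₂₁, Matrix.det_one, mul_one, hgdet]
    have h2 : b₂.det (indexMap D T V₂ s ∘ e₂ s) * ((e₂ s).toMatrix c).det =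
        b₁.det (indexMap D T V₁ s ∘ e₁ s) := by
      have h3 : b₂.toMatrix (indexMap D T V₂ s ∘ e₂ s) =
          Matrix.of fun a j => (b₂.equivFun.toLinearMap ∘ₗ indexMap D T V₂ s) (e₂ s j) a := rfl
      rw [Module.Basis.det_apply, h3, ← Matrix.det_mul, matrix_mul_toMatrix]
      have : (Matrix.of fun a i => (b₂.equivFun.toLinearMap ∘ₗ indexMap D T V₂ s) (c i) a) =
          Matrix.fromBlocks (b₁.toMatrix (indexMap D T V₁ s ∘ e₁ s)) 0 0 1 := by
        ext a b
        rcases b with j | l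
        · have h5 := congrFun (hTl j) a
          rcases a with i | k
          · exact h5
          · exact h5
        · have h5 := congrFun (hTr l) a
          rcases a with i | k
          · exact h5.trans (by simp)
          · exact h5.trans (by simp [Matrix.one_apply, Pi.single_apply])
      rw [this, Matrix.det_fromBlocks_zero₂₁, Matrix.det_one, mul_one, Module.Basis.det_apply]
    exact ⟨g, hg, _, fun h0 => hg.ne' (by rw [← h1, h0, mul_zero]), h1, h2⟩
  rw [clutchingOrientable_iff (h.injective_indexMap V₁) e₁ he₁ b₁,
    clutchingOrientable_iff (h.injective_indexMap V₂) e₂ he₂ b₂]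
  obtain ⟨c₀, hc₀, ρ₀, hρ₀, hN₀, hd₀⟩ := key 0 (Or.inl rfl)
  obtain ⟨c₁, hc₁, ρ₁, hρ₁, hN₁, hd₁⟩ := key 1 (Or.inr rfl)
  have hρ : 0 < ρ₀ * ρ₁ := by
    have h1 : 0 < (N 0 * N 1) * (ρ₀ * ρ₁) := by
      have : (N 0 * N 1) * (ρ₀ * ρ₁) = c₀ * c₁ := by rw [← hN₀, ← hN₁]; ring
      rw [this]
      positivity
    exact (mul_pos_iff_of_pos_left hNpos).1 h1
  rw [← hd₀, ← hd₁, mul_mul_mul_comm, mul_pos_iff_of_pos_right hρ]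

/-- The parity can be computed with any transverse subspace. -/
theorem IsFredholmPath.exists_clutchingOrientable_iff (h : IsFredholmPath D T) {V : Submodule ℝ Y}
    (hV : IsTransverse D T V) :
    (∃ V', IsTransverse D T V' ∧ ClutchingOrientable D T V') ↔ ClutchingOrientable D T V := by
  refine ⟨fun ⟨V', hV', ho⟩ => ?_, fun ho => ⟨V, hV, ho⟩⟩
  have := hV.1
  have := hV'.1
  have hsup : IsTransverse D T (V ⊔ V') := hV.mono le_sup_left
  rw [h.clutchingOrientable_iff_of_le hV hsup le_sup_left]
  exact (h.clutchingOrientable_iff_of_le hV' hsup le_sup_right).1 ho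

end Parity

end


/-! ### Fredholm operators and reduction to a subspace of the target. -/

noncomputable section

section Parity

/-- Closedness of the range comes for free: with `W` an algebraic complement of the range, `(ker f)ᗮ
× W → Y` is a bounded bijection, hence an isomorphism, and the range is the zero set of the
`W`-component. -/
theorem ContinuousLinearMap.isFredholm_of_finiteDimensional {X Y : Type*} [NormedAddCommGroup X]
    [InnerProductSpace ℝ X] [CompleteSpace X] [NormedAddCommGroup Y] [InnerProductSpace ℝ Y]
    [CompleteSpace Y] (f : X →L[ℝ] Y) (hk : FiniteDimensional ℝ f.ker)
    (hc : FiniteDimensional ℝ (Y ⧸ f.range)) : f.IsFredholm := by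
  obtain ⟨W, hW⟩ := f.range.exists_isCompl
  have hWfin : FiniteDimensional ℝ W := (Submodule.quotientEquivOfIsCompl _ _ hW).finiteDimensional
  have hdec : ∀ x, ∃ z ∈ (f.ker)ᗮ, f z = f x := by
    intro x
    obtain ⟨y, hy, z, hz, rfl⟩ := (f.ker).exists_add_mem_mem_orthogonal x
    have : f y = 0 := hy
    exact ⟨z, hz, by simp [this]⟩
  have hker : ∀ x ∈ (f.ker)ᗮ, f x = 0 → x = 0 := by
    intro x hx h0
    have h3 : x ∈ f.ker ⊓ (f.ker)ᗮ := ⟨h0, hx⟩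
    rwa [Submodule.inf_orthogonal_eq_bot, Submodule.mem_bot] at h3
  let g : (f.ker)ᗮ × W →L[ℝ] Y := (f ∘L (f.ker)ᗮ.subtypeL).coprod W.subtypeL
  have hg : ∀ p, g p = f p.1 + p.2 := fun p => rfl
  have hinj : g.ker = ⊥ := by
    rw [LinearMap.ker_eq_bot']
    intro p hp
    have h1 : f p.1 + p.2 = 0 := hp
    have h2 : (p.2 : Y) ∈ f.range ⊓ W :=
      ⟨⟨-p.1, by simpa using (eq_neg_of_add_eq_zero_right h1).symm⟩, p.2.2⟩
    rw [hW.inf_eq_bot, Submodule.mem_bot] at h2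
    rw [h2, add_zero] at h1
    exact Prod.ext (Subtype.ext (hker _ p.1.2 h1)) (Subtype.ext h2)
  have hsurj : g.range = ⊤ := by
    rw [LinearMap.range_eq_top]
    intro y
    have hy : y ∈ f.range ⊔ W := hW.sup_eq_top ▸ Submodule.mem_top
    obtain ⟨_, ⟨x, rfl⟩, w, hw, rfl⟩ := Submodule.mem_sup.1 hy
    obtain ⟨z, hz, hzx⟩ := hdec x
    exact ⟨(⟨z, hz⟩, ⟨w, hw⟩), by simpa [hg] using hzx⟩
  let e := ContinuousLinearEquiv.ofBijective g hinj hsurj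
  have hclosed : IsClosed (f.range : Set Y) := by
    have : (f.range : Set Y) = (fun y => (e.symm y).2) ⁻¹' {0} := by
      ext y
      constructor
      · rintro ⟨x, rfl⟩
        obtain ⟨z, hz, hzx⟩ := hdec x
        have h1 : e (⟨z, hz⟩, 0) = f x := by
          change g _ = _
          simpa [hg] using hzx
        change (e.symm (f x)).2 = 0
        rw [← h1, e.symm_apply_apply]
      · intro hy
        have hy' : (e.symm y).2 = 0 := hy
        refine ⟨(e.symm y).1, ?_⟩
        have h1 : g (e.symm y) = y := e.apply_symm_apply y
        rw [hg, hy'] at h1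
        simpa using h1
    rw [this]
    exact isClosed_singleton.preimage (continuous_snd.comp e.symm.continuous)
  have hcofg : ((f.ker)ᗮ).CoFG :=
    (Submodule.quotientEquivOfIsCompl _ _
      (f.ker).isCompl_orthogonal.symm).symm.finiteDimensional
  have : f.range.CoFG := hc
  have hmap : MapsTo f (f.ker)ᗮ f.range := fun x _ => ⟨x, rfl⟩
  refine .of_isInvertible_restrict (Submodule.isClosed_orthogonal _) hclosed hmap ?_
  have : CompleteSpace f.range := hclosed.completeSpace_coe
  refine ⟨ContinuousLinearEquiv.ofBijective (f.restrict hmap) ?_ ?_, rfl⟩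
  · rw [LinearMap.ker_eq_bot']
    intro x hx
    exact Subtype.ext (hker _ x.2 (congrArg Subtype.val hx))
  · rw [LinearMap.range_eq_top]
    rintro ⟨_, x, rfl⟩
    obtain ⟨z, hz, hzx⟩ := hdec x
    exact ⟨⟨z, hz⟩, Subtype.ext hzx⟩

variable {X Y X' Y' : Type*} [NormedAddCommGroup X] [InnerProductSpace ℝ X]
  [NormedAddCommGroup Y] [InnerProductSpace ℝ Y]
  [NormedAddCommGroup X'] [InnerProductSpace ℝ X']
  [NormedAddCommGroup Y'] [InnerProductSpace ℝ Y']

/-- The operators `T'(s)` on `D'(s)` are the parts of the operators `T(s)` over the subspace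
`ι(Y')` of `Y`, where `R` identifies `T(s)⁻¹(ι(Y'))` with `D'(s)`, and `ι(Y')` is transverse to
`T(s)`. -/
structure IsReduction (D : I → Submodule ℝ X) (T : I → X →L[ℝ] Y) (D' : I → Submodule ℝ X')
    (T' : I → X' →L[ℝ] Y') (R : X →L[ℝ] X') (ι : Y' →ₗ[ℝ] Y) : Prop where
  injective : Function.Injective ι
  restrict : ∀ s, ∀ x ∈ D s, ∀ y, T s x = ι y → R x ∈ D' s ∧ T' s (R x) = y
  lift : ∀ s, ∀ x' ∈ D' s, ∃ x ∈ D s, R x = x' ∧ T s x = ι (T' s x')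
  eq_zero : ∀ s, ∀ x ∈ D s, ∀ y, T s x = ι y → R x = 0 → x = 0
  transverse : ∀ s y, ∃ x ∈ D s, ∃ y', y = T s x + ι y'

namespace IsReduction

variable {D : I → Submodule ℝ X} {T : I → X →L[ℝ] Y} {D' : I → Submodule ℝ X'}
  {T' : I → X' →L[ℝ] Y'} {R : X →L[ℝ] X'} {ι : Y' →ₗ[ℝ] Y} (h : IsReduction D T D' T' R ι)
include h

theorem isTransverse {V : Submodule ℝ Y'} (hV : IsTransverse D' T' V) :
    IsTransverse D T (V.map ι) := by
  have := hV.1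
  refine ⟨inferInstance, fun s => eq_top_iff.2 fun y _ => ?_⟩
  obtain ⟨x, hx, y', rfl⟩ := h.transverse s y
  have hy' : y' ∈ (D' s).map (T' s : X' →ₗ[ℝ] Y') ⊔ V := hV.2 s ▸ Submodule.mem_top
  obtain ⟨_, ⟨x', hx', rfl⟩, v, hv, rfl⟩ := Submodule.mem_sup.1 hy'
  obtain ⟨x₂, hx₂, -, hTx₂⟩ := h.lift s x' hx'
  refine Submodule.mem_sup.2 ⟨T s (x + x₂), ⟨_, add_mem hx hx₂, rfl⟩, ι v, ⟨v, hv, rfl⟩, ?_⟩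
  rw [map_add, hTx₂, map_add, add_assoc]
  rfl

/-- The identification of the index fibres. -/
theorem exists_fibreEquiv (V : Submodule ℝ Y') (s : I) :
    ∃ e : indexFibre D T (V.map ι) s ≃ₗ[ℝ] indexFibre D' T' V s, ∀ x, (e x : X') = R x := by
  let f : indexFibre D T (V.map ι) s →ₗ[ℝ] indexFibre D' T' V s :=
    ((R : X →ₗ[ℝ] X') ∘ₗ Submodule.subtype _).codRestrict _ fun x => by
      obtain ⟨y, hy, hxy⟩ := x.2.2
      obtain ⟨h1, h2⟩ := h.restrict s x x.2.1 y hxy.symm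
      exact ⟨h1, by simpa [h2] using hy⟩
  refine ⟨LinearEquiv.ofBijective f ⟨?_, ?_⟩, fun x => rfl⟩
  · rw [← LinearMap.ker_eq_bot, LinearMap.ker_eq_bot']
    intro x hx
    obtain ⟨y, -, hxy⟩ := x.2.2
    exact Subtype.ext (h.eq_zero s x x.2.1 y hxy.symm (congrArg Subtype.val hx))
  · intro x'
    obtain ⟨x, hx, hRx, hTx⟩ := h.lift s x' x'.2.1
    exact ⟨⟨x, hx, ⟨_, x'.2.2, hTx.symm⟩⟩, Subtype.ext hRx⟩

theorem bijective (s : I) (hb : Function.Bijective ((T' s) ∘L (D' s).subtypeL)) :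
    Function.Bijective ((T s) ∘L (D s).subtypeL) := by
  constructor
  · rw [injective_iff_map_eq_zero]
    intro x hx
    have hx' : T s x = ι 0 := by rw [map_zero]; exact hx
    obtain ⟨h1, h2⟩ := h.restrict s x x.2 0 hx'
    have h3 := (injective_iff_map_eq_zero _).1 hb.1 ⟨R x, h1⟩ h2
    exact Subtype.ext (h.eq_zero s x x.2 0 hx' (congrArg Subtype.val h3))
  · intro y
    obtain ⟨x, hx, y', rfl⟩ := h.transverse s y
    obtain ⟨x', hx'⟩ := hb.2 y'
    obtain ⟨x₂, hx₂, -, hTx₂⟩ := h.lift s x' x'.2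
    refine ⟨⟨x + x₂, add_mem hx hx₂⟩, ?_⟩
    have : T' s x' = y' := hx'
    simp [hTx₂, this]

theorem finrank_ker_eq (s : I) :
    (FiniteDimensional ℝ ((T' s) ∘L (D' s).subtypeL).ker →
      FiniteDimensional ℝ ((T s) ∘L (D s).subtypeL).ker) ∧
    Module.finrank ℝ ((T s) ∘L (D s).subtypeL).ker =
      Module.finrank ℝ ((T' s) ∘L (D' s).subtypeL).ker := by
  let f : ((T s) ∘L (D s).subtypeL).ker →ₗ[ℝ] ((T' s) ∘L (D' s).subtypeL).ker :=
    LinearMap.codRestrict _ (LinearMap.codRestrict (D' s)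
      ((R : X →ₗ[ℝ] X') ∘ₗ Submodule.subtype _ ∘ₗ Submodule.subtype _) fun x =>
        (h.restrict s x x.1.2 0 ((show T s x = 0 from x.2).trans (map_zero ι).symm)).1) fun x =>
        (h.restrict s x x.1.2 0 ((show T s x = 0 from x.2).trans (map_zero ι).symm)).2
  have hf : Function.Bijective f := by
    constructor
    · rw [injective_iff_map_eq_zero]
      intro x hx
      exact Subtype.ext (Subtype.ext (h.eq_zero s x x.1.2 0
        ((show T s x = 0 from x.2).trans (map_zero ι).symm)
        (congrArg Subtype.val (congrArg Subtype.val hx))))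
    · intro x'
      obtain ⟨x, hx, hRx, hTx⟩ := h.lift s x' x'.1.2
      have h0 : T' s x' = 0 := x'.2
      rw [h0, map_zero] at hTx
      exact ⟨⟨⟨x, hx⟩, hTx⟩, Subtype.ext (Subtype.ext hRx)⟩
  let e := LinearEquiv.ofBijective f hf
  exact ⟨fun _ => e.symm.finiteDimensional, e.finrank_eq⟩

/-- The map induced by `ι` on cokernels is injective by `restrict` and surjective by `transverse`.
-/
theorem finrank_coker_eq (s : I) :
    (FiniteDimensional ℝ (Y' ⧸ ((T' s) ∘L (D' s).subtypeL).range) →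
      FiniteDimensional ℝ (Y ⧸ ((T s) ∘L (D s).subtypeL).range)) ∧
    Module.finrank ℝ (Y ⧸ ((T s) ∘L (D s).subtypeL).range) =
      Module.finrank ℝ (Y' ⧸ ((T' s) ∘L (D' s).subtypeL).range) := by
  have hle : ((T' s) ∘L (D' s).subtypeL).range ≤
      ((T s) ∘L (D s).subtypeL).range.comap ι := by
    rintro _ ⟨x', rfl⟩
    obtain ⟨x, hx, -, hTx⟩ := h.lift s x' x'.2
    exact ⟨⟨x, hx⟩, hTx⟩
  let f := Submodule.mapQ _ _ ι hle
  have hf : Function.Bijective f := by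
    constructor
    · rw [injective_iff_map_eq_zero]
      intro z hz
      obtain ⟨y, rfl⟩ := Submodule.mkQ_surjective _ z
      rw [Submodule.mkQ_apply, Submodule.mapQ_apply, Submodule.Quotient.mk_eq_zero] at hz
      obtain ⟨x, hx⟩ := hz
      rw [Submodule.mkQ_apply, Submodule.Quotient.mk_eq_zero]
      obtain ⟨h1, h2⟩ := h.restrict s x x.2 y hx
      exact ⟨⟨R x, h1⟩, h2⟩
    · intro z
      obtain ⟨y, rfl⟩ := Submodule.mkQ_surjective _ z
      obtain ⟨x, hx, y', rfl⟩ := h.transverse s y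
      refine ⟨Submodule.mkQ _ y', ?_⟩
      rw [Submodule.mkQ_apply, Submodule.mapQ_apply, Submodule.mkQ_apply, eq_comm,
        Submodule.Quotient.eq]
      exact ⟨⟨x, hx⟩, by simp⟩
  let e := LinearEquiv.ofBijective f hf
  exact ⟨fun _ => e.finiteDimensional, e.finrank_eq.symm⟩

variable [CompleteSpace X] [CompleteSpace Y]

theorem isFredholmPath (h' : IsFredholmPath D' T') (hT : Continuous T)
    (hD : ∃ P : I → X →L[ℝ] X, Continuous P ∧ ∀ s, (∀ x, P s x ∈ D s) ∧ ∀ x ∈ D s, P s x = x) :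
    IsFredholmPath D T where
  continuous := hT
  continuous_domain := hD
  fredholm s := by
    obtain ⟨P, -, hP⟩ := hD
    have hclosed : IsClosed (D s : Set X) := by
      have : (D s : Set X) = {x | P s x = x} :=
        Set.ext fun x => ⟨fun hx => (hP s).2 x hx, fun hx => hx ▸ (hP s).1 x⟩
      rw [this]
      exact isClosed_eq (P s).continuous continuous_id
    have : CompleteSpace (D s) := hclosed.completeSpace_coe
    exact ContinuousLinearMap.isFredholm_of_finiteDimensional _
      ((h.finrank_ker_eq s).1 (h'.fredholm s).finite_ker)
      ((h.finrank_coker_eq s).1 (h'.fredholm s).finite_coker)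
  index_zero s := by
    rw [(h.finrank_ker_eq s).2, (h.finrank_coker_eq s).2, h'.index_zero s]
  invertible_zero := h.bijective 0 h'.invertible_zero
  invertible_one := h.bijective 1 h'.invertible_one

/-- For `V` transverse to `T'`, the subspace `ι V` is transverse to `T`. The bounded map `R` carries
a frame of the bundle over `ι V` to a frame of the bundle over `V`, and the gluing matrices at the
endpoints are the same. -/
theorem parity_eq [CompleteSpace X'] [CompleteSpace Y'] (hp : IsFredholmPath D T) (hp' : IsFredholmPath D' T') :
    parity D' T' = parity D T := by
  obtain ⟨V, hV⟩ := hp'.exists_isTransverse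
  have hVι := h.isTransverse hV
  have := hV.1
  have hiff : ClutchingOrientable D' T' V ↔ ClutchingOrientable D T (V.map ι) := by
    let j : V ≃ₗ[ℝ] V.map ι := V.equivMapOfInjective ι h.injective
    have hj : ∀ v, (j v : Y) = ι v := fun v => rfl
    let b := Module.finBasis ℝ V
    obtain ⟨e, he⟩ := hp.exists_frame hVι (ι := Fin (Module.finrank ℝ V))
      ((Fintype.card_fin _).trans j.finrank_eq)
    choose g hg using h.exists_fibreEquiv V
    rw [clutchingOrientable_iff (hp.injective_indexMap _) e he (b.map j),
      clutchingOrientable_iff (hp'.injective_indexMap _) (fun s => (e s).map (g s))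
        (fun i => ?_) b]
    · have hdet : ∀ s, (b.map j).det (indexMap D T (V.map ι) s ∘ e s) =
          b.det (indexMap D' T' V s ∘ (e s).map (g s)) := by
        intro s
        rw [Module.Basis.det_map]
        congr 1
        ext i
        simp only [Function.comp_apply, Module.Basis.map_apply]
        congr 1
        rw [LinearEquiv.symm_apply_eq]
        apply Subtype.ext
        rw [hj, coe_indexMap, coe_indexMap, hg]
        obtain ⟨y, hy, hxy⟩ := (e s i).2.2
        rw [(h.restrict s (e s i) (e s i).2.1 y hxy.symm).2]
        exact hxy.symm
      rw [hdet, hdet]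
    · simp only [Module.Basis.map_apply, hg]
      exact R.continuous.comp (he i)
  unfold parity
  rw [hp.exists_clutchingOrientable_iff hVι, hp'.exists_clutchingOrientable_iff hV, hiff]

end IsReduction

end Parity

end


noncomputable section

/-! ### Primitives of locally integrable functions -/

section Primitive

variable {F G : Type*} [NormedAddCommGroup F] [NormedSpace ℝ F] [NormedAddCommGroup G]
  [NormedSpace ℝ G]

/-- `u` is a primitive of the locally integrable function `w`. -/
def IsPrimitive (u w : ℝ → F) : Prop :=
  (∀ a b, IntervalIntegrable w volume a b) ∧ ∀ a b, ∫ t in a..b, w t = u b - u a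

namespace IsPrimitive

variable {u v w z : ℝ → F}

theorem eq_add (h : IsPrimitive u w) (a t : ℝ) : u t = u a + ∫ s in a..t, w s := by
  rw [h.2]; abel

theorem continuous (h : IsPrimitive u w) : Continuous u := by
  have := (continuous_const (y := u 0)).add (intervalIntegral.continuous_primitive h.1 0)
  exact this.congr fun t => (h.eq_add 0 t).symm

theorem integral (hw : ∀ a b, IntervalIntegrable w volume a b) (a : ℝ) :
    IsPrimitive (fun t => ∫ s in a..t, w s) w :=
  ⟨hw, fun b c => by
    rw [← intervalIntegral.integral_interval_sub_left (hw a c) (hw a b)]⟩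

theorem add_const (h : IsPrimitive u w) (c : F) : IsPrimitive (fun t => u t + c) w :=
  ⟨h.1, fun a b => by rw [h.2]; dsimp only; abel⟩

theorem congr_ae (h : IsPrimitive u w) (hw : w =ᵐ[volume] z) : IsPrimitive u z :=
  ⟨fun a b => (h.1 a b).congr_ae (ae_restrict_of_ae hw), fun a b => by
    rw [← h.2, intervalIntegral.integral_congr_ae (hw.mono fun t ht _ => ht)]⟩

theorem add (h : IsPrimitive u w) (h' : IsPrimitive v z) :
    IsPrimitive (fun t => u t + v t) fun t => w t + z t :=
  ⟨fun a b => (h.1 a b).add (h'.1 a b), fun a b => by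
    rw [intervalIntegral.integral_add (h.1 a b) (h'.1 a b), h.2, h'.2]; dsimp only; abel⟩

theorem neg (h : IsPrimitive u w) : IsPrimitive (fun t => -u t) fun t => -w t :=
  ⟨fun a b => (h.1 a b).neg, fun a b => by
    rw [intervalIntegral.integral_neg, h.2]; dsimp only; abel⟩

theorem sub (h : IsPrimitive u w) (h' : IsPrimitive v z) :
    IsPrimitive (fun t => u t - v t) fun t => w t - z t := by
  simpa only [sub_eq_add_neg] using h.add h'.neg

theorem clm_apply [CompleteSpace F] [CompleteSpace G] (h : IsPrimitive u w) (A : F →L[ℝ] G) :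
    IsPrimitive (fun t => A (u t)) fun t => A (w t) :=
  ⟨fun a b => by
    have := h.1 a b
    exact ⟨A.integrable_comp this.1, A.integrable_comp this.2⟩, fun a b => by
    rw [A.intervalIntegral_comp_comm (h.1 a b), h.2, map_sub]⟩

theorem finsetSum {ι : Type*} (s : Finset ι) {u w : ι → ℝ → F} (h : ∀ i, IsPrimitive (u i) (w i)) :
    IsPrimitive (fun t => ∑ i ∈ s, u i t) fun t => ∑ i ∈ s, w i t := by
  classical
  induction s using Finset.induction_on with
  | empty => exact ⟨fun a b => by simp, fun a b => by simp⟩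
  | insert i s hi ih =>
    simp only [Finset.sum_insert hi]
    exact (h i).add ih

theorem locallyIntegrable (h : IsPrimitive u w) : LocallyIntegrable w volume := by
  rw [MeasureTheory.locallyIntegrable_iff]
  intro K hK
  obtain ⟨r, hr⟩ := hK.isBounded.subset_closedBall 0
  rw [Real.closedBall_eq_Icc] at hr
  have hle : 0 - |r| ≤ 0 + |r| := by linarith [abs_nonneg r]
  have hsub : Icc (0 - r) (0 + r) ⊆ Icc (0 - |r|) (0 + |r|) :=
    Icc_subset_Icc (by linarith [le_abs_self r]) (by linarith [le_abs_self r])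
  refine IntegrableOn.mono_set ?_ (hr.trans hsub)
  rw [integrableOn_Icc_iff_integrableOn_Ioc]
  exact (h.1 _ _).1

theorem of_hasDerivAt [CompleteSpace F] (h : ∀ t, HasDerivAt u (w t) t) (hw : Continuous w) :
    IsPrimitive u w :=
  ⟨fun a b => hw.intervalIntegrable a b, fun a b =>
    intervalIntegral.integral_eq_sub_of_hasDerivAt (fun t _ => h t) (hw.intervalIntegrable a b)⟩

theorem ae_hasDerivAt [CompleteSpace F] (h : IsPrimitive u w) :
    ∀ᵐ t, HasDerivAt u (w t) t := by
  filter_upwards [_root_.LocallyIntegrable.ae_hasDerivAt_integral h.locallyIntegrable] with t ht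
  exact ((ht 0).const_add (u 0)).congr_of_eventuallyEq (.of_forall fun s => h.eq_add 0 s)

/-- Since `w` and `z` are only locally integrable, the product rule is taken from absolutely
continuous functions, whose derivatives are `w` and `z` almost everywhere by Lebesgue
differentiation. -/
theorem mul {u v w z : ℝ → ℝ} (h : IsPrimitive u w) (h' : IsPrimitive v z) :
    IsPrimitive (fun t => u t * v t) fun t => w t * v t + u t * z t := by
  refine ⟨fun a b => ((h.1 a b).mul_continuousOn h'.continuous.continuousOn).add
    ((h'.1 a b).continuousOn_mul h.continuous.continuousOn), fun a b => ?_⟩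
  have hac : ∀ {u w : ℝ → ℝ}, IsPrimitive u w → AbsolutelyContinuousOnInterval u a b := by
    intro u w h
    have h1 := (h.1 a b).absolutelyContinuousOnInterval_intervalIntegral (c := a) (by simp)
    have h2 : AbsolutelyContinuousOnInterval (fun _ : ℝ => u a) a b :=
      ((LipschitzWith.const' (K := 0) (u a)).lipschitzOnWith).absolutelyContinuousOnInterval
    have h3 := h2.add h1
    have h4 : ((fun _ => u a) + fun x => ∫ v in a..x, w v) = u :=
      funext fun x => (h.eq_add a x).symm
    rwa [h4] at h3
  rw [← (hac h).integral_deriv_mul_eq_sub (hac h')]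
  refine intervalIntegral.integral_congr_ae ?_
  filter_upwards [h.ae_hasDerivAt, h'.ae_hasDerivAt] with t h1 h2 _
  rw [h1.deriv, h2.deriv]

variable {n : ℕ} {f g f' g' : ℝ → EuclideanSpace ℝ (Fin n)}

theorem apply (h : IsPrimitive f f') (i : Fin n) : IsPrimitive (fun t => f t i) fun t => f' t i :=
  h.clm_apply (EuclideanSpace.proj i)

theorem of_apply (h : ∀ i, IsPrimitive (fun t => f t i) fun t => f' t i) : IsPrimitive f f' := by
  have hdec : ∀ x : EuclideanSpace ℝ (Fin n),
      ∑ i, ((ContinuousLinearMap.id ℝ ℝ).smulRight (EuclideanSpace.single i (1 : ℝ))) (x i) = x := by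
    intro x
    ext j
    simp [Finset.sum_apply, Pi.single_apply]
  have := finsetSum Finset.univ fun i => (h i).clm_apply
    ((ContinuousLinearMap.id ℝ ℝ).smulRight (EuclideanSpace.single i (1 : ℝ)))
  simpa only [hdec] using this

theorem smul {χ χ' : ℝ → ℝ} (hχ : IsPrimitive χ χ') (h : IsPrimitive f f') :
    IsPrimitive (fun t => χ t • f t) fun t => χ' t • f t + χ t • f' t :=
  of_apply fun i => by simpa using hχ.mul (h.apply i)

theorem inner (h : IsPrimitive f f') (h' : IsPrimitive g g') :
    IsPrimitive (fun t => inner ℝ (f t) (g t))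
      fun t => inner ℝ (f' t) (g t) + inner ℝ (f t) (g' t) := by
  have := finsetSum Finset.univ fun i => (h.apply i).mul (h'.apply i)
  simp only [Finset.sum_add_distrib] at this
  simpa only [PiLp.inner_apply, RCLike.inner_apply, conj_trivial, mul_comm] using this

/-- Two primitives can be glued at a point where they agree. -/
theorem ite (h : IsPrimitive u w) (h' : IsPrimitive v z) {c : ℝ} (hc : u c = v c) :
    IsPrimitive (fun t => if t ≤ c then u t else v t) fun t => if t ≤ c then w t else z t := by
  have hi : ∀ a b, IntervalIntegrable (fun t => if t ≤ c then w t else z t) volume a b := by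
    intro a b
    have h1 := h.locallyIntegrable
    have h2 := h'.locallyIntegrable
    have h3 : LocallyIntegrable (fun t => if t ≤ c then w t else z t) volume := by
      have := (h1.indicator (measurableSet_Iic (a := c))).add
        (h2.indicator (measurableSet_Ioi (a := c)))
      refine this.congr (.of_forall fun t => ?_)
      by_cases ht : t ≤ c
      · simp [ht, indicator]
      · simp [ht, indicator, not_le.1 ht]
    exact intervalIntegrable_iff.2 ((h3.integrableOn_isCompact isCompact_uIcc).mono_set
      uIoc_subset_uIcc)
  have hbase : ∀ b, ∫ t in c..b, (if t ≤ c then w t else z t) =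
      (if b ≤ c then u b else v b) - u c := by
    intro b
    by_cases hb : b ≤ c
    · rw [if_pos hb, ← h.2]
      refine intervalIntegral.integral_congr_ae (.of_forall fun t ht => ?_)
      rw [uIoc_of_ge hb] at ht
      exact if_pos ht.2
    · rw [if_neg hb, hc, ← h'.2]
      refine intervalIntegral.integral_congr_ae (.of_forall fun t ht => ?_)
      rw [uIoc_of_le (not_le.1 hb).le] at ht
      exact if_neg ht.1.not_ge
  refine ⟨hi, fun a b => ?_⟩
  rw [← intervalIntegral.integral_interval_sub_left (hi c b) (hi c a), hbase, hbase]
  abel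

end IsPrimitive

/-- The primitive of `ψ` that starts at the left end of its support vanishes again to the right of
the support because `ψ` has mean zero; its support lies in the convex hull, hence in the order
connected set `U`. -/
theorem exists_deriv_eq {U : Set ℝ} (hUc : OrdConnected U)
    {ψ : ℝ → ℝ} (hψ : ContDiff ℝ ∞ ψ) (hψs : HasCompactSupport ψ) (hψU : tsupport ψ ⊆ U)
    (hψ0 : ∫ t, ψ t = 0) :
    ∃ φ : ℝ → ℝ, ContDiff ℝ ∞ φ ∧ HasCompactSupport φ ∧ tsupport φ ⊆ U ∧ deriv φ = ψ := by
  rcases (tsupport ψ).eq_empty_or_nonempty with he | hne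
  · have : ψ = 0 := tsupport_eq_empty_iff.1 he
    exact ⟨0, contDiff_const, HasCompactSupport.zero, by simp, by simp [this]⟩
  have hK : IsCompact (tsupport ψ) := hψs
  set a := sInf (tsupport ψ) with ha
  set b := sSup (tsupport ψ) with hb
  have haU : a ∈ U := hψU (hK.sInf_mem hne)
  have hbU : b ∈ U := hψU (hK.sSup_mem hne)
  have hsub : tsupport ψ ⊆ Icc a b := fun t ht =>
    ⟨csInf_le hK.bddBelow ht, le_csSup hK.bddAbove ht⟩
  have hψc := hψ.continuous
  have hder : ∀ t, HasDerivAt (fun s => ∫ r in a..s, ψ r) (ψ t) t := fun t =>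
    intervalIntegral.integral_hasDerivAt_right (hψc.intervalIntegrable _ _)
      hψc.aestronglyMeasurable.stronglyMeasurableAtFilter hψc.continuousAt
  have hd : deriv (fun s => ∫ r in a..s, ψ r) = ψ := funext fun t => (hder t).deriv
  have hsupp : Function.support (fun s => ∫ r in a..s, ψ r) ⊆ Icc a b := by
    intro s hs
    by_contra hmem
    apply hs
    rw [mem_Icc, not_and_or, not_le, not_le] at hmem
    rcases hmem with h | h
    · change ∫ r in a..s, ψ r = 0
      have hz : ∀ r ∈ uIoc a s, ψ r = 0 := fun r hr => by
        rw [uIoc_of_ge h.le] at hr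
        rcases hr.2.eq_or_lt with h1 | h1
        · by_contra hne0
          have h2 : ∀ᶠ x in 𝓝 a, ψ x ≠ 0 := hψc.continuousAt.eventually_ne (h1 ▸ hne0)
          obtain ⟨x, hx, hxa⟩ := (h2.and_frequently (Filter.Frequently.mono
            (frequently_lt_nhds a) fun x hx => hx)).exists
          exact hxa.not_ge (hsub (subset_tsupport _ hx)).1
        · by_contra hne0
          exact h1.not_ge (hsub (subset_tsupport _ hne0)).1
      exact intervalIntegral.integral_zero_ae (.of_forall hz)
    · change ∫ r in a..s, ψ r = 0
      have h1 : ∫ r in (a - 1)..s, ψ r = ∫ r, ψ r := by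
        refine intervalIntegral.integral_eq_integral_of_support_subset fun r hr => ?_
        have := hsub (subset_tsupport _ hr)
        exact ⟨by linarith [this.1], this.2.trans h.le⟩
      have h2 : ∫ r in (a - 1)..a, ψ r = 0 := by
        have hne : ∀ᵐ s : ℝ, s ≠ a := by simp [ae_iff, measure_singleton]
        refine intervalIntegral.integral_zero_ae ?_
        filter_upwards [hne] with r hra hr
        rw [uIoc_of_le (by linarith)] at hr
        by_contra hne0
        exact (lt_of_le_of_ne hr.2 hra).not_ge (hsub (subset_tsupport _ hne0)).1
      rw [← intervalIntegral.integral_add_adjacent_intervals (b := a)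
        (hψc.intervalIntegrable _ _) (hψc.intervalIntegrable _ _), h2, zero_add, hψ0] at h1
      exact h1
  have hts : tsupport (fun s => ∫ r in a..s, ψ r) ⊆ Icc a b := closure_minimal hsupp isClosed_Icc
  refine ⟨fun s => ∫ r in a..s, ψ r, ?_, ?_, hts.trans (hUc.out haU hbU), hd⟩
  · rw [contDiff_infty_iff_deriv, hd]
    exact ⟨fun t => (hder t).differentiableAt, hψ⟩
  · exact HasCompactSupport.of_support_subset_isCompact isCompact_Icc hsupp

/-- The lemma of du Bois-Reymond. -/
theorem ae_const_of_integral_deriv_smul_eq_zero [CompleteSpace F] {U : Set ℝ} (hU : IsOpen U)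
    (hUc : OrdConnected U) (hne : U.Nonempty) {g : ℝ → F} (hg : LocallyIntegrableOn g U volume)
    (h : ∀ φ : ℝ → ℝ, ContDiff ℝ ∞ φ → HasCompactSupport φ → tsupport φ ⊆ U →
      ∫ t, deriv φ t • g t = 0) : ∃ c, ∀ᵐ t, t ∈ U → g t = c := by
  obtain ⟨x₀, hx₀⟩ := hne
  obtain ⟨ε, hε, hball⟩ := Metric.isOpen_iff.1 hU x₀ hx₀
  let β : ContDiffBump x₀ := ⟨ε / 4, ε / 2, by positivity, by linarith⟩
  set η := β.normed volume with hη
  have hηd : ContDiff ℝ ∞ η := β.contDiff_normed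
  have hηs : HasCompactSupport η := β.hasCompactSupport_normed
  have hηU : tsupport η ⊆ U := by
    rw [hη, β.tsupport_normed_eq]
    exact (Metric.closedBall_subset_ball (by simp only [β]; linarith)).trans hball
  have hη1 : ∫ t, η t = 1 := β.integral_normed
  have hint : ∀ {ψ : ℝ → ℝ}, ContDiff ℝ ∞ ψ → HasCompactSupport ψ → tsupport ψ ⊆ U →
      Integrable (fun t => ψ t • g t) := by
    intro ψ hψ hψs hψU
    have h1 : IntegrableOn (fun t => ψ t • g t) (tsupport ψ) :=
      (hg.integrableOn_compact_subset hψU hψs).continuousOn_smul hψ.continuous.continuousOn hψs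
    rwa [integrableOn_iff_integrable_of_support_subset] at h1
    exact (Function.support_smul_subset_left _ _).trans (subset_tsupport _)
  -- For every test function `ψ` the difference `ψ - (∫ψ) η` has mean zero and is thus a derivative,
  -- so `∫ ψ g = (∫ψ) ∫ η g`. This identifies the constant.
  refine ⟨∫ t, η t • g t, ?_⟩
  have := hU.ae_eq_zero_of_integral_contDiff_smul_eq_zero (μ := volume)
    (f := fun t => g t - ∫ t, η t • g t)
    (hg.sub ((locallyIntegrable_const _).locallyIntegrableOn U)) ?_
  · filter_upwards [this] with t ht hmem
    exact sub_eq_zero.1 (ht hmem)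
  intro ψ hψ hψs hψU
  have hψi : Integrable ψ := hψ.continuous.integrable_of_hasCompactSupport hψs
  have hηi : Integrable η := hηd.continuous.integrable_of_hasCompactSupport hηs
  set c := ∫ t, ψ t with hc
  have hts : tsupport (fun t => ψ t - c * η t) ⊆ tsupport ψ ∪ tsupport η := by
    refine closure_minimal (fun t ht => ?_) ((isClosed_tsupport _).union (isClosed_tsupport _))
    by_contra hmem
    rw [mem_union, not_or] at hmem
    apply ht
    simp [image_eq_zero_of_notMem_tsupport hmem.1, image_eq_zero_of_notMem_tsupport hmem.2]
  obtain ⟨φ, hφ, hφs, hφU, hφd⟩ := exists_deriv_eq hUc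
    (ψ := fun t => ψ t - c * η t) (hψ.sub (contDiff_const.mul hηd))
    (HasCompactSupport.of_support_subset_isCompact (hψs.isCompact.union hηs.isCompact)
      ((subset_tsupport _).trans hts))
    (hts.trans (union_subset hψU hηU))
    (by rw [integral_sub hψi (hηi.const_mul c), integral_const_mul, hη1, mul_one, sub_self])
  have h1 := h φ hφ hφs hφU
  rw [hφd] at h1
  simp only [sub_smul, mul_smul] at h1
  have h2 := integral_sub (hint hψ hψs hψU) ((hint hηd hηs hηU).smul c)
  simp only [Pi.smul_apply] at h2
  rw [h2, integral_smul] at h1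
  simp only [smul_sub]
  rw [integral_sub (hint hψ hψs hψU) (hψi.smul_const _), integral_smul_const]
  exact h1

end Primitive

end


/-! ### Decay of primitives at infinity and integration by parts. -/

noncomputable section

theorem MeasureTheory.MemLp.integrable_inner_mul {α E : Type*} [MeasurableSpace α] {μ : Measure α}
    [NormedAddCommGroup E] [InnerProductSpace ℝ E] {f g : α → E} (hf : MemLp f 2 μ)
    (hg : MemLp g 2 μ) : Integrable (fun t => inner ℝ (f t) (g t)) μ :=
  (hf.norm.integrable_mul hg.norm).mono' (hf.1.inner hg.1)
    (.of_forall fun _ => norm_inner_le_norm _ _)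

namespace IsPrimitive

section Decay

variable {F : Type*} [NormedAddCommGroup F] [NormedSpace ℝ F] {u w : ℝ → F}

theorem comp_neg (h : IsPrimitive u w) : IsPrimitive (fun t => u (-t)) fun t => -w (-t) := by
  refine ⟨fun a b => ?_, fun a b => ?_⟩
  · have := ((IntervalIntegrable.iff_comp_neg (by finiteness)).1 (h.1 (-a) (-b))).neg
    rwa [neg_neg, neg_neg] at this
  · rw [intervalIntegral.integral_neg, intervalIntegral.integral_comp_neg (fun t => w t), h.2]
    simp

/-- Integrability of the derivative gives a limit at infinity, and integrability of the function
forces it to be zero. -/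
theorem tendsto_atTop_of_integrableOn [CompleteSpace F] (h : IsPrimitive u w) {a : ℝ}
    (hu : IntegrableOn u (Ioi a)) (hw : IntegrableOn w (Ioi a)) : Tendsto u atTop (𝓝 0) := by
  have h1 : Tendsto u atTop (𝓝 (u a + ∫ t in Ioi a, w t)) := by
    have := (intervalIntegral_tendsto_integral_Ioi a hw tendsto_id).const_add (u a)
    exact this.congr fun b => (h.eq_add a b).symm
  have h2 : u a + ∫ t in Ioi a, w t = 0 := by
    refine IntegrableAtFilter.eq_zero_of_tendsto (μ := volume) ⟨Ioi a, Ioi_mem_atTop a, hu⟩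
      (fun s hs => ?_) h1
    obtain ⟨b, hb⟩ := mem_atTop_sets.1 hs
    exact top_unique ((Real.volume_Ici (a := b)).ge.trans (measure_mono hb))
  rwa [h2] at h1

theorem integral_eq_zero [CompleteSpace F] (h : IsPrimitive u w) (hu : Integrable u)
    (hw : Integrable w) : ∫ t, w t = 0 := by
  have h1 : Tendsto u atTop (𝓝 0) :=
    h.tendsto_atTop_of_integrableOn (a := 0) hu.integrableOn hw.integrableOn
  have h2 : Tendsto (fun t => u (-t)) atTop (𝓝 0) :=
    h.comp_neg.tendsto_atTop_of_integrableOn (a := 0) hu.comp_neg.integrableOn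
      hw.comp_neg.neg.integrableOn
  have h3 := intervalIntegral_tendsto_integral hw tendsto_neg_atTop_atBot tendsto_id
  have h4 := h1.sub h2
  rw [sub_zero] at h4
  exact tendsto_nhds_unique h3 (h4.congr fun r => (h.2 _ _).symm)

end Decay

variable {n : ℕ} {u w : ℝ → EuclideanSpace ℝ (Fin n)}

/-- The scalar statement is applied to `‖u‖²`, whose derivative `2⟨w, u⟩` is integrable as a product
of `L²` functions. -/
theorem tendsto_atTop (h : IsPrimitive u w) {a : ℝ} (hu : MemLp u 2 (volume.restrict (Ioi a)))
    (hw : MemLp w 2 (volume.restrict (Ioi a))) : Tendsto u atTop (𝓝 0) := by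
  have h1 := (h.inner h).tendsto_atTop_of_integrableOn (a := a) (hu.integrable_inner_mul hu)
    ((hw.integrable_inner_mul hu).add (hu.integrable_inner_mul hw))
  rw [tendsto_zero_iff_norm_tendsto_zero]
  have h2 := h1.sqrt
  simpa only [real_inner_self_eq_norm_sq, Real.sqrt_zero, Real.sqrt_sq (norm_nonneg _)] using h2

theorem integral_deriv_smul (h : IsPrimitive u w) {φ : ℝ → ℝ} (hφ : ContDiff ℝ ∞ φ)
    (hφs : HasCompactSupport φ) : ∫ t, deriv φ t • u t = -∫ t, φ t • w t := by
  have hφd : Continuous (deriv φ) := hφ.continuous_deriv (by simp)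
  have h1 : IsPrimitive φ (deriv φ) :=
    .of_hasDerivAt (fun t => (hφ.differentiable (by simp) t).hasDerivAt) hφd
  have h2 := h1.smul h
  have hi : ∀ {ψ : ℝ → ℝ} {v : ℝ → EuclideanSpace ℝ (Fin n)}, Continuous ψ →
      HasCompactSupport ψ → LocallyIntegrable v volume → Integrable fun t => ψ t • v t :=
    fun hψ hψs hv => hv.integrable_smul_left_of_hasCompactSupport hψ hψs
  have hi1 := hi hφd hφs.deriv h.continuous.locallyIntegrable
  have hi2 := hi hφ.continuous hφs h.locallyIntegrable
  have h3 := h2.integral_eq_zero (hi hφ.continuous hφs h.continuous.locallyIntegrable)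
    (hi1.add hi2)
  rw [integral_add hi1 hi2] at h3
  exact eq_neg_of_add_eq_zero_left h3

end IsPrimitive

/-! ### Representatives of Sobolev functions -/

section Sobolev

variable {n : ℕ} {J : Set ℝ}

theorem mem_W12_of_isPrimitive {p : WithLp 2 (L2On n J × L2On n J)}
    {u w : ℝ → EuclideanSpace ℝ (Fin n)} (h : IsPrimitive u w)
    (hu : p.fst =ᵐ[volume.restrict J] u) (hw : p.snd =ᵐ[volume.restrict J] w) : p ∈ W12 n J := by
  intro φ hφ hφs hφJ
  have h1 : ∀ t, t ∉ J → φ t = 0 := fun t ht =>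
    image_eq_zero_of_notMem_tsupport fun hmem => ht (interior_subset (hφJ hmem))
  have h2 : ∀ t, t ∉ J → deriv φ t = 0 := fun t ht =>
    image_eq_zero_of_notMem_tsupport fun hmem =>
      ht (interior_subset (hφJ (tsupport_deriv_subset (𝕜 := ℝ) (f := φ) hmem)))
  have h3 : ∫ t in J, deriv φ t • p.fst t = ∫ t, deriv φ t • u t := by
    rw [← setIntegral_eq_integral_of_forall_compl_eq_zero (f := fun t => deriv φ t • u t) (s := J)
      fun t ht => by rw [h2 t ht, zero_smul]]
    exact integral_congr_ae (hu.mono fun t ht => by simp only [ht])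
  have h4 : ∫ t in J, φ t • p.snd t = ∫ t, φ t • w t := by
    rw [← setIntegral_eq_integral_of_forall_compl_eq_zero (f := fun t => φ t • w t) (s := J)
      fun t ht => by rw [h1 t ht, zero_smul]]
    exact integral_congr_ae (hw.mono fun t ht => by simp only [ht])
  rw [h3, h4, h.integral_deriv_smul hφ hφs]

/-- `u` is an absolutely continuous representative of the Sobolev function `p`, with
derivative `w`. -/
structure IsRep (p : W12 n J) (u w : ℝ → EuclideanSpace ℝ (Fin n)) : Prop where
  isPrimitive : IsPrimitive u w
  fst : p.1.fst =ᵐ[volume.restrict J] u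
  snd : p.1.snd =ᵐ[volume.restrict J] w

theorem exists_isRep_of_isPrimitive {u w : ℝ → EuclideanSpace ℝ (Fin n)}
    (h : IsPrimitive u w) (hu : MemLp u 2 (volume.restrict J))
    (hw : MemLp w 2 (volume.restrict J)) : ∃ p : W12 n J, IsRep p u w := by
  have h1 := hu.coeFn_toLp
  have h2 := hw.coeFn_toLp
  exact ⟨⟨WithLp.toLp 2 (hu.toLp, hw.toLp), mem_W12_of_isPrimitive h h1 h2⟩, h, h1, h2⟩

theorem IsRep.memLp_fst {p : W12 n J} {u w : ℝ → EuclideanSpace ℝ (Fin n)} (h : IsRep p u w) :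
    MemLp u 2 (volume.restrict J) := (memLp_congr_ae h.fst).1 (Lp.memLp _)

theorem IsRep.memLp_snd {p : W12 n J} {u w : ℝ → EuclideanSpace ℝ (Fin n)} (h : IsRep p u w) :
    MemLp w 2 (volume.restrict J) := (memLp_congr_ae h.snd).1 (Lp.memLp _)

theorem ae_mem_interior (hJ : OrdConnected J) :
    ∀ᵐ t ∂(volume.restrict J), t ∈ interior J := by
  rw [ae_restrict_iff' hJ.measurableSet]
  have h1 : volume (frontier J) = 0 := hJ.convex.addHaar_frontier volume
  have h2 : ∀ᵐ t, t ∉ frontier J := measure_eq_zero_iff_ae_notMem.1 h1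
  filter_upwards [h2] with t ht hmem
  by_contra hint
  exact ht ⟨subset_closure hmem, hint⟩

/-- The weak derivative, extended by zero, is integrated to `U`. Then `p.fst - U` has zero weak
derivative on the interior of `J` and is constant there by du Bois-Reymond. The extension makes the
representative a primitive on all of `ℝ`. -/
theorem W12.exists_isRep (hJ : OrdConnected J) (hne : (interior J).Nonempty) (p : W12 n J) :
    ∃ u, IsRep p u (J.indicator p.1.snd) := by
  have hJm := hJ.measurableSet
  have hloc : ∀ q : L2On n J, LocallyIntegrable (J.indicator q) volume := fun q =>
    ((memLp_indicator_iff_restrict hJm).2 (Lp.memLp q)).locallyIntegrable (by norm_num)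
  have hw : ∀ a b, IntervalIntegrable (J.indicator p.1.snd) volume a b := fun a b =>
    intervalIntegrable_iff.2 (((hloc _).integrableOn_isCompact isCompact_uIcc).mono_set
      uIoc_subset_uIcc)
  have hU := IsPrimitive.integral hw 0
  set U : ℝ → EuclideanSpace ℝ (Fin n) := fun t => ∫ s in (0 : ℝ)..t, J.indicator p.1.snd s
  obtain ⟨c, hc⟩ := ae_const_of_integral_deriv_smul_eq_zero isOpen_interior hJ.interior hne
    (g := fun t => J.indicator p.1.fst t - U t)
    (((hloc _).sub hU.continuous.locallyIntegrable).locallyIntegrableOn _) (by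
      intro φ hφ hφs hφJ
      have h1 : ∀ t, t ∉ J → φ t = 0 := fun t ht =>
        image_eq_zero_of_notMem_tsupport fun hmem => ht (interior_subset (hφJ hmem))
      have h2 : ∀ t, t ∉ J → deriv φ t = 0 := fun t ht =>
        image_eq_zero_of_notMem_tsupport fun hmem =>
          ht (interior_subset (hφJ (tsupport_deriv_subset (𝕜 := ℝ) (f := φ) hmem)))
      have hφd : Continuous (deriv φ) := hφ.continuous_deriv (by simp)
      have h3 := p.2 φ hφ hφs hφJ
      have h4 := hU.integral_deriv_smul hφ hφs
      have h5 : ∫ t, deriv φ t • J.indicator p.1.fst t = ∫ t in J, deriv φ t • p.1.fst t := by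
        rw [← integral_indicator hJm]
        congr 1
        ext1 t
        by_cases ht : t ∈ J <;> simp [ht]
      have h6 : ∫ t, φ t • J.indicator p.1.snd t = ∫ t in J, φ t • p.1.snd t := by
        rw [← integral_indicator hJm]
        congr 1
        ext1 t
        by_cases ht : t ∈ J <;> simp [ht]
      simp only [smul_sub]
      rw [integral_sub ((hloc _).integrable_smul_left_of_hasCompactSupport hφd hφs.deriv)
        (hU.continuous.locallyIntegrable.integrable_smul_left_of_hasCompactSupport hφd hφs.deriv),
        h4, h5, h6, h3, sub_self])
  refine ⟨fun t => U t + c, hU.add_const c, ?_, ?_⟩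
  · filter_upwards [ae_mem_interior hJ, ae_restrict_of_ae hc] with t ht htc
    have := htc ht
    rw [indicator_of_mem (interior_subset ht)] at this
    rw [← this]
    abel
  · filter_upwards [ae_restrict_mem hJm] with t ht
    rw [indicator_of_mem ht]

theorem exists_pairing_memLp {φ : ℝ → ℝ} (hφ : MemLp φ 2 (volume.restrict J)) :
    ∃ L : L2On n J →L[ℝ] EuclideanSpace ℝ (Fin n), ∀ u, L u = ∫ t in J, φ t • u t := by
  refine ⟨(ContinuousLinearMap.lsmul ℝ ℝ).lpPairing (volume.restrict J) 2 2 hφ.toLp, fun u => ?_⟩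
  rw [ContinuousLinearMap.lpPairing_eq_integral]
  refine integral_congr_ae ?_
  filter_upwards [hφ.coeFn_toLp] with t ht
  simp [ht]

/-- Evaluation at a point is a bounded operator on the Sobolev space. -/
theorem exists_evaluation {a t₀ : ℝ} (hne : a ≠ t₀) (hsub : uIcc a t₀ ⊆ J) :
    ∃ L : W12 n J →L[ℝ] EuclideanSpace ℝ (Fin n), ∀ p u w, IsRep p u w → L p = u t₀ := by
  have hsub' : uIoc a t₀ ⊆ J := uIoc_subset_uIcc.trans hsub
  have hmem : ∀ f : ℝ → ℝ, Continuous f →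
      MemLp ((uIoc a t₀).indicator f) 2 (volume.restrict J) := by
    intro f hf
    refine MemLp.restrict J ((memLp_indicator_iff_restrict measurableSet_uIoc).2 ?_)
    obtain ⟨C, hC⟩ := (isCompact_uIcc (a := a) (b := t₀)).exists_bound_of_continuousOn
      hf.continuousOn
    have : IsFiniteMeasure (volume.restrict (uIoc a t₀)) :=
      ⟨by rw [Measure.restrict_apply_univ, uIoc, Real.volume_Ioc]; exact ENNReal.ofReal_lt_top⟩
    refine MemLp.of_bound hf.aestronglyMeasurable C ?_
    filter_upwards [ae_restrict_mem measurableSet_uIoc] with t ht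
    exact hC t (uIoc_subset_uIcc ht)
  -- With the linear ramp `θ` from `0` at `a` to `1` at `t₀`, `u t₀` is the integral of `θ' u + θ w`
  -- from `a` to `t₀`, a bounded functional of the pair in `L² × L²`. The sign in the witness
  -- accounts for `t₀ < a`.
  set θ : ℝ → ℝ := fun t => (t - a) * (t₀ - a)⁻¹ with hθ
  have hθ' : IsPrimitive θ fun _ => (t₀ - a)⁻¹ :=
    .of_hasDerivAt (fun t => by simpa using ((hasDerivAt_id t).sub_const a).mul_const (t₀ - a)⁻¹)
      continuous_const
  obtain ⟨L₁, hL₁⟩ := exists_pairing_memLp (n := n) (hmem _ (continuous_const (y := (t₀ - a)⁻¹)))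
  obtain ⟨L₂, hL₂⟩ := exists_pairing_memLp (n := n) (hmem _ hθ'.continuous)
  have hset : ∀ (f : ℝ → ℝ) (v v' : ℝ → EuclideanSpace ℝ (Fin n)),
      v =ᵐ[volume.restrict J] v' →
      ∫ t in J, (uIoc a t₀).indicator f t • v t = ∫ t in uIoc a t₀, f t • v' t := by
    intro f v v' hv
    rw [← integral_indicator measurableSet_uIoc,
      ← setIntegral_eq_integral_of_forall_compl_eq_zero (s := J) (fun t ht =>
        indicator_of_notMem (fun h => ht (hsub' h)) _)]
    refine integral_congr_ae (hv.mono fun t ht => ?_)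
    by_cases h : t ∈ uIoc a t₀ <;> simp [h, ht]
  refine ⟨((if a ≤ t₀ then 1 else -1 : ℝ)) • ((L₁ ∘L WithLp.fstL 2 ℝ _ _ +
    L₂ ∘L WithLp.sndL 2 ℝ _ _) ∘L (W12 n J).subtypeL), fun p u w h => ?_⟩
  have h1 := hθ'.smul h.isPrimitive
  have h2 := h1.2 a t₀
  have h3 : θ a = 0 := by simp [hθ]
  have h4 : θ t₀ = 1 := mul_inv_cancel₀ (sub_ne_zero.2 hne.symm)
  dsimp only at h2
  rw [h3, h4, one_smul, zero_smul, sub_zero,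
    intervalIntegral.intervalIntegral_eq_integral_uIoc] at h2
  rw [← h2]
  change (if a ≤ t₀ then 1 else -1 : ℝ) • (L₁ p.1.fst + L₂ p.1.snd) = _
  rw [hL₁, hL₂, hset _ _ _ h.fst, hset _ _ _ h.snd, integral_add]
  · have hc : Continuous fun t => (t₀ - a)⁻¹ • u t := by
      have := h.isPrimitive.continuous
      fun_prop
    exact intervalIntegrable_iff.1 (hc.intervalIntegrable a t₀)
  · exact intervalIntegrable_iff.1
      ((h.isPrimitive.1 a t₀).continuousOn_smul hθ'.continuous.continuousOn)

end Sobolev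

end


noncomputable section

/-! ### First order operators on the line -/

section Operator

variable {n : ℕ} {J : Set ℝ}

theorem coeFn_mulOp {a : ℝ → EuclideanSpace ℝ (Fin n) →L[ℝ] EuclideanSpace ℝ (Fin n)}
    (ha : MemLp a ∞ (volume.restrict J)) (f : L2On n J) :
    mulOp ha f =ᵐ[volume.restrict J] fun t => a t (f t) := by
  refine (ContinuousLinearMap.coeFn_holder _ _ _).trans ?_
  filter_upwards [ha.coeFn_toLp] with t ht
  rw [ht]
  rfl

theorem norm_mulOp_sub_le {a b : ℝ → EuclideanSpace ℝ (Fin n) →L[ℝ] EuclideanSpace ℝ (Fin n)}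
    (ha : MemLp a ∞ (volume.restrict J)) (hb : MemLp b ∞ (volume.restrict J)) {C : ℝ}
    (hC : 0 ≤ C) (h : ∀ t, ‖a t - b t‖ ≤ C) : ‖mulOp ha - mulOp hb‖ ≤ C := by
  refine ContinuousLinearMap.opNorm_le_bound _ hC fun f => ?_
  refine Lp.norm_le_mul_norm_of_ae_le_mul ?_
  rw [_root_.sub_apply]
  filter_upwards [Lp.coeFn_sub (mulOp ha f) (mulOp hb f), coeFn_mulOp ha f, coeFn_mulOp hb f]
    with t h1 h2 h3
  rw [h1, Pi.sub_apply, h2, h3, ← _root_.sub_apply]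
  exact (ContinuousLinearMap.le_opNorm _ _).trans
    (mul_le_mul_of_nonneg_right (h t) (norm_nonneg _))

/-- The operator `u ↦ u' - a u`. -/
def coeffOp {a : ℝ → EuclideanSpace ℝ (Fin n) →L[ℝ] EuclideanSpace ℝ (Fin n)}
    (ha : MemLp a ∞ (volume.restrict J)) : W12 n J →L[ℝ] L2On n J :=
  (WithLp.sndL 2 ℝ _ _ - mulOp ha ∘L WithLp.fstL 2 ℝ _ _) ∘L (W12 n J).subtypeL

theorem coeffOp_apply {a : ℝ → EuclideanSpace ℝ (Fin n) →L[ℝ] EuclideanSpace ℝ (Fin n)}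
    (ha : MemLp a ∞ (volume.restrict J)) (p : W12 n J) :
    coeffOp ha p = p.1.snd - mulOp ha p.1.fst := rfl

theorem IsRep.coeffOp_ae {a : ℝ → EuclideanSpace ℝ (Fin n) →L[ℝ] EuclideanSpace ℝ (Fin n)}
    (ha : MemLp a ∞ (volume.restrict J)) {p : W12 n J} {u w : ℝ → EuclideanSpace ℝ (Fin n)}
    (h : IsRep p u w) : coeffOp ha p =ᵐ[volume.restrict J] fun t => w t - a t (u t) := by
  rw [coeffOp_apply]
  filter_upwards [Lp.coeFn_sub p.1.snd (mulOp ha p.1.fst), coeFn_mulOp ha p.1.fst, h.fst, h.snd]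
    with t h1 h2 h3 h4
  rw [h1, Pi.sub_apply, h2, h3, h4]

/-- By symmetry of `K` the integrand is half the derivative of `⟨Ku, u⟩`, which is integrable
together with that derivative. -/
theorem inner_compLpL_snd_eq_zero
    {K : EuclideanSpace ℝ (Fin n) →L[ℝ] EuclideanSpace ℝ (Fin n)}
    (hK : ∀ x y, inner ℝ (K x) y = inner ℝ x (K y)) (p : W12 n univ) :
    inner ℝ (K.compLpL 2 _ p.1.fst) p.1.snd = 0 := by
  obtain ⟨u, hu⟩ := W12.exists_isRep ordConnected_univ (by simp) p
  set w := univ.indicator p.1.snd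
  have hm : MemLp u 2 volume := by simpa using hu.memLp_fst
  have hmw : MemLp w 2 volume := by simpa using hu.memLp_snd
  have h1 := (hu.isPrimitive.clm_apply K).inner hu.isPrimitive
  have hKu := K.comp_memLp' hm
  have hKw := K.comp_memLp' hmw
  have hsym : ∀ t, inner ℝ (K (w t)) (u t) = inner ℝ (K (u t)) (w t) := fun t => by
    rw [hK, real_inner_comm]
  have hi : Integrable fun t => inner ℝ (K (u t)) (w t) := hKu.integrable_inner_mul hmw
  have h2 := h1.integral_eq_zero (hKu.integrable_inner_mul hm) (by
    simp only [hsym]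
    exact hi.add hi)
  simp only [hsym] at h2
  rw [integral_add hi hi] at h2
  rw [L2.inner_def]
  have h6 : ∫ t in univ, inner ℝ ((K.compLpL 2 _ p.1.fst) t) (p.1.snd t) =
      ∫ t, inner ℝ (K (u t)) (w t) := by
    rw [← setIntegral_univ (μ := volume) (f := fun t => inner ℝ (K (u t)) (w t))]
    refine integral_congr_ae ?_
    filter_upwards [hu.fst, hu.snd, K.coeFn_compLpL p.1.fst] with t h3 h4 h5
    rw [← h3, ← h4, h5]
  rw [h6]
  linarith

/-- The operator `u ↦ u' - a u` on the line is invertible if `a` admits a Lyapunov function. -/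
theorem bijective_coeffOp {a : ℝ → EuclideanSpace ℝ (Fin n) →L[ℝ] EuclideanSpace ℝ (Fin n)}
    (ha : MemLp a ∞ (volume.restrict univ))
    {H : EuclideanSpace ℝ (Fin n) →L[ℝ] EuclideanSpace ℝ (Fin n)}
    (hH : ∀ x y, inner ℝ (H x) y = inner ℝ x (H y)) {c : ℝ} (hc : 0 < c)
    (h : ∀ t v, c * ‖v‖ ^ 2 ≤ inner ℝ (H v) (a t v)) : Function.Bijective (coeffOp ha) := by
  set B := mulOp ha with hB
  set LH : L2On n univ →L[ℝ] L2On n univ := H.compLpL 2 (volume.restrict univ) with hLH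
  have hlow : ∀ f : L2On n univ, c * ‖f‖ ^ 2 ≤ inner ℝ (LH f) (B f) := by
    intro f
    have hf : MemLp f 2 (volume.restrict univ) := Lp.memLp f
    rw [← real_inner_self_eq_norm_sq, L2.inner_def, L2.inner_def, ← integral_const_mul]
    refine integral_mono_ae ((hf.integrable_inner_mul hf).const_mul c)
      (MemLp.integrable_inner_mul (Lp.memLp _) (Lp.memLp _)) ?_
    filter_upwards [H.coeFn_compLpL f, coeFn_mulOp ha f] with t h1 h2
    rw [h1, h2, real_inner_self_eq_norm_sq]
    exact h t _
  -- Pairing `u' - au` with `Hu` removes the derivative term and leaves the coercive one. With the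
  -- equation controlling `u'`, this bounds the whole Sobolev norm, giving injectivity and closed
  -- range.
  have hest : ∀ p : W12 n univ, c * ‖p.1.fst‖ ≤ ‖LH‖ * ‖coeffOp ha p‖ := by
    intro p
    have h1 := inner_compLpL_snd_eq_zero hH p
    have h2 := hlow p.1.fst
    have h3 : inner ℝ (LH p.1.fst) (coeffOp ha p) = -inner ℝ (LH p.1.fst) (B p.1.fst) := by
      rw [coeffOp_apply, inner_sub_right, h1, zero_sub]
    have h4 : c * ‖p.1.fst‖ ^ 2 ≤ ‖LH‖ * ‖p.1.fst‖ * ‖coeffOp ha p‖ := by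
      refine h2.trans ?_
      have h5 := abs_real_inner_le_norm (LH p.1.fst) (coeffOp ha p)
      rw [h3, abs_neg] at h5
      exact (le_abs_self _).trans (h5.trans
        (mul_le_mul_of_nonneg_right (LH.le_opNorm _) (norm_nonneg _)))
    rcases (norm_nonneg p.1.fst).eq_or_lt with h0 | h0
    · rw [← h0, mul_zero]
      positivity
    · nlinarith
  have hbound : ∀ p : W12 n univ,
      ‖p‖ ≤ ((1 + ‖B‖) * (‖LH‖ / c) + 1) * ‖coeffOp ha p‖ := by
    intro p
    have h1 : ‖p.1.fst‖ ≤ ‖LH‖ / c * ‖coeffOp ha p‖ := by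
      rw [div_mul_eq_mul_div, le_div_iff₀ hc, mul_comm]
      exact hest p
    have h2 : ‖p.1.snd‖ ≤ ‖coeffOp ha p‖ + ‖B‖ * ‖p.1.fst‖ := by
      have : p.1.snd = coeffOp ha p + B p.1.fst := by rw [coeffOp_apply]; abel
      rw [this]
      exact (norm_add_le _ _).trans (add_le_add_right (B.le_opNorm _) _)
    have h3 : ‖p‖ ≤ ‖p.1.fst‖ + ‖p.1.snd‖ := by
      have : ‖p‖ = ‖p.1‖ := rfl
      rw [this, WithLp.prod_norm_eq_of_L2]
      refine Real.sqrt_le_iff.2 ⟨by positivity, ?_⟩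
      nlinarith [norm_nonneg p.1.fst, norm_nonneg p.1.snd]
    nlinarith [norm_nonneg B]
  have hanti : AntilipschitzWith ((1 + ‖B‖₊) * (‖LH‖₊ / c.toNNReal) + 1) (coeffOp ha) := by
    refine (coeffOp ha).antilipschitz_of_bound fun p => ?_
    simpa [hc.le] using hbound p
  refine ⟨hanti.injective, ?_⟩
  have hclosed : IsClosed ((coeffOp ha).range : Set (L2On n univ)) := by
    have hr : ((coeffOp ha).range : Set (L2On n univ)) = range (coeffOp ha) := by
      ext
      rfl
    rw [hr]
    exact hanti.isClosed_range (coeffOp ha).uniformContinuous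
  have hcomplete : CompleteSpace (coeffOp ha).range := hclosed.completeSpace_coe
  refine LinearMap.range_eq_top (f := (coeffOp ha : W12 n univ →ₗ[ℝ] L2On n univ)) |>.1 ?_
  rw [← Submodule.orthogonal_eq_bot_iff, Submodule.eq_bot_iff]
  intro g hg
  have hg' : ∀ p : W12 n univ, inner ℝ (coeffOp ha p) g = 0 := fun p =>
    (Submodule.mem_orthogonal _ _).1 hg _ ⟨p, rfl⟩
  set g' : L2On n univ := -(ContinuousLinearMap.adjoint B g) with hg'def
  -- Testing orthogonality to the range against functions `φ v` shows that `g` is weakly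
  -- differentiable and solves the adjoint equation.
  have hmem : WithLp.toLp 2 (g, g') ∈ W12 n univ := by
    intro φ hφ hφs _
    have hφd : Continuous (deriv φ) := hφ.continuous_deriv (by simp)
    have hprim : IsPrimitive φ (deriv φ) :=
      .of_hasDerivAt (fun t => (hφ.differentiable (by simp) t).hasDerivAt) hφd
    change ∫ t in univ, deriv φ t • g t = -∫ t in univ, φ t • g' t
    have hvec : ∀ (v : EuclideanSpace ℝ (Fin n)) (ψ : ℝ → ℝ) (f : L2On n univ), Continuous ψ →
        HasCompactSupport ψ →
        inner ℝ v (∫ t in univ, ψ t • f t) = ∫ t in univ, inner ℝ (ψ t • v) (f t) := by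
      intro v ψ f hψ hψs
      have hi : Integrable (fun t => ψ t • f t) (volume.restrict univ) := by
        have : LocallyIntegrable f (volume.restrict univ) :=
          (Lp.memLp f).locallyIntegrable (by norm_num)
        exact this.integrable_smul_left_of_hasCompactSupport hψ hψs
      rw [← integral_inner hi]
      simp only [inner_smul_left, inner_smul_right, conj_trivial]
    refine ext_inner_left ℝ fun v => ?_
    rw [inner_neg_right, hvec v _ _ hφd hφs.deriv, hvec v _ _ hφ.continuous hφs]
    have hp1 : MemLp (fun t => φ t • v) 2 (volume.restrict univ) :=
      ((hφ.continuous.smul continuous_const).memLp_of_hasCompactSupport hφs.smul_right).restrict univ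
    have hp2 : MemLp (fun t => deriv φ t • v) 2 (volume.restrict univ) :=
      ((hφd.smul continuous_const).memLp_of_hasCompactSupport hφs.deriv.smul_right).restrict univ
    have hprim' : IsPrimitive (fun t => φ t • v) fun t => deriv φ t • v :=
      hprim.clm_apply ((ContinuousLinearMap.id ℝ ℝ).smulRight v)
    obtain ⟨p, hp⟩ := exists_isRep_of_isPrimitive hprim' hp1 hp2
    have h1 := hg' p
    rw [coeffOp_apply, inner_sub_left, sub_eq_zero, ← hB,
      ← ContinuousLinearMap.adjoint_inner_right, L2.inner_def, L2.inner_def] at h1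
    have h2 : ∫ t in univ, inner ℝ (deriv φ t • v) (g t) = ∫ t in univ, inner ℝ (p.1.snd t) (g t) :=
      integral_congr_ae (hp.snd.mono fun t ht => by simp only [ht])
    have h3 : ∫ t in univ, inner ℝ (φ t • v) (g' t) =
        -∫ t in univ, inner ℝ (p.1.fst t) (ContinuousLinearMap.adjoint B g t) := by
      rw [← integral_neg]
      refine integral_congr_ae ?_
      filter_upwards [hp.fst, Lp.coeFn_neg (ContinuousLinearMap.adjoint B g)] with t h4 h5
      rw [h4, hg'def, h5, Pi.neg_apply, inner_neg_right]
    rw [h2, h3, neg_neg]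
    exact h1
  have hHinj : Function.Injective H := by
    rw [injective_iff_map_eq_zero]
    intro v hv
    have := h 0 v
    rw [hv, inner_zero_left] at this
    have h2 : ‖v‖ ^ 2 ≤ 0 := by
      by_contra h3
      exact (mul_pos hc (not_le.1 h3)).not_ge this
    exact norm_eq_zero.1 (pow_eq_zero_iff two_ne_zero |>.1 (le_antisymm h2 (sq_nonneg _)))
  let e := (LinearEquiv.ofInjectiveEndo (H : EuclideanSpace ℝ (Fin n) →ₗ[ℝ] _)
    hHinj).toContinuousLinearEquiv
  have he : ∀ v, e v = H v := fun v => rfl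
  -- The inverse of `H` serves as Lyapunov form for the adjoint equation: with `y = H⁻¹ g`, the
  -- vanishing of `⟨H⁻¹ g, g'⟩` becomes `⟨Hy, By⟩ = 0`, and coercivity forces `y = 0`.
  let K : EuclideanSpace ℝ (Fin n) →L[ℝ] EuclideanSpace ℝ (Fin n) := e.symm
  have hHK : ∀ v, H (K v) = v := fun v => e.apply_symm_apply v
  have hK : ∀ x y, inner ℝ (K x) y = inner ℝ x (K y) := by
    intro x y
    conv_lhs => rw [← hHK y]
    rw [← hH, hHK]
  have h1 := inner_compLpL_snd_eq_zero hK ⟨_, hmem⟩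
  set y : L2On n univ := K.compLpL 2 _ g with hy
  have hLHy : LH y = g := by
    refine Lp.ext ?_
    filter_upwards [H.coeFn_compLpL y, K.coeFn_compLpL g] with t h2 h3
    rw [h2, h3, hHK]
  have h2 : inner ℝ (LH y) (B y) = 0 := by
    have h3 : inner ℝ y g' = 0 := h1
    rw [hg'def, inner_neg_right, neg_eq_zero, ContinuousLinearMap.adjoint_inner_right] at h3
    rw [hLHy, real_inner_comm, h3]
  have h3 := hlow y
  rw [h2] at h3
  have h4 : ‖y‖ = 0 := by
    by_contra h5
    have : 0 < ‖y‖ := lt_of_le_of_ne (norm_nonneg _) (Ne.symm h5)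
    nlinarith [mul_pos hc (pow_pos this 2)]
  rw [← hLHy, norm_eq_zero.1 h4, map_zero]

end Operator

end


noncomputable section

/-! ### Lyapunov forms of hyperbolic matrices -/

section Lyapunov

/-- Enlarging a Lyapunov form of a hyperplane to the whole space. -/
theorem exists_lyapunov_const {c s C : ℝ} (hc : 0 < c) (hs : 0 < s) :
    ∃ K : ℝ, ∃ c' > 0, ∀ x y : ℝ, 0 ≤ x → 0 ≤ y →
      c' * (x + y) ^ 2 ≤ c * x ^ 2 - C * x * y + K * s * y ^ 2 := by
  -- The share `C²/c` of `K s` absorbs the cross term, leaving at least `(3/4) c x²`; the share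
  -- `c/2` keeps a positive multiple of `y²`.
  refine ⟨(C ^ 2 / c + c / 2) / s, c / 8, by positivity, fun x y hx hy => ?_⟩
  rw [div_mul_cancel₀ _ hs.ne']
  have h1 : C ^ 2 / c * y ^ 2 = c * (C / c * y) ^ 2 := by field_simp
  have h2 : C * x * y = c * x * (C / c * y) := by field_simp
  rw [add_mul, h1, h2]
  nlinarith [mul_nonneg hc.le (sq_nonneg (x / 2 - C / c * y)), mul_nonneg hc.le (sq_nonneg (x - y)),
    mul_nonneg hc.le (sq_nonneg (C / c * y)), mul_nonneg hc.le (sq_nonneg x),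
    mul_nonneg hc.le (sq_nonneg y)]

/-- An endomorphism of a complex vector space without eigenvalues on the imaginary axis admits a
Lyapunov form. -/
theorem exists_lyapunov_complex (d : ℕ) : ∀ (V : Type) [NormedAddCommGroup V] [NormedSpace ℂ V]
    [FiniteDimensional ℂ V] (f : V →ₗ[ℂ] V), Module.finrank ℂ V = d →
    (∀ (z : ℂ) (v : V), f v = z • v → v ≠ 0 → z.re ≠ 0) →
    ∃ B : V →L[ℝ] V →L[ℝ] ℝ, (∀ v w, B v w = B w v) ∧
      ∃ c > 0, ∀ v, c * ‖v‖ ^ 2 ≤ B v (f v) := by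
  induction d with
  | zero =>
    intro V _ _ _ f hV _
    have := Module.finrank_zero_iff.1 hV
    exact ⟨0, fun _ _ => rfl, 1, one_pos, fun v => by simp [Subsingleton.elim v 0]⟩
  | succ d ih =>
    intro V _ _ _ f hV hf
    have : Nontrivial V := Module.nontrivial_of_finrank_pos (R := ℂ) (by omega)
    -- An eigenvector `φ` of the transpose has an invariant hyperplane as kernel, to which induction
    -- applies, and `f` acts on the quotient as `z`.
    obtain ⟨z, hz⟩ := Module.End.exists_eigenvalue (Module.Dual.transpose (R := ℂ) f)
    obtain ⟨φ, hφ⟩ := hz.exists_hasEigenvector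
    have hφf : ∀ v, φ (f v) = z * φ v := fun v => by
      have := congrArg (fun ψ : Module.Dual ℂ V => ψ v) hφ.apply_eq_smul
      exact this
    obtain ⟨v₀, hv₀⟩ : ∃ v, φ v ≠ 0 := by
      by_contra! h
      exact hφ.2 (LinearMap.ext h)
    have hzre : z.re ≠ 0 := by
      by_contra h0
      -- If `z` were imaginary, `f - z` would be injective and hence onto, whereas `φ` vanishes on
      -- its range.
      have hinj : Function.Injective (f - z • (LinearMap.id : V →ₗ[ℂ] V)) := by
        refine (injective_iff_map_eq_zero (f - z • (LinearMap.id : V →ₗ[ℂ] V))).2 fun v hv => ?_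
        by_contra hv0
        exact hf z v (sub_eq_zero.1 (by simpa using hv)) hv0 h0
      obtain ⟨v, hv⟩ := (LinearMap.injective_iff_surjective.1 hinj) v₀
      refine hv₀ ?_
      rw [← hv]
      simp [hφf]
    set v₁ := (φ v₀)⁻¹ • v₀ with hv₁
    have hφv₁ : φ v₁ = 1 := by simp [hv₁, hv₀]
    let W : Submodule ℂ V := φ.ker
    have hWd : Module.finrank ℂ W = d := by
      have h1 := φ.finrank_range_add_finrank_ker
      have h2 : φ.range = ⊤ := LinearMap.range_eq_top.2 fun a => ⟨a • v₁, by simp [hφv₁]⟩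
      rw [h2, finrank_top, Module.finrank_self] at h1
      change 1 + Module.finrank ℂ W = _ at h1
      omega
    have hWf : ∀ w ∈ W, f w ∈ W := fun w hw => by
      have : φ w = 0 := hw
      change φ (f w) = 0
      rw [hφf, this, mul_zero]
    obtain ⟨B, hB, c, hc, hBc⟩ := ih W (f.restrict hWf) hWd fun z w hw hw0 =>
      hf z w (congrArg Subtype.val hw) (by simpa using hw0)
    let πₗ : V →ₗ[ℂ] W := (LinearMap.id - φ.smulRight v₁).codRestrict W fun v => by
      change φ _ = 0
      simp [hφv₁]
    have hπₗ : ∀ v, (πₗ v : V) = v - φ v • v₁ := fun v => rfl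
    let π : V →L[ℝ] W := (LinearMap.toContinuousLinearMap πₗ).restrictScalars ℝ
    have hπ : ∀ v, π v = πₗ v := fun v => rfl
    let φ' : V →L[ℝ] ℂ := (LinearMap.toContinuousLinearMap φ).restrictScalars ℝ
    have hφ' : ∀ v, φ' v = φ v := fun v => rfl
    let g : W := πₗ (f v₁)
    have hπf : ∀ v, π (f v) = f.restrict hWf (π v) + φ v • g := fun v => by
      apply Subtype.ext
      simp only [hπ, hπₗ, Submodule.coe_add, LinearMap.coe_restrict_apply, Submodule.coe_smul, g,
        map_sub, map_smul, hφf, hφv₁, mul_one, smul_sub, smul_smul]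
      rw [mul_comm (φ v) z]
      abel
    obtain ⟨K, c', hc', hK⟩ := exists_lyapunov_const (C := ‖B‖ * ‖g‖) hc (abs_pos.2 hzre)
    obtain ⟨ε, hε⟩ : ∃ ε : ℝ, ε * z.re = |z.re| := by
      rcases abs_cases z.re with h | h
      · exact ⟨1, by rw [h.1, one_mul]⟩
      · exact ⟨-1, by rw [h.1, neg_one_mul]⟩
    let ψ : ℂ →L[ℝ] ℂ →L[ℝ] ℝ :=
      Complex.reCLM.smulRight Complex.reCLM + Complex.imCLM.smulRight Complex.imCLM
    have hψ : ∀ a b, ψ a b = a.re * b.re + a.im * b.im := fun a b => rfl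
    -- The form of the hyperplane is augmented by a multiple of `Re(φ v · conj (φ w))`. The sign `ε`
    -- makes this part positive along `f`, and `K` is large enough to dominate the off-diagonal term
    -- `B (π v) (φ v • g)`.
    refine ⟨B.bilinearComp π π + (K * ε) • ψ.bilinearComp φ' φ',
      fun v w => ?_, c' / (1 + ‖v₁‖) ^ 2, by positivity, fun v => ?_⟩
    · simp only [_root_.add_apply, _root_.smul_apply, ContinuousLinearMap.bilinearComp_apply,
        hB (π v), hψ, mul_comm]
    · have h1 : (B.bilinearComp π π +
          (K * ε) • ψ.bilinearComp φ' φ') v (f v) =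
          B (π v) (f.restrict hWf (π v)) + B (π v) (φ v • g) + K * |z.re| * ‖φ v‖ ^ 2 := by
        have h2 : ψ (φ v) (z * φ v) = z.re * ‖φ v‖ ^ 2 := by
          rw [hψ, Complex.sq_norm, Complex.normSq_apply, Complex.mul_re, Complex.mul_im]
          ring
        simp only [_root_.add_apply, _root_.smul_apply,
          ContinuousLinearMap.bilinearComp_apply, hφ', hφf, hπf, map_add, h2,
          smul_eq_mul, ← hε]
        ring
      have h3 : -(‖B‖ * ‖g‖ * ‖π v‖ * ‖φ v‖) ≤ B (π v) (φ v • g) := by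
        have h4 := B.le_opNorm₂ (π v) (φ v • g)
        rw [norm_smul, Real.norm_eq_abs] at h4
        have := neg_abs_le (B (π v) (φ v • g))
        nlinarith
      have h5 : ‖v‖ ≤ (1 + ‖v₁‖) * (‖π v‖ + ‖φ v‖) := by
        have h6 : v = (π v : V) + φ v • v₁ := by rw [hπ, hπₗ]; abel
        have h7 : ‖v‖ ≤ ‖π v‖ + ‖φ v‖ * ‖v₁‖ := by
          conv_lhs => rw [h6]
          refine (norm_add_le _ _).trans_eq ?_
          rw [norm_smul]
          rfl
        nlinarith [norm_nonneg (π v), norm_nonneg (φ v), norm_nonneg v₁,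
          mul_nonneg (norm_nonneg (π v)) (norm_nonneg v₁)]
      have h8 := hK ‖π v‖ ‖φ v‖ (norm_nonneg _) (norm_nonneg _)
      rw [h1]
      refine le_trans ?_ (h8.trans ?_)
      · rw [div_mul_eq_mul_div, div_le_iff₀ (by positivity), mul_assoc]
        refine mul_le_mul_of_nonneg_left ?_ hc'.le
        rw [← mul_pow, mul_comm]
        exact pow_le_pow_left₀ (norm_nonneg _) h5 2
      · have := hBc (π v)
        linarith

theorem complexify_toEuclideanCLM {n : ℕ} (M : Matrix (Fin n) (Fin n) ℝ)
    (v : EuclideanSpace ℝ (Fin n)) :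
    complexify n (Matrix.toEuclideanCLM (𝕜 := ℝ) M v) =
      Matrix.toLin' (M.map (algebraMap ℝ ℂ)) (complexify n v) := by
  ext i
  simp [complexify, Matrix.mulVec, dotProduct, Matrix.ofLp_toEuclideanCLM]

theorem complexify_injective (n : ℕ) : Function.Injective (complexify n) := by
  intro v w h
  ext i
  exact Complex.ofReal_injective (congrFun h i)

theorem norm_complexify (n : ℕ) : ∃ C > 0, ∀ v, ‖v‖ ≤ C * ‖complexify n v‖ := by
  obtain ⟨K, hK, h⟩ := (LinearMap.toContinuousLinearMap (complexify n)).exists_antilipschitzWith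
    (LinearMap.ker_eq_bot.2 (complexify_injective n))
  exact ⟨K, hK, fun v => by simpa using h.le_mul_norm_sub (x := v) (y := 0) |>.trans_eq (by simp)⟩

/-- `H` is a Lyapunov function for the linear map `a`, with constant `c`. -/
structure IsLyapunov {n : ℕ} (H : EuclideanSpace ℝ (Fin n) →L[ℝ] EuclideanSpace ℝ (Fin n)) (c : ℝ)
    (a : EuclideanSpace ℝ (Fin n) →L[ℝ] EuclideanSpace ℝ (Fin n)) : Prop where
  symm : ∀ x y, inner ℝ (H x) y = inner ℝ x (H y)
  pos : 0 < c
  le : ∀ v, c * ‖v‖ ^ 2 ≤ inner ℝ (H v) (a v)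

/-- The form on `ℂⁿ` is real bilinear, so it restricts to real vectors, where the Riesz isomorphism
turns it into a symmetric operator. -/
theorem IsHyperbolic.exists_isLyapunov {n : ℕ} {M : Matrix (Fin n) (Fin n) ℝ}
    (hM : IsHyperbolic M) : ∃ H c, IsLyapunov H c (Matrix.toEuclideanCLM (𝕜 := ℝ) M) := by
  obtain ⟨B, hB, c, hc, hBc⟩ := exists_lyapunov_complex _ (Fin n → ℂ)
    (Matrix.toLin' (M.map (algebraMap ℝ ℂ))) rfl fun z v hv hv0 => by
      refine hM z ?_
      rw [← Matrix.spectrum_toLin']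
      exact (Module.End.hasEigenvalue_of_hasEigenvector
        ⟨Module.End.mem_eigenspace_iff.2 hv, hv0⟩).mem_spectrum
  obtain ⟨C, hC, hnorm⟩ := norm_complexify n
  let κ := LinearMap.toContinuousLinearMap (complexify n)
  let H : EuclideanSpace ℝ (Fin n) →ₗ[ℝ] EuclideanSpace ℝ (Fin n) :=
    { toFun := fun v => (InnerProductSpace.toDual ℝ _).symm ((B (κ v)).comp κ)
      map_add' := fun v w => by simp [ContinuousLinearMap.add_comp]
      map_smul' := fun r v => by simp [ContinuousLinearMap.smul_comp] }
  have hH : ∀ v w, inner ℝ (H v) w = B (complexify n v) (complexify n w) := fun v w => by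
    change inner ℝ ((InnerProductSpace.toDual ℝ _).symm ((B (κ v)).comp κ)) w = _
    rw [InnerProductSpace.toDual_symm_apply]
    rfl
  refine ⟨LinearMap.toContinuousLinearMap H, c / C ^ 2, fun x y => ?_, by positivity, fun v => ?_⟩
  · rw [← real_inner_comm x]
    change inner ℝ (H x) y = inner ℝ (H y) x
    rw [hH, hH, hB]
  · change _ ≤ inner ℝ (H v) _
    rw [hH, complexify_toEuclideanCLM]
    refine le_trans ?_ (hBc _)
    rw [div_mul_eq_mul_div, div_le_iff₀ (by positivity), mul_assoc, ← mul_pow, mul_comm _ C]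
    exact mul_le_mul_of_nonneg_left (pow_le_pow_left₀ (norm_nonneg _) (hnorm v) 2) hc.le

/-- A Lyapunov function is one for all nearby maps. -/
theorem IsLyapunov.of_norm_sub_le {n : ℕ}
    {H a b : EuclideanSpace ℝ (Fin n) →L[ℝ] EuclideanSpace ℝ (Fin n)} {c : ℝ}
    (h : IsLyapunov H c a) (hb : ‖b - a‖ * ‖H‖ ≤ c / 2) : IsLyapunov H (c / 2) b := by
  refine ⟨h.symm, half_pos h.pos, fun v => ?_⟩
  have h1 : inner ℝ (H v) (b v) = inner ℝ (H v) (a v) + inner ℝ (H v) ((b - a) v) := by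
    rw [_root_.sub_apply, inner_sub_right]
    ring
  have h2 := abs_real_inner_le_norm (H v) ((b - a) v)
  have h3 : ‖H v‖ * ‖(b - a) v‖ ≤ c / 2 * ‖v‖ ^ 2 := by
    calc ‖H v‖ * ‖(b - a) v‖ ≤ (‖H‖ * ‖v‖) * (‖b - a‖ * ‖v‖) :=
          mul_le_mul (H.le_opNorm v) ((b - a).le_opNorm v) (norm_nonneg _) (by positivity)
      _ = ‖b - a‖ * ‖H‖ * ‖v‖ ^ 2 := by ring
      _ ≤ _ := mul_le_mul_of_nonneg_right hb (sq_nonneg _)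
  have h4 := neg_abs_le (inner ℝ (H v) ((b - a) v))
  have h5 := h.le v
  rw [h1]
  linarith

end Lyapunov

end


noncomputable section

/-! ### Solutions of linear systems -/

section Solutions

theorem IsPrimitive.hasDerivAt {F : Type*} [NormedAddCommGroup F] [NormedSpace ℝ F]
    [CompleteSpace F] {u w : ℝ → F} (h : IsPrimitive u w) (hw : Continuous w) (t : ℝ) :
    HasDerivAt u (w t) t := by
  have h1 := (intervalIntegral.integral_hasDerivAt_right (hw.intervalIntegrable 0 t)
    hw.aestronglyMeasurable.stronglyMeasurableAtFilter hw.continuousAt).const_add (u 0)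
  exact h1.congr_of_eventuallyEq (.of_forall fun s => h.eq_add 0 s)

theorem IsPrimitive.le_of_nonneg {u w : ℝ → ℝ} (h : IsPrimitive u w) {s t : ℝ} (hst : s ≤ t)
    (hw : ∀ᵐ r, r ∈ Ioo s t → 0 ≤ w r) : u s ≤ u t := by
  have h1 : 0 ≤ ∫ r in s..t, w r := by
    rw [intervalIntegral.integral_of_le hst, integral_Ioc_eq_integral_Ioo]
    exact setIntegral_nonneg_of_ae_restrict ((ae_restrict_iff' measurableSet_Ioo).2 hw)
  rw [h.2] at h1
  linarith

variable {n : ℕ} {a : ℝ → EuclideanSpace ℝ (Fin n) →L[ℝ] EuclideanSpace ℝ (Fin n)}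
  {J J' K : Set ℝ} {x w y z : ℝ → EuclideanSpace ℝ (Fin n)}

/-- A bounded continuous coefficient function. -/
structure IsBoundedCoeff (a : ℝ → EuclideanSpace ℝ (Fin n) →L[ℝ] EuclideanSpace ℝ (Fin n)) :
    Prop where
  continuous : Continuous a
  bounded : ∃ C, ∀ t, ‖a t‖ ≤ C

theorem IsBoundedCoeff.memLp (ha : IsBoundedCoeff a) (J : Set ℝ) : MemLp a ∞ (volume.restrict J) :=
  let ⟨C, hC⟩ := ha.bounded
  memLp_top_of_bound ha.continuous.aestronglyMeasurable C (.of_forall hC)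

theorem IsBoundedCoeff.reverse (ha : IsBoundedCoeff a) : IsBoundedCoeff fun t => -a (-t) :=
  ⟨(ha.continuous.comp continuous_neg).neg, ha.bounded.imp fun _ hC t => by
    rw [norm_neg]
    exact hC _⟩

theorem IsBoundedCoeff.memLp_apply (ha : IsBoundedCoeff a) (hx : Continuous x)
    (hm : MemLp x 2 (volume.restrict J)) :
    MemLp (fun t => a t (x t)) 2 (volume.restrict J) := by
  obtain ⟨C, hC⟩ := ha.bounded
  refine hm.of_le_mul (c := C) (ha.continuous.clm_apply hx).aestronglyMeasurable
    (.of_forall fun t => ?_)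
  exact (ContinuousLinearMap.le_opNorm _ _).trans
    (mul_le_mul_of_nonneg_right (hC t) (norm_nonneg _))

/-- `x`, a primitive of `w`, solves `x' = a x` on `J`. -/
structure SolvesOn (a : ℝ → EuclideanSpace ℝ (Fin n) →L[ℝ] EuclideanSpace ℝ (Fin n))
    (J : Set ℝ) (x w : ℝ → EuclideanSpace ℝ (Fin n)) : Prop where
  isPrimitive : IsPrimitive x w
  ae : ∀ᵐ t, t ∈ J → w t = a t (x t)

namespace SolvesOn

theorem continuous (h : SolvesOn a J x w) : Continuous x := h.isPrimitive.continuous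

theorem congr {b : ℝ → EuclideanSpace ℝ (Fin n) →L[ℝ] EuclideanSpace ℝ (Fin n)}
    (h : SolvesOn a J x w) (hJ : K ⊆ J) (hab : ∀ t ∈ K, a t = b t) : SolvesOn b K x w :=
  ⟨h.isPrimitive, h.ae.mono fun t ht hK => by rw [ht (hJ hK), hab t hK]⟩

theorem mono (h : SolvesOn a J x w) (hJ : K ⊆ J) : SolvesOn a K x w :=
  h.congr hJ fun _ _ => rfl

theorem sub (h : SolvesOn a J x w) (h' : SolvesOn a J y z) :
    SolvesOn a J (fun t => x t - y t) fun t => w t - z t :=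
  ⟨h.isPrimitive.sub h'.isPrimitive, by
    filter_upwards [h.ae, h'.ae] with t h1 h2 hJ
    rw [h1 hJ, h2 hJ, map_sub]⟩

theorem comp_neg (h : SolvesOn a J x w) (hJ : ∀ t ∈ K, -t ∈ J) :
    SolvesOn (fun t => -a (-t)) K (fun t => x (-t)) fun t => -w (-t) :=
  ⟨h.isPrimitive.comp_neg, by
    filter_upwards [(Measure.measurePreserving_neg volume).quasiMeasurePreserving.ae h.ae]
      with t ht hK
    rw [ht (hJ t hK)]
    rfl⟩

theorem ite (h : SolvesOn a J x w) (h' : SolvesOn a J' y z) {c : ℝ} (hc : x c = y c)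
    (hJ : ∀ t ∈ K, t < c → t ∈ J) (hJ' : ∀ t ∈ K, c < t → t ∈ J') :
    SolvesOn a K (fun t => if t ≤ c then x t else y t) fun t => if t ≤ c then w t else z t :=
  ⟨h.isPrimitive.ite h'.isPrimitive hc, by
    filter_upwards [h.ae, h'.ae, compl_mem_ae_iff.2
      (measure_singleton c : volume {c} = 0)] with t h1 h2 h3 hK
    rcases lt_trichotomy t c with h4 | h4 | h4
    · rw [if_pos h4.le, if_pos h4.le, h1 (hJ t hK h4)]
    · exact absurd h4 h3
    · rw [if_neg h4.not_ge, if_neg h4.not_ge, h2 (hJ' t hK h4)]⟩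

theorem memLp_deriv (h : SolvesOn a J x w) (ha : IsBoundedCoeff a) (hJ : MeasurableSet J)
    (hx : MemLp x 2 (volume.restrict J)) : MemLp w 2 (volume.restrict J) :=
  (memLp_congr_ae ((ae_restrict_iff' hJ).2 h.ae)).2 (ha.memLp_apply h.continuous hx)

/-- Gronwall's argument: `exp(-2Ct) ‖x‖²` is nonincreasing. -/
theorem eq_zero_of_le (h : SolvesOn a J x w) (ha : IsBoundedCoeff a) (hJ : OrdConnected J) {s t : ℝ}
    (hs : s ∈ J) (ht : t ∈ J) (hst : s ≤ t) (h0 : x s = 0) : x t = 0 := by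
  obtain ⟨C, hC⟩ := ha.bounded
  have hexp : IsPrimitive (fun r : ℝ => Real.exp (-2 * C * r))
      fun r => Real.exp (-2 * C * r) * (-2 * C) :=
    .of_hasDerivAt (fun r => by simpa using ((hasDerivAt_id r).const_mul (-2 * C)).exp)
      (by fun_prop)
  have h1 := (hexp.mul (h.isPrimitive.inner h.isPrimitive)).neg.le_of_nonneg hst (by
    filter_upwards [h.ae] with r hr hmem
    rw [hr (hJ.out hs ht ⟨hmem.1.le, hmem.2.le⟩), real_inner_comm (x r) (a r (x r))]
    have h2 := abs_real_inner_le_norm (x r) (a r (x r))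
    have h3 : ‖x r‖ * ‖a r (x r)‖ ≤ ‖x r‖ * (C * ‖x r‖) :=
      mul_le_mul_of_nonneg_left (((a r).le_opNorm _).trans
        (mul_le_mul_of_nonneg_right (hC r) (norm_nonneg _))) (norm_nonneg _)
    have h4 : inner ℝ (x r) (a r (x r)) ≤ C * inner ℝ (x r) (x r) := by
      rw [real_inner_self_eq_norm_sq]
      nlinarith [le_abs_self (inner ℝ (x r) (a r (x r)))]
    have h5 := mul_nonneg (Real.exp_pos (-2 * C * r)).le (sub_nonneg.2 h4)
    linarith)
  simp only [h0, inner_zero_left, mul_zero, neg_zero] at h1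
  have h2 := Real.exp_pos (-2 * C * t)
  have h3 : inner ℝ (x t) (x t) ≤ 0 := by
    by_contra h4
    have := mul_pos h2 (not_le.1 h4)
    linarith
  exact norm_eq_zero.1 (by nlinarith [real_inner_self_eq_norm_sq (x t), norm_nonneg (x t)])

/-- A solution that vanishes at one point vanishes. -/
theorem eq_zero (h : SolvesOn a J x w) (ha : IsBoundedCoeff a) (hJ : OrdConnected J) {s t : ℝ}
    (hs : s ∈ J) (ht : t ∈ J) (h0 : x s = 0) : x t = 0 := by
  rcases le_total s t with hst | hst
  · exact h.eq_zero_of_le ha hJ hs ht hst h0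
  · have h1 := (h.comp_neg (K := Neg.neg ⁻¹' J) fun t ht => ht).eq_zero_of_le ha.reverse
      (hJ.preimage_anti fun _ _ => neg_le_neg) (s := -s) (t := -t) (by simpa) (by simpa)
      (by linarith) (by simpa)
    simpa using h1

theorem eqOn (h : SolvesOn a J x w) (h' : SolvesOn a J y z) (ha : IsBoundedCoeff a)
    (hJ : OrdConnected J) {s : ℝ} (hs : s ∈ J) (h0 : x s = y s) : EqOn x y J := fun _ ht =>
  sub_eq_zero.1 ((h.sub h').eq_zero ha hJ hs ht (sub_eq_zero.2 h0))

theorem tendsto_atTop (h : SolvesOn a (Ioi τ) x w) (ha : IsBoundedCoeff a)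
    (hx : MemLp x 2 (volume.restrict (Ioi τ))) : Tendsto x atTop (𝓝 0) :=
  h.isPrimitive.tendsto_atTop hx (h.memLp_deriv ha measurableSet_Ioi hx)

variable {H : EuclideanSpace ℝ (Fin n) →L[ℝ] EuclideanSpace ℝ (Fin n)} {c τ : ℝ}

/-- The derivative of `⟨Hx, x⟩` along a solution is `2⟨Hx, ax⟩ ≥ 2c‖x‖²`. The monotonicity
determines the sign of the energy of decaying solutions, and the integral term bounds their `L²`
norm. -/
theorem energy_le (h : SolvesOn a (Ioi τ) x w) (hH : ∀ t, τ < t → IsLyapunov H c (a t)) {s t : ℝ}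
    (hs : τ ≤ s) (hst : s ≤ t) :
    inner ℝ (H (x s)) (x s) + 2 * c * ∫ r in s..t, ‖x r‖ ^ 2 ≤ inner ℝ (H (x t)) (x t) := by
  have h1 := (h.isPrimitive.clm_apply H).inner h.isPrimitive
  have hx2 : Continuous fun r => 2 * c * ‖x r‖ ^ 2 := by
    have := h.continuous
    fun_prop
  have h2 := (h1.sub (IsPrimitive.integral (fun a b => hx2.intervalIntegrable a b) s)).le_of_nonneg
    hst (by
      filter_upwards [h.ae] with r hr hmem
      have h3 : τ < r := hs.trans_lt hmem.1
      rw [hr h3, (hH r h3).symm, real_inner_comm]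
      have := (hH r h3).le (x r)
      linarith)
  rw [intervalIntegral.integral_same, intervalIntegral.integral_const_mul] at h2
  linarith

/-- The Lyapunov function is negative along decaying solutions. -/
theorem energy_neg (h : SolvesOn a (Ioi τ) x w) (hH : ∀ t, τ < t → IsLyapunov H c (a t))
    (hx : Tendsto x atTop (𝓝 0)) (h0 : x τ ≠ 0) : inner ℝ (H (x τ)) (x τ) < 0 := by
  have hc : 0 < c := (hH (τ + 1) (by linarith)).pos
  have hq : Tendsto (fun t => inner ℝ (H (x t)) (x t)) atTop (𝓝 0) := by
    have := ((H.continuous.tendsto 0).comp hx).inner (𝕜 := ℝ) hx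
    simpa using this
  have hle : inner ℝ (H (x (τ + 1))) (x (τ + 1)) ≤ 0 := by
    refine ge_of_tendsto hq ?_
    filter_upwards [eventually_ge_atTop (τ + 1)] with t ht
    have h1 := h.energy_le hH (by linarith : τ ≤ τ + 1) ht
    have h2 : 0 ≤ ∫ r in (τ + 1)..t, ‖x r‖ ^ 2 :=
      intervalIntegral.integral_nonneg ht fun _ _ => sq_nonneg _
    nlinarith
  have h1 := h.energy_le hH le_rfl (by linarith : τ ≤ τ + 1)
  have h2 : 0 < ∫ r in τ..(τ + 1), ‖x r‖ ^ 2 :=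
    intervalIntegral.integral_pos (by linarith) (h.continuous.norm.pow 2).continuousOn
      (fun _ _ => sq_nonneg _) ⟨τ, ⟨le_rfl, by linarith⟩, by positivity⟩
  nlinarith [mul_pos hc h2]

/-- Decaying solutions are square integrable. -/
theorem memLp_of_tendsto (h : SolvesOn a (Ioi τ) x w) (hH : ∀ t, τ < t → IsLyapunov H c (a t))
    (hx : Tendsto x atTop (𝓝 0)) : MemLp x 2 (volume.restrict (Ioi τ)) := by
  have hc : 0 < c := (hH (τ + 1) (by linarith)).pos
  have hq : Tendsto (fun t => inner ℝ (H (x t)) (x t)) atTop (𝓝 0) := by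
    have := ((H.continuous.tendsto 0).comp hx).inner (𝕜 := ℝ) hx
    simpa using this
  have hx2 : Continuous fun r => ‖x r‖ ^ 2 := h.continuous.norm.pow 2
  rw [memLp_two_iff_integrable_sq_norm h.continuous.aestronglyMeasurable]
  refine integrableOn_Ioi_of_intervalIntegral_norm_bounded (l := atTop) (b := id)
    ((1 - inner ℝ (H (x τ)) (x τ)) / (2 * c)) τ
    (fun t => (hx2.integrableOn_Icc).mono_set Ioc_subset_Icc_self) tendsto_id ?_
  filter_upwards [eventually_ge_atTop τ, hq.eventually (gt_mem_nhds one_pos)] with t ht h1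
  have h2 := h.energy_le hH le_rfl ht
  simp only [norm_pow, norm_norm, id_eq]
  rw [le_div_iff₀ (by positivity)]
  linarith

end SolvesOn

end Solutions

end


noncomputable section

/-! ### Splitting into solutions on half-lines -/

section Splitting

variable {n : ℕ} {a : ℝ → EuclideanSpace ℝ (Fin n) →L[ℝ] EuclideanSpace ℝ (Fin n)}
  {x w : ℝ → EuclideanSpace ℝ (Fin n)}

theorem memLp_exp_neg (t₀ : ℝ) :
    MemLp (fun t : ℝ => Real.exp (-(t - t₀))) 2 (volume.restrict (Ioi t₀)) := by
  have hc : Continuous fun t : ℝ => Real.exp (-(t - t₀)) := by fun_prop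
  rw [memLp_two_iff_integrable_sq hc.aestronglyMeasurable]
  have h1 := (integrableOn_exp_mul_Ioi (a := -2) (by norm_num) t₀).const_mul (Real.exp (2 * t₀))
  refine h1.congr (.of_forall fun t => ?_)
  change Real.exp (2 * t₀) * Real.exp (-2 * t) = Real.exp (-(t - t₀)) ^ 2
  rw [← Real.exp_add, ← Real.exp_nat_mul]
  congr 1
  push_cast
  ring

/-- The functions `e^{-(t - t₀)} ξ` on `(t₀, ∞)`, extended by zero. -/
theorem exists_halfExp (n : ℕ) (t₀ : ℝ) : ∃ G : EuclideanSpace ℝ (Fin n) →L[ℝ] L2On n univ,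
    ∀ ξ, G ξ =ᵐ[volume.restrict univ]
      (Ioi t₀).indicator fun t => Real.exp (-(t - t₀)) • ξ := by
  have hm : ∀ ξ : EuclideanSpace ℝ (Fin n), MemLp ((Ioi t₀).indicator
      fun t => Real.exp (-(t - t₀)) • ξ) 2 (volume.restrict univ) := fun ξ => by
    rw [memLp_indicator_iff_restrict measurableSet_Ioi, Measure.restrict_restrict measurableSet_Ioi,
      inter_univ]
    exact ((ContinuousLinearMap.id ℝ ℝ).smulRight ξ).comp_memLp' (memLp_exp_neg t₀)
  refine ⟨LinearMap.toContinuousLinearMap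
    { toFun := fun ξ => (hm ξ).toLp
      map_add' := fun ξ η => ?_
      map_smul' := fun r ξ => ?_ }, fun ξ => (hm ξ).coeFn_toLp⟩
  · rw [← MemLp.toLp_add]
    refine MemLp.toLp_congr _ _ (.of_forall fun t => ?_)
    by_cases ht : t ∈ Ioi t₀ <;> simp [ht]
  · rw [RingHom.id_apply, ← MemLp.toLp_const_smul]
    refine MemLp.toLp_congr _ _ (.of_forall fun t => ?_)
    by_cases ht : t ∈ Ioi t₀ <;> simp [ht, smul_comm r]

/-- One inversion on the whole line splits `ξ`. Let `G ξ` be `exp(-(t - t₀)) ξ` for `t > t₀` and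
zero before, and let `q` solve `q' - aq = Gξ + a Gξ`. Then `q + Gξ` is a solution to the right of
`t₀` and `-q` one to the left, both square integrable, and their values at `t₀` add up to `ξ`.
Continuity in the parameter is that of operator inversion. -/
theorem exists_splitting {Λ : Type*} [TopologicalSpace Λ]
    {a : Λ → ℝ → EuclideanSpace ℝ (Fin n) →L[ℝ] EuclideanSpace ℝ (Fin n)}
    (ha : ∀ l, IsBoundedCoeff (a l)) (hb : ∀ l, Function.Bijective (coeffOp ((ha l).memLp univ)))
    (hc : Continuous fun l => mulOp ((ha l).memLp univ)) (t₀ : ℝ) :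
    ∃ p : Λ → EuclideanSpace ℝ (Fin n) →L[ℝ] EuclideanSpace ℝ (Fin n), Continuous p ∧ ∀ l ξ,
      (∃ x w, SolvesOn (a l) (Ioi t₀) x w ∧ MemLp x 2 (volume.restrict (Ioi t₀)) ∧
        x t₀ = p l ξ) ∧
      ∃ x w, SolvesOn (a l) (Iio t₀) x w ∧ MemLp x 2 (volume.restrict (Iio t₀)) ∧
        x t₀ = ξ - p l ξ := by
  obtain ⟨ev, hev⟩ := exists_evaluation (n := n) (J := univ) (a := t₀ - 1) (t₀ := t₀)
    (by simp) (subset_univ _)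
  obtain ⟨G, hG⟩ := exists_halfExp n t₀
  let A : Λ → W12 n univ →L[ℝ] L2On n univ := fun l => coeffOp ((ha l).memLp univ)
  let e : Λ → W12 n univ ≃L[ℝ] L2On n univ := fun l =>
    ContinuousLinearEquiv.ofBijective (A l) (LinearMap.ker_eq_bot.2 (hb l).1)
      (LinearMap.range_eq_top.2 (hb l).2)
  have he : ∀ l, (e l : W12 n univ →L[ℝ] L2On n univ) = A l := fun l => rfl
  have hA : Continuous A :=
    (continuous_const.sub (hc.clm_comp continuous_const)).clm_comp continuous_const
  have hinv : Continuous fun l => ContinuousLinearMap.inverse (A l) := by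
    rw [continuous_iff_continuousAt]
    intro l
    have h1 : ContinuousAt ContinuousLinearMap.inverse (A l) :=
      (contDiffAt_map_inverse (n := 0) (e l)).continuousAt
    exact ContinuousAt.comp h1 hA.continuousAt
  refine ⟨fun l => ContinuousLinearMap.id ℝ _ +
    ev ∘L ContinuousLinearMap.inverse (A l) ∘L
      (ContinuousLinearMap.id ℝ _ + mulOp ((ha l).memLp univ)) ∘L G, ?_, fun l ξ => ?_⟩
  · exact continuous_const.add (continuous_const.clm_comp (hinv.clm_comp
      ((continuous_const.add hc).clm_comp continuous_const)))
  set q := (e l).symm (G ξ + mulOp ((ha l).memLp univ) (G ξ))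
  obtain ⟨z, hz⟩ := W12.exists_isRep ordConnected_univ (by simp) q
  set w := univ.indicator q.1.snd
  have hp : (ContinuousLinearMap.id ℝ (EuclideanSpace ℝ (Fin n)) +
      ev ∘L ContinuousLinearMap.inverse (A l) ∘L
      (ContinuousLinearMap.id ℝ (L2On n univ) + mulOp ((ha l).memLp univ)) ∘L G) ξ = ξ + z t₀ := by
    rw [← hev q z w hz, ← he l, ContinuousLinearMap.inverse_equiv]
    rfl
  have hz2 : MemLp z 2 volume := by simpa using hz.memLp_fst
  have hAq : A l q = G ξ + mulOp ((ha l).memLp univ) (G ξ) := (e l).apply_symm_apply _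
  have hae : ∀ᵐ t, w t - a l t (z t) = (Ioi t₀).indicator
      (fun t => Real.exp (-(t - t₀)) • ξ + a l t (Real.exp (-(t - t₀)) • ξ)) t := by
    have h1 := hz.coeffOp_ae ((ha l).memLp univ)
    have h2 := coeFn_mulOp ((ha l).memLp univ) (G ξ)
    have h3 := Lp.coeFn_add (G ξ) (mulOp ((ha l).memLp univ) (G ξ))
    have h4 := hG ξ
    change A l q =ᵐ[_] _ at h1
    rw [hAq] at h1
    refine (ae_restrict_iff' MeasurableSet.univ).1 ?_ |>.mono fun t ht => ht trivial
    filter_upwards [h1, h2, h3, h4] with t h1 h2 h3 h4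
    rw [← h1, h3, Pi.add_apply, h2, h4]
    by_cases ht : t ∈ Ioi t₀ <;> simp [ht]
  have hexp : IsPrimitive (fun t : ℝ => Real.exp (-(t - t₀)) • ξ)
      fun t => (-Real.exp (-(t - t₀))) • ξ := by
    refine .of_hasDerivAt (fun t => ?_) (by fun_prop)
    have := (((hasDerivAt_id t).sub_const t₀).neg.exp).smul_const ξ
    simpa using this
  have hexpm : MemLp (fun t : ℝ => Real.exp (-(t - t₀)) • ξ) 2 (volume.restrict (Ioi t₀)) :=
    ((ContinuousLinearMap.id ℝ ℝ).smulRight ξ).comp_memLp' (memLp_exp_neg t₀)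
  refine ⟨⟨_, _, ⟨hexp.add hz.isPrimitive, ?_⟩, hexpm.add (hz2.restrict _), ?_⟩,
    ⟨_, _, ⟨hz.isPrimitive.neg, ?_⟩, (hz2.restrict _).neg, ?_⟩⟩
  · filter_upwards [hae] with t ht hmem
    rw [indicator_of_mem hmem, sub_eq_iff_eq_add] at ht
    rw [ht, map_add, neg_smul]
    abel
  · rw [hp]
    simp
  · filter_upwards [hae] with t ht hmem
    rw [indicator_of_notMem (fun h : t ∈ Ioi t₀ => lt_asymm (mem_Iio.1 hmem) h), sub_eq_zero] at ht
    rw [ht, map_neg]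
  · rw [hp]
    simp

/-- Shifting by more than the norm of the coefficient makes the system contracting. Existence for
arbitrary bounded coefficients thus reduces to the Lyapunov case. -/
theorem isLyapunov_one {b : EuclideanSpace ℝ (Fin n) →L[ℝ] EuclideanSpace ℝ (Fin n)} {C : ℝ}
    (hb : ‖b‖ ≤ C) : IsLyapunov (-ContinuousLinearMap.id ℝ _) 1
      (b - (C + 1) • ContinuousLinearMap.id ℝ _) := by
  refine ⟨fun x y => by simp, one_pos, fun v => ?_⟩
  have h1 := abs_real_inner_le_norm v (b v)
  have h2 : ‖v‖ * ‖b v‖ ≤ ‖v‖ * (C * ‖v‖) := mul_le_mul_of_nonneg_left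
    ((b.le_opNorm v).trans (mul_le_mul_of_nonneg_right hb (norm_nonneg _))) (norm_nonneg _)
  have h3 : inner ℝ ((-ContinuousLinearMap.id ℝ _ : EuclideanSpace ℝ (Fin n) →L[ℝ] _) v)
      ((b - (C + 1) • ContinuousLinearMap.id ℝ (EuclideanSpace ℝ (Fin n))) v) =
      (C + 1) * ‖v‖ ^ 2 - inner ℝ v (b v) := by
    rw [← real_inner_self_eq_norm_sq]
    simp [inner_sub_right, inner_smul_right]
    ring
  rw [h3]
  nlinarith [le_abs_self (inner ℝ v (b v))]

theorem IsLyapunov.neg {H b : EuclideanSpace ℝ (Fin n) →L[ℝ] EuclideanSpace ℝ (Fin n)} {c : ℝ}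
    (h : IsLyapunov H c b) : IsLyapunov (-H) c (-b) :=
  ⟨fun x y => by simp [h.symm], h.pos, fun v => by simpa using h.le v⟩

theorem IsBoundedCoeff.bijective_coeffOp (ha : IsBoundedCoeff a)
    {H : EuclideanSpace ℝ (Fin n) →L[ℝ] EuclideanSpace ℝ (Fin n)} {c : ℝ}
    (hH : ∀ t, IsLyapunov H c (a t)) : Function.Bijective (coeffOp (ha.memLp univ)) :=
  _root_.bijective_coeffOp _ (hH 0).symm (hH 0).pos fun t => (hH t).le

theorem IsBoundedCoeff.sub_smul_id (ha : IsBoundedCoeff a) (r : ℝ) :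
    IsBoundedCoeff fun t => a t - r • ContinuousLinearMap.id ℝ _ :=
  ⟨ha.continuous.sub continuous_const, ha.bounded.imp' (· + ‖r • ContinuousLinearMap.id ℝ _‖)
    fun _ hC t => (norm_sub_le _ _).trans (add_le_add_left (hC t) _)⟩

/-- Multiplying by an exponential shifts the coefficient. -/
theorem SolvesOn.exp_smul {r : ℝ} {J : Set ℝ}
    (h : SolvesOn (fun t => a t - r • ContinuousLinearMap.id ℝ _) J x w) (t₀ : ℝ) :
    SolvesOn a J (fun t => Real.exp (r * (t - t₀)) • x t)
      fun t => (Real.exp (r * (t - t₀)) * r) • x t + Real.exp (r * (t - t₀)) • w t := by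
  have hexp : IsPrimitive (fun t : ℝ => Real.exp (r * (t - t₀)))
      fun t => Real.exp (r * (t - t₀)) * r := by
    refine .of_hasDerivAt (fun t => ?_) (by fun_prop)
    have := (((hasDerivAt_id t).sub_const t₀).const_mul r).exp
    simpa using this
  refine ⟨hexp.smul h.isPrimitive, ?_⟩
  filter_upwards [h.ae] with t ht hmem
  rw [ht hmem]
  simp only [map_smul, _root_.sub_apply, _root_.smul_apply, ContinuousLinearMap.id_apply, smul_sub,
    smul_smul]
  abel

/-- For the shifted, contracting system the left half of the splitting vanishes: reversed in time,
it would be a decaying solution with `‖z‖²` as Lyapunov energy, which must be negative unless `z` is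
zero at `t₀`. Hence all of `ξ` is the value of a solution to the right, and the shift is undone by
an exponential factor. -/
theorem IsBoundedCoeff.exists_solvesOn_Ioi (ha : IsBoundedCoeff a) (t₀ : ℝ)
    (ξ : EuclideanSpace ℝ (Fin n)) : ∃ x w, SolvesOn a (Ioi t₀) x w ∧ x t₀ = ξ := by
  obtain ⟨C, hC⟩ := ha.bounded
  have hL : ∀ t, IsLyapunov (-ContinuousLinearMap.id ℝ _) 1
    (a t - (C + 1) • ContinuousLinearMap.id ℝ _) := fun t => isLyapunov_one (hC t)
  have hb := ha.sub_smul_id (C + 1)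
  obtain ⟨p, -, hp⟩ := exists_splitting (Λ := Unit) (fun _ => hb)
    (fun _ => hb.bijective_coeffOp hL) continuous_const t₀
  obtain ⟨⟨x, w, hx, -, hxt⟩, z, w', hz, hzm, hzt⟩ := hp () ξ
  have h0 : z t₀ = 0 := by
    by_contra h0
    have h1 := hz.comp_neg (K := Ioi (-t₀)) fun t ht => neg_lt.1 (mem_Ioi.1 ht)
    have hm : MemLp (fun t => z (-t)) 2 (volume.restrict (Ioi (-t₀))) := by
      have := hzm.comp_measurePreserving
        ((Measure.measurePreserving_neg volume).restrict_preimage (measurableSet_Iio (a := t₀)))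
      simpa [Function.comp_def] using this
    have h2 := h1.energy_neg (τ := -t₀) (fun t _ => (hL (-t)).neg)
      (h1.tendsto_atTop hb.reverse hm) (by simpa using h0)
    simp only [neg_neg, ContinuousLinearMap.id_apply] at h2
    exact (real_inner_self_nonneg.not_gt h2)
  rw [h0, eq_comm, sub_eq_zero] at hzt
  exact ⟨_, _, hx.exp_smul t₀, by simp [hxt, ← hzt]⟩

/-- Global existence for linear systems. -/
theorem IsBoundedCoeff.exists_solvesOn_univ (ha : IsBoundedCoeff a) (t₀ : ℝ)
    (ξ : EuclideanSpace ℝ (Fin n)) : ∃ x w, SolvesOn a univ x w ∧ x t₀ = ξ := by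
  obtain ⟨x, w, hx, hxt⟩ := ha.exists_solvesOn_Ioi t₀ ξ
  obtain ⟨z, w', hz, hzt⟩ := ha.reverse.exists_solvesOn_Ioi (-t₀) ξ
  have hz' := (hz.comp_neg (K := Iio t₀) fun t ht => neg_lt_neg (mem_Iio.1 ht)).congr (b := a) subset_rfl
    fun t _ => by simp
  exact ⟨_, _, hz'.ite hx (c := t₀) (by simp [hzt, hxt]) (fun t _ h => h) fun t _ h => h,
    by simp [hzt]⟩

end Splitting

end


noncomputable section

/-! ### Stable and unstable spaces -/

section StableSpaces

variable {n : ℕ}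

/-- The coefficient operators of a matrix function. -/
abbrev coeff (M : ℝ → Matrix (Fin n) (Fin n) ℝ) (t : ℝ) :
    EuclideanSpace ℝ (Fin n) →L[ℝ] EuclideanSpace ℝ (Fin n) :=
  Matrix.toEuclideanCLM (𝕜 := ℝ) (M t)

variable {M M' : ℝ → Matrix (Fin n) (Fin n) ℝ}
  {H : EuclideanSpace ℝ (Fin n) →L[ℝ] EuclideanSpace ℝ (Fin n)} {c τ τ' : ℝ}
  {x w u : ℝ → EuclideanSpace ℝ (Fin n)} {v : EuclideanSpace ℝ (Fin n)}

theorem coeff_reverse (M : ℝ → Matrix (Fin n) (Fin n) ℝ) :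
    coeff (fun t => -M (-t)) = fun t => -coeff M (-t) := by
  ext1 t
  simp [coeff]

theorem IsSolution.solvesOn (h : IsSolution M u) (hM : Continuous (coeff M)) :
    SolvesOn (coeff M) univ u fun t => coeff M t (u t) :=
  ⟨.of_hasDerivAt h (hM.clm_apply
    (continuous_iff_continuousAt.2 fun t => (h t).continuousAt)), .of_forall fun _ _ => rfl⟩

theorem SolvesOn.isSolution (h : SolvesOn (coeff M) univ x w) (hM : Continuous (coeff M)) :
    IsSolution M x :=
  (h.isPrimitive.congr_ae (h.ae.mono fun _ ht => ht trivial)).hasDerivAt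
    (hM.clm_apply h.continuous)

theorem IsSolution.reverse (h : IsSolution M u) :
    IsSolution (fun t => -M (-t)) fun t => u (-t) := fun t => by
  have := (h (-t)).scomp t (hasDerivAt_neg t)
  rw [neg_one_smul] at this
  have h2 := congrFun (coeff_reverse M) t
  dsimp only [coeff] at h2
  rw [h2]
  exact this

theorem unstableSpace_eq (M : ℝ → Matrix (Fin n) (Fin n) ℝ) (τ : ℝ) :
    unstableSpace M τ = stableSpace (fun t => -M (-t)) (-τ) := by
  ext v
  constructor
  · rintro ⟨u, hu, rfl, h0⟩
    exact ⟨_, hu.reverse, by simp, h0.comp tendsto_neg_atTop_atBot⟩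
  · rintro ⟨u, hu, rfl, h0⟩
    refine ⟨fun t => u (-t), ?_, rfl, h0.comp tendsto_neg_atBot_atTop⟩
    simpa using hu.reverse

/-- Under a Lyapunov function decay and square integrability are equivalent. The right-hand side
sees the coefficients only on `(τ, ∞)`, which permits changing them elsewhere and gluing at `τ`. -/
theorem mem_stableSpace_iff (hM : IsBoundedCoeff (coeff M))
    (hH : ∀ t, τ < t → IsLyapunov H c (coeff M t)) :
    v ∈ stableSpace M τ ↔ ∃ x w, SolvesOn (coeff M) (Ioi τ) x w ∧
      MemLp x 2 (volume.restrict (Ioi τ)) ∧ x τ = v := by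
  constructor
  · rintro ⟨u, hu, rfl, h0⟩
    have h1 := (hu.solvesOn hM.continuous).mono (subset_univ (Ioi τ))
    exact ⟨u, _, h1, h1.memLp_of_tendsto hH h0, rfl⟩
  · rintro ⟨x, w, hx, hm, rfl⟩
    obtain ⟨u, w', hu, huτ⟩ := hM.exists_solvesOn_univ τ (x τ)
    refine ⟨u, hu.isSolution hM.continuous, huτ, ?_⟩
    have hx' : SolvesOn (coeff M) (Ici τ) x w := ⟨hx.isPrimitive, by
      filter_upwards [hx.ae, compl_mem_ae_iff.2 (measure_singleton τ : volume {τ} = 0)]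
        with t h1 h2 h3
      exact h1 (lt_of_le_of_ne h3 (Ne.symm h2))⟩
    have heq := hx'.eqOn (hu.mono (subset_univ _)) hM ordConnected_Ici self_mem_Ici huτ.symm
    refine (hx.tendsto_atTop hM hm).congr' ?_
    filter_upwards [eventually_ge_atTop τ] with t ht
    exact heq ht

theorem isBoundedCoeff_reverse (hM : IsBoundedCoeff (coeff M)) :
    IsBoundedCoeff (coeff fun t => -M (-t)) := by
  rw [coeff_reverse]
  exact hM.reverse

theorem memLp_comp_neg (h : MemLp x 2 (volume.restrict (Iio τ))) :
    MemLp (fun t => x (-t)) 2 (volume.restrict (Ioi (-τ))) := by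
  have := h.comp_measurePreserving
    ((Measure.measurePreserving_neg volume).restrict_preimage (measurableSet_Iio (a := τ)))
  simpa [Function.comp_def] using this

theorem memLp_comp_neg' (h : MemLp x 2 (volume.restrict (Ioi τ))) :
    MemLp (fun t => x (-t)) 2 (volume.restrict (Iio (-τ))) := by
  have := h.comp_measurePreserving
    ((Measure.measurePreserving_neg volume).restrict_preimage (measurableSet_Ioi (a := τ)))
  simpa [Function.comp_def] using this

theorem mem_unstableSpace_iff (hM : IsBoundedCoeff (coeff M))
    (hH : ∀ t, t < τ → IsLyapunov H c (coeff M t)) :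
    v ∈ unstableSpace M τ ↔ ∃ x w, SolvesOn (coeff M) (Iio τ) x w ∧
      MemLp x 2 (volume.restrict (Iio τ)) ∧ x τ = v := by
  rw [unstableSpace_eq, mem_stableSpace_iff (isBoundedCoeff_reverse hM) (H := -H) (c := c)]
  · rw [coeff_reverse]
    constructor
    · rintro ⟨x, w, hx, hm, rfl⟩
      have h1 := (hx.comp_neg (K := Iio τ) fun t ht => neg_lt_neg (mem_Iio.1 ht)).congr
        (b := coeff M) subset_rfl fun t _ => by simp
      exact ⟨_, _, h1, by simpa using memLp_comp_neg' hm, rfl⟩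
    · rintro ⟨x, w, hx, hm, rfl⟩
      exact ⟨_, _, hx.comp_neg fun t ht => neg_lt.1 (mem_Ioi.1 ht), memLp_comp_neg hm, by simp⟩
  · intro t ht
    rw [coeff_reverse]
    exact (hH _ (by linarith)).neg

theorem stableSpace_congr (hM : IsBoundedCoeff (coeff M)) (hM' : IsBoundedCoeff (coeff M'))
    (hH : ∀ t, τ < t → IsLyapunov H c (coeff M t)) (h : ∀ t, τ < t → M t = M' t) :
    stableSpace M τ = stableSpace M' τ := by
  ext v
  rw [mem_stableSpace_iff hM hH, mem_stableSpace_iff hM' fun t ht => by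
    dsimp only [coeff]
    rw [← h t ht]
    exact hH t ht]
  have h1 : ∀ x w, SolvesOn (coeff M) (Ioi τ) x w ↔ SolvesOn (coeff M') (Ioi τ) x w := fun x w =>
    ⟨fun hx => hx.congr subset_rfl fun t ht => by dsimp only [coeff]; rw [h t ht],
      fun hx => hx.congr subset_rfl fun t ht => by dsimp only [coeff]; rw [h t ht]⟩
  simp only [h1]

theorem inner_stableSpace_neg (hM : Continuous (coeff M))
    (hH : ∀ t, τ < t → IsLyapunov H c (coeff M t)) (hv : v ∈ stableSpace M τ) (h0 : v ≠ 0) :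
    inner ℝ (H v) v < 0 := by
  obtain ⟨u, hu, rfl, hlim⟩ := hv
  exact ((hu.solvesOn hM).mono (subset_univ _)).energy_neg hH hlim h0

theorem inner_unstableSpace_pos (hM : Continuous (coeff M))
    (hH : ∀ t, t < τ → IsLyapunov H c (coeff M t)) (hv : v ∈ unstableSpace M τ) (h0 : v ≠ 0) :
    0 < inner ℝ (H v) v := by
  rw [unstableSpace_eq] at hv
  have := inner_stableSpace_neg (H := -H) (c := c) (by
    rw [coeff_reverse]
    exact (hM.comp continuous_neg).neg) (fun t ht => by
    rw [coeff_reverse]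
    exact (hH _ (by linarith)).neg) hv h0
  simpa using this

/-- `M` is a bounded continuous matrix function with the Lyapunov function `H`. -/
structure IsLyapunovSystem (M : ℝ → Matrix (Fin n) (Fin n) ℝ)
    (H : EuclideanSpace ℝ (Fin n) →L[ℝ] EuclideanSpace ℝ (Fin n)) (c : ℝ) : Prop where
  isBoundedCoeff : IsBoundedCoeff (coeff M)
  lyapunov : ∀ t, IsLyapunov H c (coeff M t)

/-- `H` is negative on the stable and positive on the unstable space, so they meet trivially; the
splitting shows that they span. -/
theorem IsLyapunovSystem.isCompl (h : IsLyapunovSystem M H c) (τ : ℝ) :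
    IsCompl (stableSpace M τ) (unstableSpace M τ) := by
  refine ⟨Submodule.disjoint_def.2 fun v hs hu => ?_, codisjoint_iff.2 (eq_top_iff.2 fun v _ => ?_)⟩
  · by_contra h0
    exact lt_asymm (inner_stableSpace_neg h.isBoundedCoeff.continuous (fun t _ => h.lyapunov t) hs h0)
      (inner_unstableSpace_pos h.isBoundedCoeff.continuous (fun t _ => h.lyapunov t) hu h0)
  · obtain ⟨p, -, hp⟩ := exists_splitting (Λ := Unit) (fun _ => h.isBoundedCoeff)
      (fun _ => h.isBoundedCoeff.bijective_coeffOp h.lyapunov) continuous_const τ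
    obtain ⟨⟨x, w, hx, hxm, hxt⟩, z, w', hz, hzm, hzt⟩ := hp () v
    refine Submodule.mem_sup.2 ⟨_, (mem_stableSpace_iff h.isBoundedCoeff fun t _ =>
      h.lyapunov t).2 ⟨x, w, hx, hxm, rfl⟩, _, (mem_unstableSpace_iff h.isBoundedCoeff fun t _ =>
      h.lyapunov t).2 ⟨z, w', hz, hzm, rfl⟩, ?_⟩
    rw [hxt, hzt]
    abel

/-- The stable space of one system and the unstable space of the other are disjoint because the
common form `H` has opposite signs on them. -/
theorem IsLyapunovSystem.finrank_le (h : IsLyapunovSystem M H c) {c' : ℝ}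
    (h' : IsLyapunovSystem M' H c') :
    Module.finrank ℝ (stableSpace M τ) ≤ Module.finrank ℝ (stableSpace M' τ') := by
  have h1 : Disjoint (stableSpace M τ) (unstableSpace M' τ') :=
    Submodule.disjoint_def.2 fun v hs hu => by
      by_contra h0
      exact lt_asymm
        (inner_stableSpace_neg h.isBoundedCoeff.continuous (fun t _ => h.lyapunov t) hs h0)
        (inner_unstableSpace_pos h'.isBoundedCoeff.continuous (fun t _ => h'.lyapunov t) hu h0)
  have h2 := Submodule.finrank_add_finrank_le_of_disjoint h1
  have h3 := Submodule.finrank_add_eq_of_isCompl (h'.isCompl τ')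
  omega

/-- The stable spaces of two systems with a common Lyapunov function have the same dimension. -/
theorem IsLyapunovSystem.finrank_eq (h : IsLyapunovSystem M H c) {c' : ℝ}
    (h' : IsLyapunovSystem M' H c') :
    Module.finrank ℝ (stableSpace M τ) = Module.finrank ℝ (stableSpace M' τ') :=
  (h.finrank_le h').antisymm (h'.finrank_le h)

end StableSpaces

end


noncomputable section

/-! ### Linear systems with constant coefficients -/

section Constant

theorem tendsto_exp_mul_pow_atTop {z : ℂ} (hz : z.re < 0) (j : ℕ) :
    Tendsto (fun t : ℝ => Complex.exp (t * z) * (t : ℂ) ^ j) atTop (𝓝 0) := by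
  rw [tendsto_zero_iff_norm_tendsto_zero]
  refine (tendsto_rpow_mul_exp_neg_mul_atTop_nhds_zero j (-z.re) (neg_pos.2 hz)).congr' ?_
  filter_upwards [eventually_ge_atTop 0] with t ht
  rw [norm_mul, Complex.norm_exp, norm_pow, Complex.norm_real, Real.norm_of_nonneg ht,
    Real.rpow_natCast, mul_comm]
  simp [mul_comm]

theorem tendsto_exp_mul_pow_atBot {z : ℂ} (hz : 0 < z.re) (j : ℕ) :
    Tendsto (fun t : ℝ => Complex.exp (t * z) * (t : ℂ) ^ j) atBot (𝓝 0) := by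
  have h1 := ((tendsto_exp_mul_pow_atTop (z := -z) (by simpa using hz) j).comp
    tendsto_neg_atBot_atTop).mul_const ((-1) ^ j)
  rw [zero_mul] at h1
  refine h1.congr fun t => ?_
  simp only [Function.comp_apply, Complex.ofReal_neg, neg_mul_neg]
  rw [mul_assoc, ← mul_pow, neg_mul_neg, mul_one]

variable {V : Type*} [NormedAddCommGroup V] [NormedSpace ℂ V]

/-- The initial values of the solutions of `u' = A u` that tend to zero along `l`. -/
def complexDecayingSpace (A : V →ₗ[ℂ] V) (l : Filter ℝ) : Submodule ℂ V where
  carrier := {v | ∃ u : ℝ → V, (∀ t, HasDerivAt u (A (u t)) t) ∧ u 0 = v ∧ Tendsto u l (𝓝 0)}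
  zero_mem' := ⟨0, fun t => by simp, rfl, tendsto_const_nhds⟩
  add_mem' := by
    rintro _ _ ⟨u, hu, rfl, hu0⟩ ⟨w, hw, rfl, hw0⟩
    refine ⟨fun t => u t + w t, fun t => ?_, rfl, by simpa using hu0.add hw0⟩
    simpa using (hu t).fun_add (hw t)
  smul_mem' := by
    rintro c _ ⟨u, hu, rfl, hu0⟩
    refine ⟨fun t => c • u t, fun t => ?_, rfl, by simpa using hu0.const_smul c⟩
    simpa using (hu t).fun_const_smul c

/-- The Taylor polynomials of `exp (t N) v`. -/
def expPoly (N : V →ₗ[ℂ] V) (v : V) (k : ℕ) (t : ℝ) : V :=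
  ∑ j ∈ Finset.range k, ((t : ℂ) ^ j / (j.factorial : ℂ)) • (N ^ j) v

theorem hasDerivAt_expPoly (N : V →ₗ[ℂ] V) (v : V) (k : ℕ) (t : ℝ) :
    HasDerivAt (expPoly N v (k + 1)) (N (expPoly N v k t)) t := by
  have h1 : ∀ j : ℕ, HasDerivAt (fun t : ℝ => (t : ℂ) ^ (j + 1) / ((j + 1).factorial : ℂ))
      ((t : ℂ) ^ j / (j.factorial : ℂ)) t := fun j => by
    have h2 := ((hasDerivAt_pow (j + 1) (t : ℂ)).div_const ((j + 1).factorial : ℂ)).comp_ofReal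
    convert h2 using 1
    rw [Nat.factorial_succ]
    have : (j.factorial : ℂ) ≠ 0 := by exact_mod_cast j.factorial_ne_zero
    have : ((j : ℂ) + 1) ≠ 0 := by exact_mod_cast j.succ_ne_zero
    push_cast
    field_simp
  have h3 := (HasDerivAt.fun_sum (u := Finset.range k) fun j _ =>
    (h1 j).smul_const ((N ^ (j + 1)) v)).add_const v
  have h4 : expPoly N v (k + 1) = fun t : ℝ => ∑ j ∈ Finset.range k,
      ((t : ℂ) ^ (j + 1) / ((j + 1).factorial : ℂ)) • (N ^ (j + 1)) v + v := by
    ext1 s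
    rw [expPoly, Finset.sum_range_succ']
    simp
  have h5 : N (expPoly N v k t) =
      ∑ j ∈ Finset.range k, ((t : ℂ) ^ j / (j.factorial : ℂ)) • (N ^ (j + 1)) v := by
    simp [expPoly, pow_succ']
  rw [h4, h5]
  exact h3

/-- On a generalized eigenvector the exponential series of the nilpotent part terminates, so the
solution is `exp(tz)` times a polynomial. -/
theorem maxGenEigenspace_le_complexDecayingSpace (A : V →ₗ[ℂ] V) {z : ℂ} {l : Filter ℝ}
    (hl : ∀ j : ℕ, Tendsto (fun t : ℝ => Complex.exp (t * z) * (t : ℂ) ^ j) l (𝓝 0)) :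
    Module.End.maxGenEigenspace A z ≤ complexDecayingSpace A l := by
  intro v hv
  obtain ⟨k, hk⟩ := (Module.End.mem_maxGenEigenspace A z v).1 hv
  set N : V →ₗ[ℂ] V := A - z • 1 with hN
  -- The term of order `k` is zero, which closes the gap between a Taylor polynomial and its
  -- derivative, of one degree less.
  have hstep : expPoly N v (k + 1) = expPoly N v k := by
    ext1 t
    rw [expPoly, Finset.sum_range_succ, hk, smul_zero, add_zero, expPoly]
  refine ⟨fun t => Complex.exp (t * z) • expPoly N v (k + 1) t, fun t => ?_, ?_, ?_⟩
  · have h1 := hasDerivAt_expPoly N v k t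
    have h2 : HasDerivAt (fun t : ℝ => Complex.exp (t * z)) (Complex.exp (t * z) * z) t := by
      simpa using (((hasDerivAt_id (t : ℂ)).mul_const z).cexp).comp_ofReal
    have h3 := h2.fun_smul h1
    convert h3 using 1
    have h4 : A (expPoly N v (k + 1) t) = N (expPoly N v k t) + z • expPoly N v (k + 1) t := by
      rw [hstep, hN]
      simp
    rw [map_smul, h4, smul_add, smul_smul]
  · simp [expPoly, Finset.sum_range_succ']
  · have h1 : Tendsto (fun t : ℝ => ∑ j ∈ Finset.range (k + 1),
        (Complex.exp (t * z) * (t : ℂ) ^ j) • ((j.factorial : ℂ)⁻¹ • (N ^ j) v)) l (𝓝 0) := by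
      have := tendsto_finsetSum (Finset.range (k + 1)) fun j _ =>
        (hl j).smul_const ((j.factorial : ℂ)⁻¹ • (N ^ j) v)
      simpa using this
    refine h1.congr fun t => ?_
    rw [expPoly, Finset.smul_sum]
    refine Finset.sum_congr rfl fun j _ => ?_
    rw [smul_smul, smul_smul]
    congr 1
    ring

variable {n : ℕ} {M : Matrix (Fin n) (Fin n) ℝ}

/-- The real part of a complex vector. -/
def reVec (n : ℕ) : (Fin n → ℂ) →L[ℝ] EuclideanSpace ℝ (Fin n) :=
  LinearMap.toContinuousLinearMap
    { toFun := fun a => WithLp.toLp 2 fun i => (a i).re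
      map_add' := fun a b => by ext i; simp
      map_smul' := fun r a => by ext i; simp }

theorem reVec_apply (a : Fin n → ℂ) (i : Fin n) : reVec n a i = (a i).re := rfl

theorem reVec_complexify (v : EuclideanSpace ℝ (Fin n)) : reVec n (complexify n v) = v := rfl

theorem reVec_toLin' (M : Matrix (Fin n) (Fin n) ℝ) (a : Fin n → ℂ) :
    reVec n (Matrix.toLin' (M.map (algebraMap ℝ ℂ)) a) =
      Matrix.toEuclideanCLM (𝕜 := ℝ) M (reVec n a) := by
  ext i
  simp [reVec_apply, Matrix.mulVec, dotProduct, Matrix.ofLp_toEuclideanCLM]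

theorem reVec_mem_decayingSpace {l : Filter ℝ} {a : Fin n → ℂ}
    (ha : a ∈ complexDecayingSpace (Matrix.toLin' (M.map (algebraMap ℝ ℂ))) l) :
    reVec n a ∈ decayingSpace (fun _ => M) l 0 := by
  obtain ⟨u, hu, rfl, h0⟩ := ha
  refine ⟨fun t => reVec n (u t), fun t => ?_, rfl, ?_⟩
  · rw [← reVec_toLin']
    exact (reVec n).hasFDerivAt.comp_hasDerivAt t (hu t)
  · have := ((reVec n).continuous.tendsto 0).comp h0
    rwa [map_zero] at this

theorem complexify_mem_complexDecayingSpace {l : Filter ℝ} {v : EuclideanSpace ℝ (Fin n)}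
    (hv : v ∈ decayingSpace (fun _ => M) l 0) :
    complexify n v ∈ complexDecayingSpace (Matrix.toLin' (M.map (algebraMap ℝ ℂ))) l := by
  obtain ⟨u, hu, rfl, h0⟩ := hv
  let κ := LinearMap.toContinuousLinearMap (complexify n)
  refine ⟨fun t => κ (u t), fun t => ?_, rfl, ?_⟩
  · change HasDerivAt _ (Matrix.toLin' (M.map (algebraMap ℝ ℂ)) (complexify n (u t))) t
    rw [← complexify_toEuclideanCLM]
    exact κ.hasFDerivAt.comp_hasDerivAt t (hu t)
  · have := (κ.continuous.tendsto 0).comp h0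
    rwa [map_zero] at this

/-- The sum of the complex generalized eigenspaces for the eigenvalues in `s`. -/
abbrev complexSpectralSubspace (M : Matrix (Fin n) (Fin n) ℝ) (s : Set ℂ) :
    Submodule ℂ (Fin n → ℂ) :=
  ⨆ z ∈ s, Module.End.maxGenEigenspace (Matrix.toLin' (M.map (algebraMap ℝ ℂ))) z

theorem complexSpectralSubspace_neg_le (M : Matrix (Fin n) (Fin n) ℝ) :
    complexSpectralSubspace M {z | z.re < 0} ≤
      complexDecayingSpace (Matrix.toLin' (M.map (algebraMap ℝ ℂ))) atTop :=
  iSup₂_le fun _ hz => maxGenEigenspace_le_complexDecayingSpace _ (tendsto_exp_mul_pow_atTop hz)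

theorem complexSpectralSubspace_pos_le (M : Matrix (Fin n) (Fin n) ℝ) :
    complexSpectralSubspace M {z | 0 < z.re} ≤
      complexDecayingSpace (Matrix.toLin' (M.map (algebraMap ℝ ℂ))) atBot :=
  iSup₂_le fun _ hz => maxGenEigenspace_le_complexDecayingSpace _ (tendsto_exp_mul_pow_atBot hz)

theorem IsHyperbolic.sup_eq_top (hM : IsHyperbolic M) :
    complexSpectralSubspace M {z | z.re < 0} ⊔ complexSpectralSubspace M {z | 0 < z.re} = ⊤ := by
  rw [eq_top_iff, ← Module.End.iSup_maxGenEigenspace_eq_top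
    (Matrix.toLin' (M.map (algebraMap ℝ ℂ)))]
  refine iSup_le fun z => ?_
  rcases lt_trichotomy z.re 0 with h | h | h
  · exact le_sup_of_le_left (le_iSup₂_of_le z h le_rfl)
  · have h1 : ¬Module.End.HasEigenvalue (Matrix.toLin' (M.map (algebraMap ℝ ℂ))) z := fun h2 => by
      have h3 := h2.mem_spectrum
      rw [Matrix.spectrum_toLin'] at h3
      exact hM z h3 h
    intro v hv
    obtain ⟨k, hk⟩ := (Module.End.mem_maxGenEigenspace _ z v).1 hv
    have h2 : Module.End.genEigenspace (Matrix.toLin' (M.map (algebraMap ℝ ℂ))) z k = ⊥ := by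
      by_contra h3
      exact h1 (Module.End.hasEigenvalue_of_hasGenEigenvalue h3)
    have h3 := Module.End.mem_genEigenspace_nat.2 (LinearMap.mem_ker.2 hk)
    rw [h2, Submodule.mem_bot] at h3
    rw [h3]
    exact zero_mem _
  · exact le_sup_of_le_right (le_iSup₂_of_le z h le_rfl)

theorem eq_zero_of_reVec {a : Fin n → ℂ} (h : reVec n a = 0)
    (h' : reVec n (Complex.I • a) = 0) : a = 0 := by
  ext1 i
  have h1 := congrArg (fun v => v i) h
  have h2 := congrArg (fun v => v i) h'
  refine Complex.ext (by simpa [reVec_apply] using h1) ?_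
  simpa [reVec_apply] using h2

variable {H : EuclideanSpace ℝ (Fin n) →L[ℝ] EuclideanSpace ℝ (Fin n)} {c : ℝ}

theorem IsLyapunov.isLyapunovSystem_const
    (h : IsLyapunov H c (Matrix.toEuclideanCLM (𝕜 := ℝ) M)) :
    IsLyapunovSystem (fun _ => M) H c :=
  ⟨⟨continuous_const, ‖Matrix.toEuclideanCLM (𝕜 := ℝ) M‖, fun _ => le_rfl⟩, fun _ => h⟩

theorem IsHyperbolic.eq_zero_of_mem (hM : IsHyperbolic M) {b : Fin n → ℂ}
    (h : b ∈ complexDecayingSpace (Matrix.toLin' (M.map (algebraMap ℝ ℂ))) atTop)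
    (h' : b ∈ complexDecayingSpace (Matrix.toLin' (M.map (algebraMap ℝ ℂ))) atBot) : b = 0 := by
  obtain ⟨H, c, hH⟩ := hM.exists_isLyapunov
  have h1 := Submodule.disjoint_def.1 (hH.isLyapunovSystem_const.isCompl 0).disjoint
  exact eq_zero_of_reVec
    (h1 _ (reVec_mem_decayingSpace h) (reVec_mem_decayingSpace h'))
    (h1 _ (reVec_mem_decayingSpace (Submodule.smul_mem _ _ h))
      (reVec_mem_decayingSpace (Submodule.smul_mem _ _ h')))

/-- The spectral spaces span and consist of values of solutions decaying at `+∞`, respectively `-∞`.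
In a decaying solution the second component therefore decays at both ends and vanishes. -/
theorem IsHyperbolic.stableSpace_eq (hM : IsHyperbolic M) :
    stableSpace (fun _ => M) 0 = negSpace M := by
  refine le_antisymm (fun v hv => ?_) fun v hv => ?_
  · have h1 := complexify_mem_complexDecayingSpace hv
    have h2 : complexify n v ∈ (⊤ : Submodule ℂ (Fin n → ℂ)) := trivial
    rw [← hM.sup_eq_top] at h2
    obtain ⟨a, ha, b, hb, hab⟩ := Submodule.mem_sup.1 h2
    have hb0 : b = 0 := hM.eq_zero_of_mem (by
      rw [← add_sub_cancel_left a b, hab]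
      exact sub_mem h1 (complexSpectralSubspace_neg_le M ha)) (complexSpectralSubspace_pos_le M hb)
    rw [hb0, add_zero] at hab
    change complexify n v ∈ complexSpectralSubspace M _
    rw [← hab]
    exact ha
  · rw [← reVec_complexify v]
    exact reVec_mem_decayingSpace (complexSpectralSubspace_neg_le M hv)

theorem IsHyperbolic.unstableSpace_eq (hM : IsHyperbolic M) :
    unstableSpace (fun _ => M) 0 = posSpace M := by
  refine le_antisymm (fun v hv => ?_) fun v hv => ?_
  · have h1 := complexify_mem_complexDecayingSpace hv
    have h2 : complexify n v ∈ (⊤ : Submodule ℂ (Fin n → ℂ)) := trivial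
    rw [← hM.sup_eq_top] at h2
    obtain ⟨a, ha, b, hb, hab⟩ := Submodule.mem_sup.1 h2
    have ha0 : a = 0 := hM.eq_zero_of_mem (complexSpectralSubspace_neg_le M ha) (by
      rw [← add_sub_cancel_right a b, hab]
      exact sub_mem h1 (complexSpectralSubspace_pos_le M hb))
    rw [ha0, zero_add] at hab
    change complexify n v ∈ complexSpectralSubspace M _
    rw [← hab]
    exact hb
  · rw [← reVec_complexify v]
    exact reVec_mem_decayingSpace (complexSpectralSubspace_pos_le M hv)

end Constant

end


noncomputable section

/-! ### Uniform estimates for asymptotically hyperbolic families -/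

section Uniform

theorem tendstoUniformly_of_limits {F : Type*} [PseudoMetricSpace F] {f : I → ℝ → F}
    (hf : Continuous fun q : I × ℝ => f q.1 q.2) {P Q : I → F}
    (hP : TendstoUniformly (fun t l => f l t) P atTop)
    (hQ : TendstoUniformly (fun t l => f l t) Q atBot) (l₀ : I) :
    TendstoUniformly f (f l₀) (𝓝 l₀) := by
  rw [Metric.tendstoUniformly_iff] at hP hQ ⊢
  intro ε hε
  obtain ⟨b, hb⟩ := eventually_atTop.1 (hP (ε / 5) (by positivity))
  obtain ⟨a, ha⟩ := eventually_atBot.1 (hQ (ε / 5) (by positivity))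
  have hK : Continuous ↿fun (l : I) (t : Icc (min a b) b) => f l t :=
    hf.comp (continuous_fst.prodMk (continuous_subtype_val.comp continuous_snd))
  have h1 := Metric.tendstoUniformly_iff.1 (Continuous.tendstoUniformly _ hK l₀) (ε / 5)
    (by positivity)
  -- A point `t` in a tail is compared with the endpoint `s` of the compact middle part, through the
  -- limits at `l₀` and `l`: five distances, hence the fifths.
  have key : ∀ (R : I → F) (l : I) (t s : ℝ), (∀ l, dist (R l) (f l t) < ε / 5) →
      (∀ l, dist (R l) (f l s) < ε / 5) → dist (f l₀ s) (f l s) < ε / 5 →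
      dist (f l₀ t) (f l t) < ε := by
    intro R l t s h2 h3 h4
    have e1 := dist_triangle4 (f l₀ t) (R l₀) (f l₀ s) (f l s)
    have e2 := dist_triangle4 (f l₀ t) (f l s) (R l) (f l t)
    have e3 := h2 l₀
    have e4 := h3 l
    rw [dist_comm] at e3 e4
    linarith [h2 l, h3 l₀]
  filter_upwards [h1] with l hl t
  rcases le_total b t with hbt | hbt
  · exact key P l t b (hb t hbt) (hb b le_rfl) (hl ⟨b, min_le_right _ _, le_rfl⟩)
  rcases le_total t (min a b) with hat | hat
  · exact key Q l t (min a b) (ha t (hat.trans (min_le_left _ _))) (ha _ (min_le_left _ _))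
      (hl ⟨min a b, le_rfl, min_le_right _ _⟩)
  · exact (hl ⟨t, hat, hbt⟩).trans (by linarith)

variable {n : ℕ}

theorem continuous_mulOp {J : Set ℝ}
    {a : I → ℝ → EuclideanSpace ℝ (Fin n) →L[ℝ] EuclideanSpace ℝ (Fin n)}
    (ha : ∀ l, MemLp (a l) ∞ (volume.restrict J))
    (h : ∀ l₀, TendstoUniformly a (a l₀) (𝓝 l₀)) : Continuous fun l => mulOp (ha l) := by
  rw [continuous_iff_continuousAt]
  intro l₀
  rw [ContinuousAt, Metric.tendsto_nhds]
  intro ε hε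
  filter_upwards [Metric.tendstoUniformly_iff.1 (h l₀) (ε / 2) (by positivity)] with l hl
  rw [dist_eq_norm]
  refine (norm_mulOp_sub_le (ha l) (ha l₀) (by positivity) fun t => ?_).trans_lt
    (half_lt_self hε)
  rw [← dist_eq_norm, dist_comm]
  exact (hl t).le

theorem continuous_coeffOp {J : Set ℝ}
    {a : I → ℝ → EuclideanSpace ℝ (Fin n) →L[ℝ] EuclideanSpace ℝ (Fin n)}
    (ha : ∀ l, MemLp (a l) ∞ (volume.restrict J))
    (h : ∀ l₀, TendstoUniformly a (a l₀) (𝓝 l₀)) : Continuous fun l => coeffOp (ha l) :=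
  (continuous_const.sub ((continuous_mulOp ha h).clm_comp continuous_const)).clm_comp
    continuous_const

theorem uniformContinuous_toEuclideanCLM (n : ℕ) : UniformContinuous
    fun M : Matrix (Fin n) (Fin n) ℝ => Matrix.toEuclideanCLM (𝕜 := ℝ) M :=
  uniformContinuous_addMonoidHom_of_continuous
    (f := (Matrix.toEuclideanCLM (n := Fin n) (𝕜 := ℝ)).toAlgEquiv.toLinearMap)
    (LinearMap.continuous_of_finiteDimensional _)

/-- A uniform limit of hyperbolic matrices has Lyapunov functions that are valid near the limit. -/
theorem exists_isLyapunov_of_tendstoUniformly {S : I → ℝ → Matrix (Fin n) (Fin n) ℝ}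
    {Q : I → Matrix (Fin n) (Fin n) ℝ} {F : Filter ℝ} [NeBot F]
    (h : TendstoUniformly (fun t l => S l t) Q F) (hc : ∀ t, Continuous fun l => S l t)
    (hQ : ∀ l, IsHyperbolic (Q l)) : ∃ A ∈ F, ∀ l, ∃ H c,
      IsLyapunov H c (Matrix.toEuclideanCLM (𝕜 := ℝ) (Q l)) ∧
        ∀ t ∈ A, IsLyapunov H c (coeff (S l) t) := by
  have hQc : Continuous fun l => Matrix.toEuclideanCLM (𝕜 := ℝ) (Q l) :=
    (uniformContinuous_toEuclideanCLM n).continuous.comp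
      (h.continuous (Frequently.of_forall hc))
  have hu := Metric.tendstoUniformly_iff.1
    ((uniformContinuous_toEuclideanCLM n).comp_tendstoUniformly h)
  suffices ∃ A ∈ F, ∀ l ∈ (univ : Set I), ∃ H c,
      IsLyapunov H c (Matrix.toEuclideanCLM (𝕜 := ℝ) (Q l)) ∧
        ∀ t ∈ A, IsLyapunov H c (coeff (S l) t) by simpa using this
  -- Only the set `A` of times has to be uniform in `l`; the form and its constant may vary. Finite
  -- unions are handled by intersecting the sets `A`.
  refine isCompact_univ.induction_on (p := fun s : Set I => ∃ A ∈ F, ∀ l ∈ s, ∃ H c,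
      IsLyapunov H c (Matrix.toEuclideanCLM (𝕜 := ℝ) (Q l)) ∧
        ∀ t ∈ A, IsLyapunov H c (coeff (S l) t)) ⟨univ, univ_mem, by simp⟩ ?_ ?_ ?_
  · rintro s t hst ⟨A, hA, hs⟩
    exact ⟨A, hA, fun l hl => hs l (hst hl)⟩
  · rintro s t ⟨A, hA, hs⟩ ⟨B, hB, ht⟩
    refine ⟨A ∩ B, inter_mem hA hB, fun l hl => ?_⟩
    rcases hl with hl | hl
    · obtain ⟨H, c, h1, h2⟩ := hs l hl
      exact ⟨H, c, h1, fun t ht => h2 t ht.1⟩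
    · obtain ⟨H, c, h1, h2⟩ := ht l hl
      exact ⟨H, c, h1, fun t ht => h2 t ht.2⟩
  · intro l₀ _
    obtain ⟨H, c, hH⟩ := (hQ l₀).exists_isLyapunov
    -- Half of `δ` is spent on moving `Q l₀` to `Q l`, the other half on passing from `Q l` to `S l
    -- t`.
    obtain ⟨δ, hδ, hδH⟩ : ∃ δ > 0, δ * ‖H‖ ≤ c / 2 := by
      refine ⟨c / 2 / (‖H‖ + 1), div_pos (half_pos hH.pos) (by positivity), ?_⟩
      rw [div_mul_eq_mul_div, div_le_iff₀ (by positivity)]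
      exact mul_le_mul_of_nonneg_left (by linarith) (half_pos hH.pos).le
    refine ⟨_, mem_nhdsWithin_of_mem_nhds (hQc.continuousAt.eventually
      (Metric.ball_mem_nhds _ (half_pos hδ))), _, hu (δ / 2) (half_pos hδ), fun l hl =>
        ⟨H, c / 2, hH.of_norm_sub_le ?_, fun t ht => hH.of_norm_sub_le ?_⟩⟩
    · have h1 : dist (Matrix.toEuclideanCLM (𝕜 := ℝ) (Q l))
        (Matrix.toEuclideanCLM (𝕜 := ℝ) (Q l₀)) < δ / 2 := hl
      rw [dist_eq_norm] at h1
      exact (mul_le_mul_of_nonneg_right (by linarith) (norm_nonneg _)).trans hδH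
    · have h1 : dist (Matrix.toEuclideanCLM (𝕜 := ℝ) (Q l))
        (Matrix.toEuclideanCLM (𝕜 := ℝ) (Q l₀)) < δ / 2 := hl
      have h2 : dist (Matrix.toEuclideanCLM (𝕜 := ℝ) (Q l)) (coeff (S l) t) < δ / 2 := ht l
      have h3 := dist_triangle_left (coeff (S l) t) (Matrix.toEuclideanCLM (𝕜 := ℝ) (Q l₀))
        (Matrix.toEuclideanCLM (𝕜 := ℝ) (Q l))
      rw [dist_eq_norm (coeff (S l) t)] at h3
      exact (mul_le_mul_of_nonneg_right (by linarith) (norm_nonneg _)).trans hδH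

namespace AsympHyperbolic

variable {S : I → ℝ → Matrix (Fin n) (Fin n) ℝ} {Sp Sm : I → Matrix (Fin n) (Fin n) ℝ}

/-- The essential bound holds on a dense set, which is closed by continuity, so it holds everywhere.
-/
theorem isBoundedCoeff (hS : AsympHyperbolic S Sp Sm) (l : I) : IsBoundedCoeff (coeff (S l)) := by
  have hc : Continuous (coeff (S l)) := (uniformContinuous_toEuclideanCLM n).continuous.comp
    (hS.continuous.comp (by fun_prop : Continuous fun t : ℝ => (l, t)))
  refine ⟨hc, (eLpNormEssSup (coeff (S l)) volume).toReal, ?_⟩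
  have hm := hS.memLp l univ
  rw [Measure.restrict_univ] at hm
  have hfin : eLpNormEssSup (coeff (S l)) volume ≠ ⊤ := by
    have := hm.2.ne
    rwa [eLpNorm_exponent_top] at this
  have hd : Dense {t | ‖coeff (S l) t‖ ≤ (eLpNormEssSup (coeff (S l)) volume).toReal} := by
    refine Measure.dense_of_ae (μ := volume) ?_
    filter_upwards [enorm_ae_le_eLpNormEssSup (coeff (S l)) volume] with t ht
    rw [← toReal_enorm]
    exact ENNReal.toReal_mono hfin ht
  have h1 := hd.closure_eq
  rw [(isClosed_le hc.norm continuous_const).closure_eq] at h1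
  exact fun t => (h1.symm ▸ mem_univ t : t ∈ {t | ‖coeff (S l) t‖ ≤ _})

theorem tendstoUniformly (hS : AsympHyperbolic S Sp Sm) (l₀ : I) :
    TendstoUniformly (fun l => coeff (S l)) (coeff (S l₀)) (𝓝 l₀) :=
  tendstoUniformly_of_limits
    ((uniformContinuous_toEuclideanCLM n).continuous.comp hS.continuous)
    ((uniformContinuous_toEuclideanCLM n).comp_tendstoUniformly hS.tendsto_atTop)
    ((uniformContinuous_toEuclideanCLM n).comp_tendstoUniformly hS.tendsto_atBot) l₀

end AsympHyperbolic

end Uniform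

end


noncomputable section

/-! ### Stable and unstable spaces of asymptotically hyperbolic families -/

section Clipped

variable {n : ℕ}

theorem unstableSpace_congr {M M' : ℝ → Matrix (Fin n) (Fin n) ℝ}
    {H : EuclideanSpace ℝ (Fin n) →L[ℝ] EuclideanSpace ℝ (Fin n)} {c τ : ℝ}
    (hM : IsBoundedCoeff (coeff M)) (hM' : IsBoundedCoeff (coeff M'))
    (hH : ∀ t, t < τ → IsLyapunov H c (coeff M t)) (h : ∀ t, t < τ → M t = M' t) :
    unstableSpace M τ = unstableSpace M' τ := by
  rw [unstableSpace_eq, unstableSpace_eq]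
  refine stableSpace_congr (H := -H) (c := c) (isBoundedCoeff_reverse hM)
    (isBoundedCoeff_reverse hM') (fun t ht => ?_) fun t ht => ?_
  · rw [coeff_reverse]
    exact (hH _ (by linarith)).neg
  · rw [h _ (by linarith)]

theorem IsLyapunovSystem.finrank_unstable_eq {M M' : ℝ → Matrix (Fin n) (Fin n) ℝ}
    {H : EuclideanSpace ℝ (Fin n) →L[ℝ] EuclideanSpace ℝ (Fin n)} {c c' τ τ' : ℝ}
    (h : IsLyapunovSystem M H c) (h' : IsLyapunovSystem M' H c') :
    Module.finrank ℝ (unstableSpace M τ) = Module.finrank ℝ (unstableSpace M' τ') := by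
  have h1 := Submodule.finrank_add_eq_of_isCompl (h.isCompl τ)
  have h2 := Submodule.finrank_add_eq_of_isCompl (h'.isCompl τ')
  have h3 := h.finrank_eq h' (τ := τ) (τ' := τ')
  omega

variable {S : I → ℝ → Matrix (Fin n) (Fin n) ℝ} {Sp Sm : I → Matrix (Fin n) (Fin n) ℝ} {τ : ℝ}

namespace AsympHyperbolic

theorem isBoundedCoeff_comp (hS : AsympHyperbolic S Sp Sm) {κ : ℝ → ℝ} (hκ : Continuous κ) (l : I) :
    IsBoundedCoeff (coeff fun t => S l (κ t)) :=
  ⟨(hS.isBoundedCoeff l).continuous.comp hκ, (hS.isBoundedCoeff l).bounded.imp fun _ hC _ => hC _⟩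

/-- Freezing the coefficient at its value at `τ` for earlier times extends the Lyapunov inequality
to the whole line without touching the stable space at `τ`. -/
theorem isLyapunovSystem_max (hS : AsympHyperbolic S Sp Sm) {l : I}
    {H : EuclideanSpace ℝ (Fin n) →L[ℝ] EuclideanSpace ℝ (Fin n)} {c : ℝ}
    (h : ∀ t, τ ≤ t → IsLyapunov H c (coeff (S l) t)) :
    IsLyapunovSystem (fun t => S l (max t τ)) H c :=
  ⟨hS.isBoundedCoeff_comp (by fun_prop) l, fun t => h _ (le_max_right _ _)⟩

theorem isLyapunovSystem_min (hS : AsympHyperbolic S Sp Sm) {l : I}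
    {H : EuclideanSpace ℝ (Fin n) →L[ℝ] EuclideanSpace ℝ (Fin n)} {c : ℝ}
    (h : ∀ t, t ≤ τ → IsLyapunov H c (coeff (S l) t)) :
    IsLyapunovSystem (fun t => S l (min t τ)) H c :=
  ⟨hS.isBoundedCoeff_comp (by fun_prop) l, fun t => h _ (min_le_right _ _)⟩

theorem stableSpace_max (hS : AsympHyperbolic S Sp Sm) {l : I}
    {H : EuclideanSpace ℝ (Fin n) →L[ℝ] EuclideanSpace ℝ (Fin n)} {c : ℝ}
    (h : ∀ t, τ ≤ t → IsLyapunov H c (coeff (S l) t)) :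
    stableSpace (S l) τ = stableSpace (fun t => S l (max t τ)) τ :=
  stableSpace_congr (hS.isBoundedCoeff l) (hS.isBoundedCoeff_comp (by fun_prop) l)
    (fun t ht => h t ht.le) fun t ht => by rw [max_eq_left ht.le]

theorem unstableSpace_min (hS : AsympHyperbolic S Sp Sm) {l : I}
    {H : EuclideanSpace ℝ (Fin n) →L[ℝ] EuclideanSpace ℝ (Fin n)} {c : ℝ}
    (h : ∀ t, t ≤ τ → IsLyapunov H c (coeff (S l) t)) :
    unstableSpace (S l) τ = unstableSpace (fun t => S l (min t τ)) τ :=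
  unstableSpace_congr (hS.isBoundedCoeff l) (hS.isBoundedCoeff_comp (by fun_prop) l)
    (fun t ht => h t ht.le) fun t ht => by rw [min_eq_left ht.le]

/-- The clipped system and the constant limit system share the form `H`, and for the limit system
the stable space is the negative spectral space. -/
theorem finrank_stableSpace (hS : AsympHyperbolic S Sp Sm) {l : I}
    {H : EuclideanSpace ℝ (Fin n) →L[ℝ] EuclideanSpace ℝ (Fin n)} {c : ℝ}
    (h : ∀ t, τ ≤ t → IsLyapunov H c (coeff (S l) t))
    (h' : IsLyapunov H c (Matrix.toEuclideanCLM (𝕜 := ℝ) (Sp l))) :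
    Module.finrank ℝ (stableSpace (S l) τ) = Module.finrank ℝ (negSpace (Sp l)) := by
  rw [hS.stableSpace_max h, ← (hS.hyperbolic_atTop l).stableSpace_eq]
  exact (hS.isLyapunovSystem_max h).finrank_eq h'.isLyapunovSystem_const

theorem finrank_unstableSpace (hS : AsympHyperbolic S Sp Sm) {l : I}
    {H : EuclideanSpace ℝ (Fin n) →L[ℝ] EuclideanSpace ℝ (Fin n)} {c : ℝ}
    (h : ∀ t, t ≤ τ → IsLyapunov H c (coeff (S l) t))
    (h' : IsLyapunov H c (Matrix.toEuclideanCLM (𝕜 := ℝ) (Sm l))) :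
    Module.finrank ℝ (unstableSpace (S l) τ) = Module.finrank ℝ (posSpace (Sm l)) := by
  rw [hS.unstableSpace_min h, ← (hS.hyperbolic_atBot l).unstableSpace_eq]
  exact (hS.isLyapunovSystem_min h).finrank_unstable_eq h'.isLyapunovSystem_const

theorem exists_splitting_comp (hS : AsympHyperbolic S Sp Sm) {κ : ℝ → ℝ} (hκ : Continuous κ)
    (h : ∀ l, ∃ H c, IsLyapunovSystem (fun t => S l (κ t)) H c) (τ : ℝ) :
    ∃ p : I → EuclideanSpace ℝ (Fin n) →L[ℝ] EuclideanSpace ℝ (Fin n), Continuous p ∧ ∀ l ξ,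
      p l ξ ∈ stableSpace (fun t => S l (κ t)) τ ∧
      ξ - p l ξ ∈ unstableSpace (fun t => S l (κ t)) τ := by
  obtain ⟨p, hp, hpξ⟩ := exists_splitting (fun l => hS.isBoundedCoeff_comp hκ l)
    (fun l => let ⟨_, _, h⟩ := h l; h.isBoundedCoeff.bijective_coeffOp h.lyapunov)
    (continuous_mulOp _ fun l₀ => (hS.tendstoUniformly l₀).comp κ) τ
  refine ⟨p, hp, fun l ξ => ?_⟩
  obtain ⟨H, c, hl⟩ := h l
  obtain ⟨⟨x, w, hx, hxm, hxt⟩, z, w', hz, hzm, hzt⟩ := hpξ l ξ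
  exact ⟨(mem_stableSpace_iff hl.isBoundedCoeff fun t _ => hl.lyapunov t).2 ⟨x, w, hx, hxm, hxt⟩,
    (mem_unstableSpace_iff hl.isBoundedCoeff fun t _ => hl.lyapunov t).2 ⟨z, w', hz, hzm, hzt⟩⟩

/-- The stable spaces are the ranges of a continuous path of projections. -/
theorem exists_stable_projection (hS : AsympHyperbolic S Sp Sm)
    (h : ∀ l, ∃ H c, ∀ t, τ ≤ t → IsLyapunov H c (coeff (S l) t)) :
    ∃ p : I → EuclideanSpace ℝ (Fin n) →L[ℝ] EuclideanSpace ℝ (Fin n), Continuous p ∧ ∀ l,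
      (∀ ξ, p l ξ ∈ stableSpace (S l) τ) ∧ ∀ ξ ∈ stableSpace (S l) τ, p l ξ = ξ := by
  have h' := fun l => (h l).imp fun H => Exists.imp fun c hl => hS.isLyapunovSystem_max hl
  obtain ⟨p, hp, hpξ⟩ := hS.exists_splitting_comp (by fun_prop) h' τ
  refine ⟨p, hp, fun l => ?_⟩
  obtain ⟨H, c, hl⟩ := h l
  rw [hS.stableSpace_max hl]
  refine ⟨fun ξ => (hpξ l ξ).1, fun ξ hξ => ?_⟩
  exact (sub_eq_zero.1 (Submodule.disjoint_def.1 ((hS.isLyapunovSystem_max hl).isCompl τ).disjoint _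
    (sub_mem hξ (hpξ l ξ).1) (hpξ l ξ).2)).symm

/-- The unstable spaces are the ranges of a continuous path of projections. -/
theorem exists_unstable_projection (hS : AsympHyperbolic S Sp Sm)
    (h : ∀ l, ∃ H c, ∀ t, t ≤ τ → IsLyapunov H c (coeff (S l) t)) :
    ∃ p : I → EuclideanSpace ℝ (Fin n) →L[ℝ] EuclideanSpace ℝ (Fin n), Continuous p ∧ ∀ l,
      (∀ ξ, p l ξ ∈ unstableSpace (S l) τ) ∧ ∀ ξ ∈ unstableSpace (S l) τ, p l ξ = ξ := by
  have h' := fun l => (h l).imp fun H => Exists.imp fun c hl => hS.isLyapunovSystem_min hl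
  obtain ⟨p, hp, hpξ⟩ := hS.exists_splitting_comp (by fun_prop) h' τ
  refine ⟨fun l => ContinuousLinearMap.id ℝ _ - p l, continuous_const.sub hp, fun l => ?_⟩
  obtain ⟨H, c, hl⟩ := h l
  rw [hS.unstableSpace_min hl]
  refine ⟨fun ξ => (hpξ l ξ).2, fun ξ hξ => ?_⟩
  have h1 := Submodule.disjoint_def.1 ((hS.isLyapunovSystem_min hl).isCompl τ).disjoint _
    (hpξ l ξ).1 (by simpa using sub_mem hξ (hpξ l ξ).2)
  simp [h1]

end AsympHyperbolic

end Clipped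

end


noncomputable section

/-! ### Boundary value problems -/

section Index

variable {𝕜 X Y Z : Type*} [Field 𝕜] [AddCommGroup X] [Module 𝕜 X] [AddCommGroup Y] [Module 𝕜 Y]
  [AddCommGroup Z] [Module 𝕜 Z] [FiniteDimensional 𝕜 Z]

/-- The index of the restriction of a surjective operator to the subspace given by finitely many
boundary conditions. -/
theorem LinearMap.index_restrict_comap {Θ : X →ₗ[𝕜] Y} (hΘ : Function.Surjective Θ)
    {β : X →ₗ[𝕜] Z} (hβ : Function.Surjective β) (F : Submodule 𝕜 Z) [FiniteDimensional 𝕜 Θ.ker]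
    (hdim : Module.finrank 𝕜 Θ.ker + Module.finrank 𝕜 F = Module.finrank 𝕜 Z) :
    FiniteDimensional 𝕜 (Θ ∘ₗ (F.comap β).subtype).ker ∧
    FiniteDimensional 𝕜 (Y ⧸ (Θ ∘ₗ (F.comap β).subtype).range) ∧
    Module.finrank 𝕜 (Θ ∘ₗ (F.comap β).subtype).ker =
      Module.finrank 𝕜 (Y ⧸ (Θ ∘ₗ (F.comap β).subtype).range) := by
  -- Restricting `Θ` has the same kernel and cokernel as the finite-dimensional map `Φ`, whose index
  -- is `dim ker Θ - dim (Z/F) = 0`.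
  let Φ : Θ.ker →ₗ[𝕜] Z ⧸ F := F.mkQ ∘ₗ β ∘ₗ Θ.ker.subtype
  have hΦ : ∀ x : Θ.ker, Φ x = F.mkQ (β x) := fun x => rfl
  have hmem : ∀ x, F.mkQ (β x) = 0 ↔ x ∈ F.comap β := fun x => by simp
  let e₁ : (Θ ∘ₗ (F.comap β).subtype).ker ≃ₗ[𝕜] Φ.ker :=
    { toFun := fun x => ⟨⟨x.1.1, x.2⟩, (hmem _).2 x.1.2⟩
      invFun := fun x => ⟨⟨x.1.1, (hmem _).1 x.2⟩, x.1.2⟩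
      map_add' := fun _ _ => rfl
      map_smul' := fun _ _ => rfl
      left_inv := fun _ => rfl
      right_inv := fun _ => rfl }
  let f : X →ₗ[𝕜] Y ⧸ (Θ ∘ₗ (F.comap β).subtype).range := Submodule.mkQ _ ∘ₗ Θ
  let g : X →ₗ[𝕜] (Z ⧸ F) ⧸ Φ.range := Submodule.mkQ _ ∘ₗ F.mkQ ∘ₗ β
  have hf : Function.Surjective f := (Submodule.mkQ_surjective _).comp hΘ
  have hg : Function.Surjective g :=
    (Submodule.mkQ_surjective _).comp ((Submodule.mkQ_surjective _).comp hβ)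
  have hker : f.ker = g.ker := by
    ext x
    have h1 : x ∈ f.ker ↔ Θ x ∈ (Θ ∘ₗ (F.comap β).subtype).range := by
      change Submodule.mkQ _ (Θ x) = 0 ↔ _
      simp
    have h2 : x ∈ g.ker ↔ F.mkQ (β x) ∈ Φ.range := by
      change Submodule.mkQ _ (F.mkQ (β x)) = 0 ↔ _
      simp
    rw [h1, h2]
    constructor
    · rintro ⟨d, hd⟩
      have hd' : Θ d = Θ x := hd
      refine ⟨⟨x - d, by simp [hd']⟩, ?_⟩
      rw [hΦ, map_sub, map_sub, (hmem d).2 d.2, sub_zero]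
    · rintro ⟨k, hk⟩
      have hk' : Θ k = 0 := k.2
      refine ⟨⟨x - k, (hmem _).1 ?_⟩, ?_⟩
      · rw [map_sub, map_sub, ← hk, hΦ, sub_self]
      · change Θ (x - k) = Θ x
        rw [map_sub, hk', sub_zero]
  let e₂ : (Y ⧸ (Θ ∘ₗ (F.comap β).subtype).range) ≃ₗ[𝕜] (Z ⧸ F) ⧸ Φ.range :=
    (f.quotKerEquivOfSurjective hf).symm ≪≫ₗ Submodule.quotEquivOfEq _ _ hker ≪≫ₗ
      g.quotKerEquivOfSurjective hg
  refine ⟨e₁.symm.finiteDimensional, e₂.symm.finiteDimensional, ?_⟩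
  rw [e₁.finrank_eq, e₂.finrank_eq]
  have h1 := Φ.finrank_range_add_finrank_ker
  have h2 := Submodule.finrank_quotient_add_finrank Φ.range
  have h3 := Submodule.finrank_quotient_add_finrank F
  omega

end Index

/-! ### Extension by zero and restriction between the line and a subset. -/

section Restriction

variable {n : ℕ} {J : Set ℝ}

theorem exists_extendZero (n : ℕ) (hJ : MeasurableSet J) :
    ∃ ι : L2On n J →ₗ[ℝ] L2On n univ, ∀ y, ∀ᵐ t, ι y t = J.indicator y t := by
  have hm : ∀ y : L2On n J, MemLp (J.indicator y) 2 (volume.restrict univ) := fun y => by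
    rw [memLp_indicator_iff_restrict hJ, Measure.restrict_restrict hJ, inter_univ]
    exact Lp.memLp y
  refine ⟨{ toFun := fun y => (hm y).toLp, map_add' := fun y z => ?_, map_smul' := fun r y => ?_ },
    fun y => ?_⟩
  · rw [← MemLp.toLp_add]
    refine MemLp.toLp_congr _ _ ?_
    rw [Filter.EventuallyEq, ae_restrict_iff' MeasurableSet.univ]
    filter_upwards [(ae_restrict_iff' hJ).1 (Lp.coeFn_add y z)] with t ht _
    by_cases htJ : t ∈ J
    · simp only [Pi.add_apply, indicator_of_mem htJ]
      exact ht htJ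
    · simp [htJ]
  · rw [RingHom.id_apply, ← MemLp.toLp_const_smul]
    refine MemLp.toLp_congr _ _ ?_
    rw [Filter.EventuallyEq, ae_restrict_iff' MeasurableSet.univ]
    filter_upwards [(ae_restrict_iff' hJ).1 (Lp.coeFn_smul r y)] with t ht _
    by_cases htJ : t ∈ J
    · simp [htJ, ht htJ]
    · simp [htJ]
  · exact ((ae_restrict_iff' MeasurableSet.univ).1 (hm y).coeFn_toLp).mono fun t ht => ht trivial

theorem exists_restrict_L2 (n : ℕ) (J : Set ℝ) : ∃ r : L2On n univ →L[ℝ] L2On n J,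
    ∀ y, r y =ᵐ[volume.restrict J] y := by
  have hle : volume.restrict J ≤ volume.restrict univ := Measure.restrict_mono (subset_univ J) le_rfl
  have hm : ∀ y : L2On n univ, MemLp y 2 (volume.restrict J) := fun y =>
    (Lp.memLp y).mono_measure hle
  refine ⟨LinearMap.mkContinuous
    { toFun := fun y => (hm y).toLp, map_add' := fun y z => ?_, map_smul' := fun r y => ?_ } 1
    fun y => ?_, fun y => (hm y).coeFn_toLp⟩
  · rw [← MemLp.toLp_add]
    exact MemLp.toLp_congr _ _ (ae_mono hle (Lp.coeFn_add y z))
  · rw [RingHom.id_apply, ← MemLp.toLp_const_smul]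
    exact MemLp.toLp_congr _ _ (ae_mono hle (Lp.coeFn_smul r y))
  · change ‖(hm y).toLp‖ ≤ _
    rw [one_mul, Lp.norm_toLp, Lp.norm_def]
    exact ENNReal.toReal_mono (Lp.eLpNorm_ne_top y) (eLpNorm_mono_measure _ hle)

theorem exists_restrict_W12 (n : ℕ) (J : Set ℝ) : ∃ R : W12 n univ →L[ℝ] W12 n J,
    ∀ p u w, IsRep p u w → IsRep (R p) u w := by
  obtain ⟨r, hr⟩ := exists_restrict_L2 n J
  have hle : volume.restrict J ≤ volume.restrict univ := Measure.restrict_mono (subset_univ J) le_rfl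
  let R₀ : W12 n univ →L[ℝ] WithLp 2 (L2On n J × L2On n J) :=
    ((WithLp.prodContinuousLinearEquiv 2 ℝ (L2On n J) (L2On n J)).symm :
      L2On n J × L2On n J →L[ℝ] WithLp 2 (L2On n J × L2On n J)) ∘L
      ((r ∘L WithLp.fstL 2 ℝ _ _).prod (r ∘L WithLp.sndL 2 ℝ _ _)) ∘L (W12 n univ).subtypeL
  have h1 : ∀ p, (R₀ p).fst = r p.1.fst := fun p => rfl
  have h2 : ∀ p, (R₀ p).snd = r p.1.snd := fun p => rfl
  have hf : ∀ p u w, IsRep p u w → (R₀ p).fst =ᵐ[volume.restrict J] u := fun p u w h => by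
    rw [h1]
    exact (hr _).trans (ae_mono hle h.fst)
  have hs : ∀ p u w, IsRep p u w → (R₀ p).snd =ᵐ[volume.restrict J] w := fun p u w h => by
    rw [h2]
    exact (hr _).trans (ae_mono hle h.snd)
  refine ⟨R₀.codRestrict (W12 n J) fun p => ?_, fun p u w h => ⟨h.isPrimitive, hf p u w h, hs p u w h⟩⟩
  obtain ⟨u, hu⟩ := W12.exists_isRep ordConnected_univ (by simp) p
  exact mem_W12_of_isPrimitive hu.isPrimitive (hf p _ _ hu) (hs p _ _ hu)

end Restriction

/-! ### Solvability on bounded intervals. -/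

section Interval

variable {n : ℕ} {a : ℝ → EuclideanSpace ℝ (Fin n) →L[ℝ] EuclideanSpace ℝ (Fin n)} {s t : ℝ}

theorem memLp_Icc_of_continuous {x : ℝ → EuclideanSpace ℝ (Fin n)} (hx : Continuous x) (s t : ℝ) :
    MemLp x 2 (volume.restrict (Icc s t)) := by
  obtain ⟨C, hC⟩ := (isCompact_Icc (a := s) (b := t)).exists_bound_of_continuousOn hx.continuousOn
  exact .of_bound hx.aestronglyMeasurable C ((ae_restrict_iff' measurableSet_Icc).2 (.of_forall hC))

theorem W12.exists_isRep_Icc (hst : s < t) (p : W12 n (Icc s t)) :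
    ∃ u w, IsRep p u w :=
  let ⟨u, hu⟩ := W12.exists_isRep ordConnected_Icc (by simpa using hst) p
  ⟨u, _, hu⟩

theorem IsRep.solvesOn {J : Set ℝ} (hJ : MeasurableSet J) {p : W12 n J}
    {u w : ℝ → EuclideanSpace ℝ (Fin n)} (h : IsRep p u w) (ha : MemLp a ∞ (volume.restrict J))
    (h0 : coeffOp ha p = 0) : SolvesOn a J u w := by
  refine ⟨h.isPrimitive, (ae_restrict_iff' hJ).1 ?_⟩
  have h1 := h.coeffOp_ae ha
  rw [h0] at h1
  filter_upwards [h1, Lp.coeFn_zero (EuclideanSpace ℝ (Fin n)) 2 (volume.restrict J)] with r h2 h3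
  rw [h3, Pi.zero_apply] at h2
  exact sub_eq_zero.1 h2.symm

theorem IsRep.coeffOp_eq {J : Set ℝ} {p : W12 n J}
    {u w : ℝ → EuclideanSpace ℝ (Fin n)} (h : IsRep p u w) (ha : MemLp a ∞ (volume.restrict J))
    {g : L2On n J} (h0 : ∀ᵐ t ∂volume.restrict J, w t - a t (u t) = g t) : coeffOp ha p = g :=
  Lp.ext ((h.coeffOp_ae ha).trans h0)

theorem eq_zero_of_coeffOp {J : Set ℝ} {p : W12 n J} (ha : MemLp a ∞ (volume.restrict J))
    (h : coeffOp ha p = 0) (h0 : p.1.fst = 0) : p = 0 := by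
  rw [coeffOp_apply, h0, map_zero, sub_zero] at h
  refine Subtype.ext (WithLp.ofLp_injective 2 ?_)
  exact Prod.ext h0 h

theorem IsRep.fst_eq_zero {J : Set ℝ} (hJ : MeasurableSet J) {p : W12 n J}
    {u w : ℝ → EuclideanSpace ℝ (Fin n)} (h : IsRep p u w) (h0 : ∀ t ∈ J, u t = 0) :
    p.1.fst = 0 :=
  Lp.ext (by
    filter_upwards [h.fst, Lp.coeFn_zero (EuclideanSpace ℝ (Fin n)) 2 (volume.restrict J),
      ae_restrict_mem hJ] with t h1 h2 h3
    rw [h1, h2, h0 t h3]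
    rfl)

/-- Solvability of the inhomogeneous equation on bounded intervals. -/
theorem surjective_coeffOp_Icc (ha : IsBoundedCoeff a) (s t : ℝ) :
    Function.Surjective (coeffOp (n := n) (ha.memLp (Icc s t))) := by
  intro g
  obtain ⟨C, hC⟩ := ha.bounded
  -- The shifted operator is invertible on the line. The exponential weight that undoes the shift is
  -- bounded on the interval, which is all that matters once `g` is extended by zero.
  have hb := ha.sub_smul_id (C + 1)
  obtain ⟨ι, hι⟩ := exists_extendZero n (measurableSet_Icc (a := s) (b := t))
  have hexp : Continuous fun r : ℝ => Real.exp (-((C + 1) * r)) := by fun_prop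
  obtain ⟨K, hK⟩ := (isCompact_Icc (a := s) (b := t)).exists_bound_of_continuousOn hexp.continuousOn
  have hm : MemLp (fun r => Real.exp (-((C + 1) * r)) • ι g r) 2 (volume.restrict univ) := by
    refine (Lp.memLp (ι g)).of_le_mul (c := K)
      (hexp.aestronglyMeasurable.smul (Lp.memLp (ι g)).1) ?_
    rw [ae_restrict_iff' MeasurableSet.univ]
    filter_upwards [hι g] with r hr _
    by_cases hrJ : r ∈ Icc s t
    · rw [norm_smul]
      exact mul_le_mul_of_nonneg_right (hK r hrJ) (norm_nonneg _)
    · rw [hr, indicator_of_notMem hrJ]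
      simp
  obtain ⟨q, hq⟩ := (hb.bijective_coeffOp fun r => isLyapunov_one (hC r)).2 hm.toLp
  obtain ⟨y, hy⟩ := W12.exists_isRep ordConnected_univ (by simp) q
  set w := univ.indicator q.1.snd
  have hexp' : IsPrimitive (fun r : ℝ => Real.exp ((C + 1) * r))
      fun r => Real.exp ((C + 1) * r) * (C + 1) := by
    refine .of_hasDerivAt (fun r => ?_) (by fun_prop)
    simpa using (((hasDerivAt_id r).const_mul (C + 1)).exp)
  have hx := hexp'.smul hy.isPrimitive
  have heq : ∀ᵐ r, r ∈ Icc s t → (Real.exp ((C + 1) * r) * (C + 1)) • y r +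
      Real.exp ((C + 1) * r) • w r - a r (Real.exp ((C + 1) * r) • y r) = g r := by
    have h1 := hy.coeffOp_ae (hb.memLp univ)
    rw [hq] at h1
    filter_upwards [(ae_restrict_iff' MeasurableSet.univ).1 h1,
      (ae_restrict_iff' MeasurableSet.univ).1 hm.coeFn_toLp, hι g] with r h1 h2 h3 hr
    have h4 : w r = Real.exp (-((C + 1) * r)) • g r + (a r (y r) - (C + 1) • y r) := by
      have h5 := (h1 trivial).symm.trans (h2 trivial)
      rw [h3, indicator_of_mem hr, sub_eq_iff_eq_add] at h5
      simpa using h5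
    rw [h4, map_smul, smul_add, smul_smul, ← Real.exp_add, add_neg_cancel, Real.exp_zero, one_smul,
      smul_sub, smul_smul]
    abel
  have hxm : MemLp (fun r => Real.exp ((C + 1) * r) • y r) 2 (volume.restrict (Icc s t)) :=
    memLp_Icc_of_continuous hx.continuous s t
  have hwm : MemLp (fun r => (Real.exp ((C + 1) * r) * (C + 1)) • y r +
      Real.exp ((C + 1) * r) • w r) 2 (volume.restrict (Icc s t)) := by
    refine (memLp_congr_ae ?_).2 ((Lp.memLp g).add (ha.memLp_apply hx.continuous hxm))
    rw [Filter.EventuallyEq, ae_restrict_iff' measurableSet_Icc]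
    filter_upwards [heq] with r hr hmem
    rw [Pi.add_apply, ← hr hmem]
    abel
  obtain ⟨p, hp⟩ := exists_isRep_of_isPrimitive hx hxm hwm
  exact ⟨p, hp.coeffOp_eq _ ((ae_restrict_iff' measurableSet_Icc).2 heq)⟩

end Interval

end


noncomputable section

/-! ### The operators on bounded intervals -/

section Boundary

variable {n : ℕ} {s t τ : ℝ}

theorem Submodule.finrank_prod' {𝕜 V W : Type*} [Field 𝕜] [AddCommGroup V] [Module 𝕜 V]
    [AddCommGroup W] [Module 𝕜 W] [FiniteDimensional 𝕜 V] [FiniteDimensional 𝕜 W]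
    (p : Submodule 𝕜 V) (q : Submodule 𝕜 W) :
    Module.finrank 𝕜 (p.prod q) = Module.finrank 𝕜 p + Module.finrank 𝕜 q := by
  let e : p.prod q ≃ₗ[𝕜] p × q :=
    { toFun := fun x => (⟨x.1.1, x.2.1⟩, ⟨x.1.2, x.2.2⟩)
      invFun := fun x => ⟨(x.1.1, x.2.1), x.1.2, x.2.2⟩
      map_add' := fun _ _ => rfl
      map_smul' := fun _ _ => rfl
      left_inv := fun _ => rfl
      right_inv := fun _ => rfl }
  rw [e.finrank_eq, Module.finrank_prod]

theorem ContinuousLinearMap.isFredholm_comp_subtypeL {X Y : Type*} [NormedAddCommGroup X]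
    [InnerProductSpace ℝ X] [CompleteSpace X] [NormedAddCommGroup Y] [InnerProductSpace ℝ Y]
    [CompleteSpace Y] (T : X →L[ℝ] Y) {D : Submodule ℝ X} (hD : IsClosed (D : Set X))
    (hk : FiniteDimensional ℝ (T ∘L D.subtypeL).ker)
    (hc : FiniteDimensional ℝ (Y ⧸ (T ∘L D.subtypeL).range)) : (T ∘L D.subtypeL).IsFredholm := by
  have : CompleteSpace D := hD.completeSpace_coe
  exact isFredholm_of_finiteDimensional _ hk hc

/-- `x` is projected by correcting only its boundary values: the part of `β x` outside `F l` is
lifted by `r` and subtracted. -/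
theorem exists_projection_comap {Λ X Z : Type*} [TopologicalSpace Λ] [NormedAddCommGroup X]
    [NormedSpace ℝ X] [NormedAddCommGroup Z] [NormedSpace ℝ Z] (β : X →L[ℝ] Z) (r : Z →L[ℝ] X)
    (hr : ∀ v, β (r v) = v) {F : Λ → Submodule ℝ Z} {A : Λ → Z →L[ℝ] Z} (hA : Continuous A)
    (hF : ∀ l, (∀ v, A l v ∈ F l) ∧ ∀ v ∈ F l, A l v = v) :
    ∃ P : Λ → X →L[ℝ] X, Continuous P ∧ ∀ l, (∀ x, P l x ∈ (F l).comap (β : X →ₗ[ℝ] Z)) ∧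
      ∀ x ∈ (F l).comap (β : X →ₗ[ℝ] Z), P l x = x := by
  refine ⟨fun l => ContinuousLinearMap.id ℝ _ - r ∘L (ContinuousLinearMap.id ℝ _ - A l) ∘L β,
    continuous_const.sub (continuous_const.clm_comp ((continuous_const.sub hA).clm_comp
      continuous_const)), fun l => ⟨fun x => ?_, fun x hx => ?_⟩⟩
  · change β (x - r (β x - A l (β x))) ∈ F l
    rw [map_sub, hr, sub_sub_cancel]
    exact (hF l).1 _
  · change x - r (β x - A l (β x)) = x
    have h1 : A l (β x) = β x := (hF l).2 _ hx
    rw [h1, sub_self, map_zero, sub_zero]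

theorem exists_boundary (n : ℕ) (hst : s < t) :
    ∃ β : W12 n (Icc s t) →L[ℝ] EuclideanSpace ℝ (Fin n) × EuclideanSpace ℝ (Fin n),
      (∀ p u w, IsRep p u w → β p = (u s, u t)) ∧
      ∃ r : EuclideanSpace ℝ (Fin n) × EuclideanSpace ℝ (Fin n) →L[ℝ] W12 n (Icc s t),
        ∀ v, β (r v) = v := by
  obtain ⟨e₁, h₁⟩ := exists_evaluation (n := n) (J := Icc s t) hst.ne'
    (by rw [uIcc_of_ge hst.le])
  obtain ⟨e₂, h₂⟩ := exists_evaluation (n := n) (J := Icc s t) hst.ne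
    (by rw [uIcc_of_le hst.le])
  have hβ : ∀ p u w, IsRep p u w → (e₁.prod e₂) p = (u s, u t) := fun p u w h => by
    rw [ContinuousLinearMap.prod_apply, h₁ p u w h, h₂ p u w h]
  have hsurj : Function.Surjective (e₁.prod e₂) := by
    rintro ⟨v, v'⟩
    have hd : ∀ r, HasDerivAt (fun r : ℝ => v + ((r - s) / (t - s)) • (v' - v))
        ((1 / (t - s)) • (v' - v)) r := fun r =>
      ((((hasDerivAt_id r).sub_const s).div_const (t - s)).smul_const (v' - v)).const_add v
    have hp := IsPrimitive.of_hasDerivAt hd continuous_const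
    obtain ⟨p, hp⟩ := exists_isRep_of_isPrimitive hp (memLp_Icc_of_continuous hp.continuous s t)
      (memLp_Icc_of_continuous continuous_const s t)
    refine ⟨p, ?_⟩
    rw [hβ p _ _ hp]
    simp [div_self (sub_ne_zero.2 hst.ne')]
  obtain ⟨r, hr⟩ := LinearMap.exists_rightInverse_of_surjective
    (e₁.prod e₂ : W12 n (Icc s t) →ₗ[ℝ] EuclideanSpace ℝ (Fin n) × EuclideanSpace ℝ (Fin n))
    (LinearMap.range_eq_top.2 hsurj)
  exact ⟨e₁.prod e₂, hβ, LinearMap.toContinuousLinearMap r, fun v => LinearMap.congr_fun hr v⟩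

theorem boundaryDomain_eq (hτ : 0 < τ)
    {β : W12 n (Icc (-τ) τ) →L[ℝ] EuclideanSpace ℝ (Fin n) × EuclideanSpace ℝ (Fin n)}
    (hβ : ∀ p u w, IsRep p u w → β p = (u (-τ), u τ)) (M : ℝ → Matrix (Fin n) (Fin n) ℝ) :
    boundaryDomain M τ = ((unstableSpace M (-τ)).prod (stableSpace M τ)).comap
      (β : W12 n (Icc (-τ) τ) →ₗ[ℝ] _) := by
  ext p
  obtain ⟨u, w, hu⟩ := W12.exists_isRep_Icc (by linarith) p
  rw [Submodule.mem_comap]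
  change _ ↔ β p ∈ _
  rw [hβ p u w hu, Submodule.mem_prod]
  constructor
  · rintro ⟨f, hf, hpf, h1, h2⟩
    have heq := Measure.eqOn_Icc_of_ae_eq volume (by linarith : -τ ≠ τ) (hu.fst.symm.trans hpf)
      hu.isPrimitive.continuous.continuousOn hf
    rw [heq ⟨le_rfl, by linarith⟩, heq ⟨by linarith, le_rfl⟩]
    exact ⟨h1, h2⟩
  · rintro ⟨h1, h2⟩
    exact ⟨u, hu.isPrimitive.continuous.continuousOn, hu.fst, h1, h2⟩

theorem isClosed_boundaryDomain (hτ : 0 < τ) (M : ℝ → Matrix (Fin n) (Fin n) ℝ) :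
    IsClosed (boundaryDomain M τ : Set (W12 n (Icc (-τ) τ))) := by
  obtain ⟨β, hβ, -⟩ := exists_boundary n (by linarith : -τ < τ)
  rw [boundaryDomain_eq hτ hβ]
  exact (Submodule.closed_of_finiteDimensional
    ((unstableSpace M (-τ)).prod (stableSpace M τ))).preimage β.continuous

theorem mem_boundaryDomain_iff (hτ : 0 < τ) {p : W12 n (Icc (-τ) τ)}
    {u w : ℝ → EuclideanSpace ℝ (Fin n)} (hu : IsRep p u w) (M : ℝ → Matrix (Fin n) (Fin n) ℝ) :
    p ∈ boundaryDomain M τ ↔ u (-τ) ∈ unstableSpace M (-τ) ∧ u τ ∈ stableSpace M τ := by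
  obtain ⟨β, hβ, -⟩ := exists_boundary n (by linarith : -τ < τ)
  rw [boundaryDomain_eq hτ hβ, Submodule.mem_comap]
  change β p ∈ _ ↔ _
  rw [hβ p u w hu, Submodule.mem_prod]

/-- Evaluation at `s` identifies the solutions with `ℝⁿ`, by uniqueness and global existence. -/
theorem finrank_ker_coeffOp {a : ℝ → EuclideanSpace ℝ (Fin n) →L[ℝ] EuclideanSpace ℝ (Fin n)}
    (ha : IsBoundedCoeff a) (hst : s < t) :
    FiniteDimensional ℝ (coeffOp (ha.memLp (Icc s t)) : W12 n (Icc s t) →ₗ[ℝ] L2On n (Icc s t)).ker ∧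
      Module.finrank ℝ (coeffOp (ha.memLp (Icc s t)) : W12 n (Icc s t) →ₗ[ℝ] L2On n (Icc s t)).ker = n := by
  obtain ⟨β, hβ, -⟩ := exists_boundary n hst
  let e : (coeffOp (ha.memLp (Icc s t)) : W12 n (Icc s t) →ₗ[ℝ] L2On n (Icc s t)).ker →ₗ[ℝ]
      EuclideanSpace ℝ (Fin n) :=
    LinearMap.fst ℝ _ _ ∘ₗ (β : W12 n (Icc s t) →ₗ[ℝ]
      EuclideanSpace ℝ (Fin n) × EuclideanSpace ℝ (Fin n)) ∘ₗ Submodule.subtype _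
  have he : Function.Bijective e := by
    refine ⟨(injective_iff_map_eq_zero e).2 fun p hp => ?_, fun v => ?_⟩
    · obtain ⟨u, w, hu⟩ := W12.exists_isRep_Icc hst p.1
      have h1 : coeffOp (ha.memLp (Icc s t)) p.1 = 0 := p.2
      have h2 := hu.solvesOn measurableSet_Icc (ha.memLp _) h1
      have h3 : u s = 0 := by
        have : (β p.1).1 = 0 := hp
        rwa [hβ p.1 u w hu] at this
      exact Subtype.ext (eq_zero_of_coeffOp (ha.memLp _) h1 (hu.fst_eq_zero measurableSet_Icc
        fun r hr => h2.eq_zero ha ordConnected_Icc (left_mem_Icc.2 hst.le) hr h3))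
    · obtain ⟨u, w, hu, huv⟩ := ha.exists_solvesOn_univ s v
      have hm := memLp_Icc_of_continuous hu.continuous s t
      obtain ⟨p, hp⟩ := exists_isRep_of_isPrimitive hu.isPrimitive hm
        ((hu.mono (subset_univ _)).memLp_deriv ha measurableSet_Icc hm)
      refine ⟨⟨p, ?_⟩, ?_⟩
      · change coeffOp (ha.memLp (Icc s t)) p = 0
        refine hp.coeffOp_eq _ ?_
        filter_upwards [ae_restrict_of_ae hu.ae,
          Lp.coeFn_zero (EuclideanSpace ℝ (Fin n)) 2 (volume.restrict (Icc s t))] with r h1 h2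
        rw [h2, h1 trivial, sub_self]
        rfl
      · change (β p).1 = v
        rw [hβ p _ _ hp, huv]
  let E := LinearEquiv.ofBijective e he
  exact ⟨E.symm.finiteDimensional, by rw [E.finrank_eq, finrank_euclideanSpace_fin]⟩

variable {S : I → ℝ → Matrix (Fin n) (Fin n) ℝ} {Sp Sm : I → Matrix (Fin n) (Fin n) ℝ}

namespace AsympHyperbolic

theorem index_boundary (hS : AsympHyperbolic S Sp Sm) (hτ : 0 < τ) {l : I}
    (hdim : Module.finrank ℝ (unstableSpace (S l) (-τ)) +
      Module.finrank ℝ (stableSpace (S l) τ) = n) :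
    FiniteDimensional ℝ
      (diffOp hS (Icc (-τ) τ) l ∘L (boundaryDomain (S l) τ).subtypeL).ker ∧
    FiniteDimensional ℝ (L2On n (Icc (-τ) τ) ⧸
      (diffOp hS (Icc (-τ) τ) l ∘L (boundaryDomain (S l) τ).subtypeL).range) ∧
    Module.finrank ℝ (diffOp hS (Icc (-τ) τ) l ∘L (boundaryDomain (S l) τ).subtypeL).ker =
      Module.finrank ℝ (L2On n (Icc (-τ) τ) ⧸
        (diffOp hS (Icc (-τ) τ) l ∘L (boundaryDomain (S l) τ).subtypeL).range) := by
  have hst : -τ < τ := by linarith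
  obtain ⟨β, hβ, r, hr⟩ := exists_boundary n hst
  obtain ⟨hfin, hn⟩ := finrank_ker_coeffOp (hS.isBoundedCoeff l) hst
  have h := LinearMap.index_restrict_comap (surjective_coeffOp_Icc (hS.isBoundedCoeff l) (-τ) τ)
    (β := (β : W12 n (Icc (-τ) τ) →ₗ[ℝ] _)) (fun v => ⟨r v, hr v⟩)
    ((unstableSpace (S l) (-τ)).prod (stableSpace (S l) τ)) (by
      rw [hn, Submodule.finrank_prod', hdim, Module.finrank_prod, finrank_euclideanSpace_fin])
  rw [← boundaryDomain_eq hτ hβ] at h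
  exact h

theorem injective_boundary (hS : AsympHyperbolic S Sp Sm) (hτ : 0 < τ) {l : I}
    (h0 : OnlyTrivialSolution (S l)) :
    Function.Injective (diffOp hS (Icc (-τ) τ) l ∘L (boundaryDomain (S l) τ).subtypeL) := by
  have ha := hS.isBoundedCoeff l
  refine (injective_iff_map_eq_zero _).2 fun p hp => Subtype.ext ?_
  have hp' : coeffOp (ha.memLp (Icc (-τ) τ)) p.1 = 0 := hp
  obtain ⟨u, w, hu⟩ := W12.exists_isRep_Icc (by linarith) p.1
  have h1 := hu.solvesOn measurableSet_Icc (ha.memLp _) hp'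
  obtain ⟨⟨y, hy, hy1, hy2⟩, z, hz, hz1, hz2⟩ := (mem_boundaryDomain_iff hτ hu (S l)).1 p.2
  have hyu : EqOn y u (Icc (-τ) τ) := ((hy.solvesOn ha.continuous).mono (subset_univ _)).eqOn h1 ha
    ordConnected_Icc (left_mem_Icc.2 (by linarith)) hy1
  -- `y` decays at `-∞`, `z` at `+∞`, and both extend `u`; being one solution, they decay at both
  -- ends.
  have hyz : EqOn y z univ := (hy.solvesOn ha.continuous).eqOn (hz.solvesOn ha.continuous) ha
    ordConnected_univ (mem_univ τ) (by rw [hyu (right_mem_Icc.2 (by linarith)), hz1])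
  have hyz' : z = y := funext fun t => (hyz (mem_univ t)).symm
  have hy0 := h0 y hy (hyz' ▸ hz2) hy2
  refine eq_zero_of_coeffOp (ha.memLp _) hp' (hu.fst_eq_zero measurableSet_Icc fun t ht => ?_)
  rw [← hyu ht, hy0]
  rfl

theorem bijective_boundary (hS : AsympHyperbolic S Sp Sm) (hτ : 0 < τ) {l : I}
    (hdim : Module.finrank ℝ (unstableSpace (S l) (-τ)) +
      Module.finrank ℝ (stableSpace (S l) τ) = n) (h0 : OnlyTrivialSolution (S l)) :
    Function.Bijective (diffOp hS (Icc (-τ) τ) l ∘L (boundaryDomain (S l) τ).subtypeL) := by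
  obtain ⟨-, h2, h3⟩ := hS.index_boundary hτ hdim
  have hinj := hS.injective_boundary hτ h0
  refine ⟨hinj, LinearMap.range_eq_top.1 ?_⟩
  have h4 : (diffOp hS (Icc (-τ) τ) l ∘L (boundaryDomain (S l) τ).subtypeL).ker = ⊥ :=
    LinearMap.ker_eq_bot.2 hinj
  rw [h4, finrank_bot] at h3
  exact Submodule.Quotient.subsingleton_iff.1 (Module.finrank_zero_iff.1 h3.symm)

theorem continuous_diffOp (hS : AsympHyperbolic S Sp Sm) (J : Set ℝ) : Continuous (diffOp hS J) :=
  continuous_coeffOp (fun l => hS.memLp l J) hS.tendstoUniformly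

theorem continuous_boundaryDomain (hS : AsympHyperbolic S Sp Sm) (hτ : 0 < τ)
    (hp : ∀ l, ∃ H c, ∀ t, τ ≤ t → IsLyapunov H c (coeff (S l) t))
    (hm : ∀ l, ∃ H c, ∀ t, t ≤ -τ → IsLyapunov H c (coeff (S l) t)) :
    ∃ P : I → W12 n (Icc (-τ) τ) →L[ℝ] W12 n (Icc (-τ) τ), Continuous P ∧
      ∀ l, (∀ x, P l x ∈ boundaryDomain (S l) τ) ∧ ∀ x ∈ boundaryDomain (S l) τ, P l x = x := by
  obtain ⟨β, hβ, r, hr⟩ := exists_boundary n (by linarith : -τ < τ)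
  obtain ⟨p, hpc, hp⟩ := hS.exists_stable_projection hp
  obtain ⟨q, hqc, hq⟩ := hS.exists_unstable_projection hm
  simp only [boundaryDomain_eq hτ hβ]
  refine exists_projection_comap β r hr
    (A := fun l => ContinuousLinearMap.inl ℝ _ _ ∘L q l ∘L ContinuousLinearMap.fst ℝ _ _ +
      ContinuousLinearMap.inr ℝ _ _ ∘L p l ∘L ContinuousLinearMap.snd ℝ _ _)
    ((continuous_const.clm_comp (hqc.clm_comp continuous_const)).add
      (continuous_const.clm_comp (hpc.clm_comp continuous_const))) fun l => ⟨fun v => ?_,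
        fun v hv => ?_⟩
  · simpa using ⟨(hq l).1 _, (hp l).1 _⟩
  · simp [(hq l).2 _ hv.1, (hp l).2 _ hv.2]

theorem isFredholmPath_boundary (hS : AsympHyperbolic S Sp Sm) (hτ : 0 < τ)
    (hp : ∀ l, ∃ H c, ∀ t, τ ≤ t → IsLyapunov H c (coeff (S l) t))
    (hm : ∀ l, ∃ H c, ∀ t, t ≤ -τ → IsLyapunov H c (coeff (S l) t))
    (hdim : ∀ l, Module.finrank ℝ (unstableSpace (S l) (-τ)) +
      Module.finrank ℝ (stableSpace (S l) τ) = n)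
    (h0 : OnlyTrivialSolution (S 0)) (h1 : OnlyTrivialSolution (S 1)) :
    IsFredholmPath (fun l => boundaryDomain (S l) τ) (diffOp hS (Icc (-τ) τ)) where
  continuous := hS.continuous_diffOp _
  continuous_domain := hS.continuous_boundaryDomain hτ hp hm
  fredholm l := by
    obtain ⟨h2, h3, -⟩ := hS.index_boundary hτ (hdim l)
    exact (diffOp hS (Icc (-τ) τ) l).isFredholm_comp_subtypeL
      (isClosed_boundaryDomain hτ (S l)) h2 h3
  index_zero l := (hS.index_boundary hτ (hdim l)).2.2
  invertible_zero := hS.bijective_boundary hτ (hdim 0) h0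
  invertible_one := hS.bijective_boundary hτ (hdim 1) h1

end AsympHyperbolic

end Boundary

end


noncomputable section

/-! ### Reduction from the line to a bounded interval -/

section LineReduction

variable {n : ℕ}

theorem ae_restrict_univ_iff {P : ℝ → Prop} :
    (∀ᵐ t ∂(volume.restrict univ), P t) ↔ ∀ᵐ t, P t := by rw [Measure.restrict_univ]

theorem IsRep.ext {J : Set ℝ} {p q : W12 n J} {u w u' w' : ℝ → EuclideanSpace ℝ (Fin n)}
    (h : IsRep p u w) (h' : IsRep q u' w') (hu : u =ᵐ[volume.restrict J] u')
    (hw : w =ᵐ[volume.restrict J] w') : p = q := by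
  refine Subtype.ext (WithLp.ofLp_injective 2 (Prod.ext ?_ ?_))
  · exact Lp.ext (h.fst.trans (hu.trans h'.fst.symm))
  · exact Lp.ext (h.snd.trans (hw.trans h'.snd.symm))

theorem memLp_glue {E : Type*} [NormedAddCommGroup E] {f g h : ℝ → E} {s t : ℝ}
    (hf : MemLp f 2 (volume.restrict (Iio s))) (hg : MemLp g 2 (volume.restrict (Icc s t)))
    (hh : MemLp h 2 (volume.restrict (Ioi t))) :
    MemLp (fun r => if r ≤ s then f r else if r ≤ t then g r else h r) 2
      (volume.restrict univ) := by
  rw [Measure.restrict_univ]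
  rw [Measure.restrict_congr_set Iio_ae_eq_Iic] at hf
  have hi : MemLp ((Iic t).piecewise g h) 2 (volume.restrict (Iic s)ᶜ) := by
    refine MemLp.piecewise measurableSet_Iic ?_ ?_
    · rw [Measure.restrict_restrict measurableSet_Iic]
      exact hg.mono_measure (Measure.restrict_mono (fun r (hr : r ∈ Iic t ∩ (Iic s)ᶜ) =>
        show r ∈ Icc s t from ⟨(lt_of_not_ge fun h : r ≤ s => hr.2 h).le, hr.1⟩) le_rfl)
    · rw [Measure.restrict_restrict measurableSet_Iic.compl]
      exact hh.mono_measure (Measure.restrict_mono (fun r (hr : r ∈ (Iic t)ᶜ ∩ (Iic s)ᶜ) =>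
        show t < r from lt_of_not_ge fun h : r ≤ t => hr.1 h) le_rfl)
  refine (MemLp.piecewise measurableSet_Iic hf hi).ae_eq (.of_forall fun r => ?_)
  by_cases h1 : r ≤ s <;> by_cases h2 : r ≤ t <;> simp [Set.piecewise, h1, h2]

theorem ae_ne (s : ℝ) : ∀ᵐ t : ℝ, t ≠ s :=
  compl_mem_ae_iff.2 (measure_singleton s)

/-- A piecewise linear function that decreases from `1` to `0` between `s` and `t`. -/
theorem exists_cutoff {s t : ℝ} (hst : s < t) : ∃ χ χ' : ℝ → ℝ, IsPrimitive χ χ' ∧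
    Measurable χ' ∧ (∃ C, ∀ r, ‖χ r‖ ≤ C) ∧ (∃ C, ∀ r, ‖χ' r‖ ≤ C) ∧
    (∀ r < s, χ r = 1 ∧ χ' r = 0) ∧ ∀ r, t < r → χ r = 0 ∧ χ' r = 0 := by
  have hts : 0 < t - s := sub_pos.2 hst
  have h1 : IsPrimitive (fun _ : ℝ => (1 : ℝ)) fun _ => 0 :=
    .of_hasDerivAt (fun r => hasDerivAt_const r 1) continuous_const
  have h2 : IsPrimitive (fun r : ℝ => (t - r) / (t - s)) fun _ => (-1) / (t - s) :=
    .of_hasDerivAt (fun r => ((hasDerivAt_id r).const_sub t).div_const (t - s)) continuous_const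
  have h3 : IsPrimitive (fun _ : ℝ => (0 : ℝ)) fun _ => 0 :=
    .of_hasDerivAt (fun r => hasDerivAt_const r 0) continuous_const
  have h4 := h1.ite (h2.ite h3 (c := t) (by simp)) (c := s) (by simp [hst.le, div_self hts.ne'])
  refine ⟨_, _, h4, ?_, ⟨1, fun r => ?_⟩, ⟨|(-1) / (t - s)|, fun r => ?_⟩, fun r hr => ?_,
    fun r hr => ?_⟩
  · exact Measurable.ite measurableSet_Iic measurable_const
      (Measurable.ite measurableSet_Iic measurable_const measurable_const)
  · split_ifs with h5 h6
    · simp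
    · rw [Real.norm_of_nonneg (div_nonneg (by linarith) hts.le), div_le_one hts]
      linarith [not_le.1 h5]
    · simp
  · split_ifs <;> simp [abs_nonneg, abs_div]
  · simp [hr.le]
  · simp [(hst.trans hr).not_ge, hr.not_ge]

theorem exists_extendZero_eq {J : Set ℝ} {ι : L2On n J →ₗ[ℝ] L2On n univ}
    (hJ : MeasurableSet J) (hι : ∀ y, ∀ᵐ t, ι y t = J.indicator y t) {g : L2On n univ}
    (hg : ∀ᵐ t, t ∉ J → g t = 0) : ∃ y, ι y = g := by
  obtain ⟨r, hr⟩ := exists_restrict_L2 n J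
  refine ⟨r g, Lp.ext (ae_restrict_univ_iff.2 ?_)⟩
  filter_upwards [hι (r g), hg, (ae_restrict_iff' hJ).1 (hr g)] with t h1 h2 h3
  rw [h1]
  by_cases ht : t ∈ J
  · rw [indicator_of_mem ht, h3 ht]
  · rw [indicator_of_notMem ht, h2 ht]

variable {S : I → ℝ → Matrix (Fin n) (Fin n) ℝ} {Sp Sm : I → Matrix (Fin n) (Fin n) ℝ} {τ : ℝ}
  {R : W12 n univ →L[ℝ] W12 n (Icc (-τ) τ)} {ι : L2On n (Icc (-τ) τ) →ₗ[ℝ] L2On n univ}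

namespace AsympHyperbolic

theorem reduction_restrict (hS : AsympHyperbolic S Sp Sm) (hτ : 0 < τ) {l : I}
    (hp : ∃ H c, ∀ t, τ ≤ t → IsLyapunov H c (coeff (S l) t))
    (hm : ∃ H c, ∀ t, t ≤ -τ → IsLyapunov H c (coeff (S l) t))
    (hR : ∀ p u w, IsRep p u w → IsRep (R p) u w)
    (hι : ∀ y, ∀ᵐ t, ι y t = (Icc (-τ) τ).indicator y t) {x : W12 n univ}
    {y : L2On n (Icc (-τ) τ)} (hxy : diffOp hS univ l x = ι y) :
    R x ∈ boundaryDomain (S l) τ ∧ diffOp hS (Icc (-τ) τ) l (R x) = y := by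
  obtain ⟨H, c, hp⟩ := hp
  obtain ⟨H', c', hm⟩ := hm
  have ha := hS.isBoundedCoeff l
  obtain ⟨u, hu⟩ := W12.exists_isRep ordConnected_univ (by simp) x
  set w := univ.indicator x.1.snd
  have hm2 : MemLp u 2 volume := by simpa using hu.memLp_fst
  have h1 : ∀ᵐ t, w t - coeff (S l) t (u t) = (Icc (-τ) τ).indicator y t := by
    have h2 := ae_restrict_univ_iff.1 (hu.coeffOp_ae (hS.memLp l univ))
    change coeffOp (hS.memLp l univ) x = ι y at hxy
    rw [hxy] at h2
    filter_upwards [h2, hι y] with t h2 h3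
    exact h2.symm.trans h3
  refine ⟨(mem_boundaryDomain_iff hτ (hR x u w hu) (S l)).2 ⟨?_, ?_⟩,
    (hR x u w hu).coeffOp_eq (hS.memLp l _) ?_⟩
  · refine (mem_unstableSpace_iff ha fun t ht => hm t (le_of_lt ht)).2
      ⟨u, w, ⟨hu.isPrimitive, ?_⟩, hm2.restrict _, rfl⟩
    filter_upwards [h1] with t ht hmem
    rw [indicator_of_notMem (fun h => (h.1.trans_lt hmem).false)] at ht
    exact sub_eq_zero.1 ht
  · refine (mem_stableSpace_iff ha fun t ht => hp t (le_of_lt ht)).2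
      ⟨u, w, ⟨hu.isPrimitive, ?_⟩, hm2.restrict _, rfl⟩
    filter_upwards [h1] with t ht hmem
    rw [indicator_of_notMem (fun h => (h.2.trans_lt hmem).false)] at ht
    exact sub_eq_zero.1 ht
  · refine (ae_restrict_iff' measurableSet_Icc).2 ?_
    filter_upwards [h1] with t ht hmem
    rwa [indicator_of_mem hmem] at ht

/-- The boundary conditions provide square-integrable solutions on both outer half-lines with
matching values, and gluing them to `x'` adds nothing to the right-hand side outside the interval.
-/
theorem reduction_lift (hS : AsympHyperbolic S Sp Sm) (hτ : 0 < τ) {l : I}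
    (hp : ∃ H c, ∀ t, τ ≤ t → IsLyapunov H c (coeff (S l) t))
    (hm : ∃ H c, ∀ t, t ≤ -τ → IsLyapunov H c (coeff (S l) t))
    (hR : ∀ p u w, IsRep p u w → IsRep (R p) u w)
    (hι : ∀ y, ∀ᵐ t, ι y t = (Icc (-τ) τ).indicator y t) {x' : W12 n (Icc (-τ) τ)}
    (hx' : x' ∈ boundaryDomain (S l) τ) :
    ∃ x, R x = x' ∧ diffOp hS univ l x = ι (diffOp hS (Icc (-τ) τ) l x') := by
  obtain ⟨H, c, hp⟩ := hp
  obtain ⟨H', c', hm⟩ := hm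
  have ha := hS.isBoundedCoeff l
  have hlt : -τ < τ := by linarith
  obtain ⟨u, w, hu⟩ := W12.exists_isRep_Icc hlt x'
  obtain ⟨h1, h2⟩ := (mem_boundaryDomain_iff hτ hu (S l)).1 hx'
  obtain ⟨z, wz, hz, hzm, hzu⟩ := (mem_unstableSpace_iff ha fun t ht => hm t (le_of_lt ht)).1 h1
  obtain ⟨y, wy, hy, hym, hyu⟩ := (mem_stableSpace_iff ha fun t ht => hp t (le_of_lt ht)).1 h2
  have hglue := hz.isPrimitive.ite (hu.isPrimitive.ite hy.isPrimitive (c := τ) hyu.symm) (c := -τ)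
    (by simp [hlt.le, hzu])
  obtain ⟨x, hx⟩ := exists_isRep_of_isPrimitive (J := univ) hglue
    (memLp_glue hzm hu.memLp_fst hym)
    (memLp_glue (hz.memLp_deriv ha measurableSet_Iio hzm) hu.memLp_snd
      (hy.memLp_deriv ha measurableSet_Ioi hym))
  refine ⟨x, (hR _ _ _ hx).ext hu ?_ ?_, hx.coeffOp_eq (hS.memLp l univ)
    (ae_restrict_univ_iff.2 ?_)⟩
  · refine (ae_restrict_iff' measurableSet_Icc).2 ?_
    filter_upwards [ae_ne (-τ)] with t ht hmem
    rw [if_neg (not_le.2 (lt_of_le_of_ne hmem.1 ht.symm)), if_pos hmem.2]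
  · refine (ae_restrict_iff' measurableSet_Icc).2 ?_
    filter_upwards [ae_ne (-τ)] with t ht hmem
    rw [if_neg (not_le.2 (lt_of_le_of_ne hmem.1 ht.symm)), if_pos hmem.2]
  · filter_upwards [hι (diffOp hS (Icc (-τ) τ) l x'), ae_ne (-τ), hz.ae, hy.ae,
      (ae_restrict_iff' measurableSet_Icc).1 (hu.coeffOp_ae (hS.memLp l (Icc (-τ) τ)))]
      with t h3 h4 h5 h6 h7
    rw [h3]
    rcases lt_or_gt_of_ne h4 with h8 | h8
    · rw [if_pos h8.le, if_pos h8.le, indicator_of_notMem (fun h => (h.1.trans_lt h8).false)]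
      exact sub_eq_zero.2 (h5 h8)
    · rw [if_neg h8.not_ge, if_neg h8.not_ge]
      by_cases h9 : t ≤ τ
      · have h10 : t ∈ Icc (-τ) τ := ⟨h8.le, h9⟩
        rw [if_pos h9, if_pos h9, indicator_of_mem h10]
        exact (h7 h10).symm
      · rw [if_neg h9, if_neg h9, indicator_of_notMem (fun h => h9 h.2)]
        exact sub_eq_zero.2 (h6 (not_le.1 h9))

theorem reduction_eq_zero (hS : AsympHyperbolic S Sp Sm) (hτ : 0 < τ) {l : I}
    (hR : ∀ p u w, IsRep p u w → IsRep (R p) u w) {x : W12 n univ}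
    (hx : diffOp hS univ l x = 0) (hRx : R x = 0) : x = 0 := by
  have ha := hS.isBoundedCoeff l
  obtain ⟨u, hu⟩ := W12.exists_isRep ordConnected_univ (by simp) x
  have h1 := hR _ _ _ hu
  rw [hRx] at h1
  have h2 : u =ᵐ[volume.restrict (Icc (-τ) τ)] 0 :=
    h1.fst.symm.trans (Lp.coeFn_zero (EuclideanSpace ℝ (Fin n)) 2 _)
  have h3 := Measure.eqOn_Icc_of_ae_eq volume (by linarith : -τ ≠ τ) h2
    hu.isPrimitive.continuous.continuousOn continuousOn_const
  have h4 := hu.solvesOn MeasurableSet.univ (hS.memLp l univ) hx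
  exact eq_zero_of_coeffOp (hS.memLp l univ) hx (hu.fst_eq_zero MeasurableSet.univ fun t ht =>
    h4.eq_zero ha ordConnected_univ (mem_univ τ) ht (h3 ⟨by linarith, le_rfl⟩))

/-- The equation with right-hand side `g` is solved on the line by `u` with coefficients clipped for
the right tail and by `v` with coefficients clipped for the left tail. A cutoff interpolates from
`v` to `u` inside `[-τ,τ]`, so the error is supported there and lies in the range of `ι`. -/
theorem reduction_transverse (hS : AsympHyperbolic S Sp Sm) (hτ : 0 < τ) {l : I}
    (hp : ∃ H c, ∀ t, τ ≤ t → IsLyapunov H c (coeff (S l) t))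
    (hm : ∃ H c, ∀ t, t ≤ -τ → IsLyapunov H c (coeff (S l) t))
    (hι : ∀ y, ∀ᵐ t, ι y t = (Icc (-τ) τ).indicator y t) (g : L2On n univ) :
    ∃ x y, g = diffOp hS univ l x + ι y := by
  obtain ⟨H, c, hp⟩ := hp
  obtain ⟨H', c', hm⟩ := hm
  have hp' := hS.isLyapunovSystem_max hp
  have hm' := hS.isLyapunovSystem_min hm
  obtain ⟨q, hq⟩ := (hp'.isBoundedCoeff.bijective_coeffOp hp'.lyapunov).2 g
  obtain ⟨r, hr⟩ := (hm'.isBoundedCoeff.bijective_coeffOp hm'.lyapunov).2 g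
  obtain ⟨u, hu⟩ := W12.exists_isRep ordConnected_univ (by simp) q
  obtain ⟨v, hv⟩ := W12.exists_isRep ordConnected_univ (by simp) r
  set wu := univ.indicator q.1.snd
  set wv := univ.indicator r.1.snd
  obtain ⟨χ, χ', hχ, hχm, ⟨C, hC⟩, ⟨C', hC'⟩, hχ1, hχ0⟩ := exists_cutoff (by linarith : -τ < τ)
  have hx := hu.isPrimitive.add (hχ.smul (hv.isPrimitive.sub hu.isPrimitive))
  have hb : ∀ {ψ : ℝ → ℝ} {f : ℝ → EuclideanSpace ℝ (Fin n)} {K : ℝ},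
      AEStronglyMeasurable ψ (volume.restrict univ) → (∀ s, ‖ψ s‖ ≤ K) →
      MemLp f 2 (volume.restrict univ) → MemLp (fun s => ψ s • f s) 2 (volume.restrict univ) :=
    fun hψ hK hf => hf.of_le_mul (hψ.smul hf.1) (.of_forall fun s => by
      rw [norm_smul]
      exact mul_le_mul_of_nonneg_right (hK s) (norm_nonneg _))
  have hd := hv.memLp_fst.sub hu.memLp_fst
  obtain ⟨x, hx⟩ := exists_isRep_of_isPrimitive (J := univ) hx
    (hu.memLp_fst.add (hb hχ.continuous.aestronglyMeasurable hC hd))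
    (hu.memLp_snd.add ((hb hχm.aestronglyMeasurable hC' hd).add
      (hb hχ.continuous.aestronglyMeasurable hC (hv.memLp_snd.sub hu.memLp_snd))))
  have h1 := ae_restrict_univ_iff.1 (hu.coeffOp_ae (hp'.isBoundedCoeff.memLp univ))
  have h2 := ae_restrict_univ_iff.1 (hv.coeffOp_ae (hm'.isBoundedCoeff.memLp univ))
  rw [hq] at h1
  rw [hr] at h2
  have h3 := ae_restrict_univ_iff.1 (hx.coeffOp_ae (hS.memLp l univ))
  obtain ⟨y, hy⟩ := exists_extendZero_eq (g := g - diffOp hS univ l x) measurableSet_Icc hι (by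
    filter_upwards [h1, h2, h3, ae_restrict_univ_iff.1 (Lp.coeFn_sub g (diffOp hS univ l x))]
      with t h1 h2 h3 h4 ht
    rw [h4, Pi.sub_apply]
    change g t - coeffOp (hS.memLp l univ) x t = 0
    rw [h3]
    rcases lt_or_ge t (-τ) with h5 | h5
    · rw [(hχ1 t h5).1, (hχ1 t h5).2, h2]
      dsimp only [coeff]
      rw [min_eq_left h5.le]
      simp
    · have h6 : τ < t := not_le.1 fun h => ht ⟨h5, h⟩
      rw [(hχ0 t h6).1, (hχ0 t h6).2, h1]
      dsimp only [coeff]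
      rw [max_eq_left h6.le]
      simp)
  exact ⟨x, y, by rw [hy]; abel⟩

theorem isReduction (hS : AsympHyperbolic S Sp Sm) (hτ : 0 < τ)
    (hp : ∀ l, ∃ H c, ∀ t, τ ≤ t → IsLyapunov H c (coeff (S l) t))
    (hm : ∀ l, ∃ H c, ∀ t, t ≤ -τ → IsLyapunov H c (coeff (S l) t))
    (hR : ∀ p u w, IsRep p u w → IsRep (R p) u w)
    (hι : ∀ y, ∀ᵐ t, ι y t = (Icc (-τ) τ).indicator y t) :
    IsReduction (fun _ => ⊤) (diffOp hS univ) (fun l => boundaryDomain (S l) τ)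
      (diffOp hS (Icc (-τ) τ)) R ι where
  injective := by
    refine (injective_iff_map_eq_zero ι).2 fun y hy => Lp.ext ?_
    refine (ae_restrict_iff' measurableSet_Icc).2 ?_
    have h1 := hι y
    rw [hy] at h1
    filter_upwards [h1, ae_restrict_univ_iff.1 (Lp.coeFn_zero (EuclideanSpace ℝ (Fin n)) 2 _),
      (ae_restrict_iff' measurableSet_Icc).1 (Lp.coeFn_zero (EuclideanSpace ℝ (Fin n)) 2 _)]
      with t h1 h2 h3 ht
    rw [h3 ht, ← indicator_of_mem ht y, ← h1, h2]
  restrict l _ _ _ h := hS.reduction_restrict hτ (hp l) (hm l) hR hι h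
  lift l _ hx' :=
    let ⟨x, h⟩ := hS.reduction_lift hτ (hp l) (hm l) hR hι hx'
    ⟨x, trivial, h⟩
  eq_zero l x _ y h hRx := by
    have h1 := (hS.reduction_restrict hτ (hp l) (hm l) hR hι h).2
    rw [hRx, map_zero] at h1
    rw [← h1, map_zero] at h
    exact hS.reduction_eq_zero hτ hR h hRx
  transverse l g :=
    let ⟨x, y, h⟩ := hS.reduction_transverse hτ (hp l) (hm l) hι g
    ⟨x, trivial, y, h⟩

end AsympHyperbolic

end LineReduction

end

/-! ### Comparison of the two parities. -/

theorem proposition3p3 (n k : ℕ) (S : unitInterval → ℝ → Matrix (Fin n) (Fin n) ℝ)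
    (Sp Sm : unitInterval → Matrix (Fin n) (Fin n) ℝ)
    (hS : AsympHyperbolic S Sp Sm)
    (h0 : OnlyTrivialSolution (S 0)) (h1 : OnlyTrivialSolution (S 1))
    (hdim : ∀ l, Module.finrank ℝ (posSpace (Sm l)) = k ∧
      Module.finrank ℝ (negSpace (Sp l)) + k = n) :
    IsFredholmPath (fun _ => ⊤) (diffOp hS Set.univ) ∧
    ∃ τ₀ : ℝ, 0 < τ₀ ∧ ∀ τ : ℝ, τ₀ ≤ τ →
      IsFredholmPath (fun l => boundaryDomain (S l) τ) (diffOp hS (Set.Icc (-τ) τ)) ∧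
      parity (fun l => boundaryDomain (S l) τ) (diffOp hS (Set.Icc (-τ) τ)) =
        parity (fun _ => ⊤) (diffOp hS Set.univ) := by
  have hcont : ∀ t, Continuous fun l => S l t := fun t =>
    hS.continuous.comp (by fun_prop : Continuous fun l : I => (l, t))
  obtain ⟨A, hA, hAp⟩ := exists_isLyapunov_of_tendstoUniformly hS.tendsto_atTop hcont
    hS.hyperbolic_atTop
  obtain ⟨B, hB, hBm⟩ := exists_isLyapunov_of_tendstoUniformly hS.tendsto_atBot hcont
    hS.hyperbolic_atBot
  obtain ⟨a, ha⟩ := mem_atTop_sets.1 hA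
  obtain ⟨b, hb⟩ := mem_atBot_sets.1 hB
  -- The `1` keeps `τ` positive; `a` and `-b` place both outer half-lines where the Lyapunov
  -- functions are valid for every `l`.
  have key : ∀ τ : ℝ, max 1 (max a (-b)) ≤ τ → ∃ R ι,
      IsFredholmPath (fun l => boundaryDomain (S l) τ) (diffOp hS (Icc (-τ) τ)) ∧
      IsReduction (fun _ => ⊤) (diffOp hS univ) (fun l => boundaryDomain (S l) τ)
        (diffOp hS (Icc (-τ) τ)) R ι := by
    intro τ hτ
    have hτ1 : 0 < τ := one_pos.trans_le ((le_max_left _ _).trans hτ)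
    have hτa : a ≤ τ := (le_max_left a (-b)).trans ((le_max_right _ _).trans hτ)
    have hτb : -τ ≤ b := by
      linarith [(le_max_right a (-b)).trans ((le_max_right 1 _).trans hτ)]
    choose H c hHc hHS using hAp
    choose H' c' hHc' hHS' using hBm
    have hp : ∀ l t, τ ≤ t → IsLyapunov (H l) (c l) (coeff (S l) t) := fun l t ht =>
      hHS l t (ha t (hτa.trans ht))
    have hm : ∀ l t, t ≤ -τ → IsLyapunov (H' l) (c' l) (coeff (S l) t) := fun l t ht =>
      hHS' l t (hb t (ht.trans hτb))
    obtain ⟨R, hR⟩ := exists_restrict_W12 n (Icc (-τ) τ)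
    obtain ⟨ι, hι⟩ := exists_extendZero n (measurableSet_Icc (a := -τ) (b := τ))
    refine ⟨R, ι, hS.isFredholmPath_boundary hτ1 (fun l => ⟨_, _, hp l⟩) (fun l => ⟨_, _, hm l⟩)
      (fun l => ?_) h0 h1,
      hS.isReduction hτ1 (fun l => ⟨_, _, hp l⟩) (fun l => ⟨_, _, hm l⟩) hR hι⟩
    rw [hS.finrank_stableSpace (hp l) (hHc l), hS.finrank_unstableSpace (hm l) (hHc' l),
      (hdim l).1, add_comm, (hdim l).2]
  -- Admissibility on the line is inherited from a single interval, the smallest one allowed.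
  have hline : IsFredholmPath (fun _ => ⊤) (diffOp hS univ) := by
    obtain ⟨R, ι, h2, h3⟩ := key _ le_rfl
    exact h3.isFredholmPath h2 (hS.continuous_diffOp univ)
      ⟨fun _ => ContinuousLinearMap.id ℝ _, continuous_const, fun _ =>
        ⟨fun _ => trivial, fun _ _ => rfl⟩⟩
  refine ⟨hline, max 1 (max a (-b)), one_pos.trans_le (le_max_left _ _), fun τ hτ => ?_⟩
  obtain ⟨R, ι, h2, h3⟩ := key τ hτ
  exact ⟨h2, h3.parity_eq hline h2⟩
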